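/- Let $n\ge 0$, let $k$ be an infinite field, and let $X=GL_{2n}(k)/Sp_{2n}(k)$, identified by $g\,Sp_{2n}\mapsto gJg^{t}$ ($J$ the matrix of the symplectic form) with the nondegenerate alternating $2n\times 2n$ matrices. Let $B$ be the group of upper triangular matrices in $GL_{2n}(k)$ and $W=S_{2n}$ with simple reflections $s_i=(i,\,i+1)$. On the dual side let $G^\vee=GL_{2n}(\mathbb C)$, let $B^\vee$ be its upper triangular Borel subgroup with Lie algebra $\mathfrak b^\vee$, $\mathcal B=G^\vee/B^\vee$, $H=\left\{\begin{pmatrix} g&a\\0&g\end{pmatrix}: g\in GL_n,\ a\in M_n\right\}$ with Lie algebra $\mathfrak h=\left\{\begin{pmatrix} x&a\\0&x\end{pmatrix}\right\}$, and $\psi\begin{pmatrix} x&a\\0&x\end{pmatrix}=\operatorname{tr}(a)$. With $\mathfrak g^\vee=\mathfrak{gl}_{2n}(\mathbb C)$ and the coadjoint action on $\mathfrak g^{\vee *}$ put $$\Lambda=\{(g_1H,g_2B^\vee,\phi)\in G^\vee/H\times\mathcal B\times\mathfrak g^{\vee*}:\ (g_1^{-1}\phi)|_{\mathfrak h}=\psi,\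 (g_2^{-1}\phi)|_{\mathfrak b^\vee}=0\},$$ with projection $\tau:\Lambda\to G^\vee/H\times\mathcal B$. A $G^\vee$-orbit on $G^\vee/H\times\mathcal B$ is called relevant if it lies in the image of $\tau$. Such orbits are identified with Borel orbits on $G^\vee/H$ by $B^\vee y\leftrightarrow G^\vee (y,B^\vee)$. Simple reflections act on the Borel orbits of $X$ and of $G^\vee/H$ by Knop's action. For $s$ a simple reflection and $O$ a relevant orbit put $s*O=sO$ if $sO$ is relevant and $s*O=O$ otherwise. The weak Bruhat order on Borel orbits is: $O\le O'$ if there are simple reflections $t_1,\dots,t_r$ ($r\ge 0$) with $O'=t_1\cdots t_rO$ and such that for each $1\le j\le r$ the Zariski closure of $t_j\cdots t_rO$ contains $t_{j+1}\cdots t_rO$; on relevant orbits we take the restriction of the weak Bruhat order on the Borel orbits of $G^\vee/H$. Then the following hold. (1) Each $B$-orbit on $X$ contains exactly one of the antisymmetric monomial matrices $m_P$, where $P$ runs over the perfect matchings of $\{1,\dots,2n\}$ and $(m_P)_{ij}=1$ for $i<j$, $\{i,j\}\in P$, $(m_P)_{ij}=-1$ for $i>j$, $\{i,j\}\in P$,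 and $(m_P)_{ij}=0$ otherwise; and each $m_P$ lies in exactly one orbit. The relevant orbits are also indexed bijectively by the perfect matchings: to $P$ corresponds the orbit of $(\sigma H,B^\vee)$, where $\sigma\in S_{2n}$ (the matrix $e_j\mapsto e_{\sigma(j)}$) satisfies $\sigma(i)>\sigma(i+n)$ for $1\le i\le n$ and $P=\{\{\sigma(i),\sigma(i+n)\}: 1\le i\le n\}$. (2) The number of $B$-orbits on $X$, the number of relevant orbits and the number of irreducible components of $\Lambda$ (in the Zariski topology) are all equal to $(2n-1)!!$ (with $(-1)!!=1$). (3) The map $\Phi_X$ that sends the $B$-orbit on $X$ of a perfect matching $P$ to the relevant orbit of $P$ is a bijection from $B\backslash X$ onto the set of relevant $G^\vee$-orbits on $G^\vee/H\times\mathcal B$. (4) Knop's action of the simple reflections on $B\backslash X$, and the operation $*$ of the simple reflections on the relevant orbits, extend to actions of the group $W$ (so $w*O=s_{i_1}*(\cdots *(s_{i_r}*O))$ is independent of the factorization $w=s_{i_1}\cdots s_{i_r}$), and $\Phi_X(wO)=w*\Phi_X(O)$ for all $w\in W$ and $O\in B\backslash X$. (5) $\Phi_X$ reverses the weak Bruhat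 order: $O\le O'$ if and only if $\Phi_X(O')\le\Phi_X(O)$, for all $O,O'\in B\backslash X$. -/

import Mathlib

open scoped Matrix Topology

noncomputable section

namespace SpDual

/-! ### Borel subgroup, minimal parabolics, homogeneous spaces of `GL_m` -/

/-- The subgroup of `GL_m(k)` of matrices whose `(a, c)` entry vanishes whenever `b c < b a`. -/
def parabolic (k : Type*) [Field k] {m : ℕ} (b : Fin m → ℕ) : Subgroup (GL (Fin m) k) where
  carrier := {g | (g : Matrix (Fin m) (Fin m) k).BlockTriangular b}
  one_mem' := Matrix.blockTriangular_one
  mul_mem' := fun {x y} hx hy => by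
    have h := Matrix.BlockTriangular.mul (M := (x : Matrix (Fin m) (Fin m) k))
      (N := (y : Matrix (Fin m) (Fin m) k)) hx hy
    simpa using h
  inv_mem' := fun {x} hx => by
    have : Invertible (x : Matrix (Fin m) (Fin m) k) := x.invertible
    have h := Matrix.blockTriangular_inv_of_blockTriangular
      (M := (x : Matrix (Fin m) (Fin m) k)) hx
    simpa using h

/-- The Borel subgroup of upper triangular matrices. -/
def borel (k : Type*) [Field k] (m : ℕ) : Subgroup (GL (Fin m) k) :=
  parabolic k (fun a : Fin m => (a : ℕ))

/-- The minimal parabolic subgroup `P_s ⊇ B` attached to the simple reflection `s = (i, i+1)`: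
upper triangular except for the entry `(i+1, i)`. -/
def minParabolic (k : Type*) [Field k] {m : ℕ} (i : Fin (m - 1)) : Subgroup (GL (Fin m) k) :=
  parabolic k (fun a : Fin m => if (a : ℕ) = i + 1 then (i : ℕ) else a)

/-- The simple reflection `(i, i+1)` of the Weyl group `S_m`. -/
def simpleRefl {m : ℕ} (i : Fin (m - 1)) : Equiv.Perm (Fin m) :=
  Equiv.swap ⟨i, by omega⟩ ⟨i + 1, by omega⟩

/-- The Zariski topology on a set `E` with affine coordinates `c : E → k^σ`: the nonvanishing
loci of polynomials in the coordinates form a basis. -/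
abbrev zariski (k : Type*) [Field k] {σ E : Type*} (c : E → σ → k) : TopologicalSpace E :=
  TopologicalSpace.generateFrom
    {U | ∃ p : MvPolynomial σ k, U = {x | MvPolynomial.eval (c x) p ≠ 0}}

/-- The Zariski topology on `GL_m(k)` (inverting the determinant adds no open sets). -/
abbrev zariskiGL (k : Type*) [Field k] (m : ℕ) : TopologicalSpace (GL (Fin m) k) :=
  zariski k (fun (g : GL (Fin m) k) (ij : Fin m × Fin m) => g ij.1 ij.2)

section Homogeneous

variable {k : Type*} [Field k] {m : ℕ} (K : Subgroup (GL (Fin m) k))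

/-- The Zariski topology on `GL_m / K`. -/
abbrev zariskiQuot : TopologicalSpace (GL (Fin m) k ⧸ K) :=
  TopologicalSpace.coinduced (QuotientGroup.mk : GL (Fin m) k → GL (Fin m) k ⧸ K) (zariskiGL k m)

/-- The set `B \ (GL_m / K)` of Borel orbits. -/
abbrev BorelOrbits : Type _ :=
  MulAction.orbitRel.Quotient (borel k m) (GL (Fin m) k ⧸ K)

/-- The Borel orbit of a point. -/
def borelOrbit (y : GL (Fin m) k ⧸ K) : BorelOrbits K := Quotient.mk'' y

/-- The set of `GL_m`-orbits on `GL_m / K × 𝓑`, where `𝓑 = GL_m / B` is the flag variety. -/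
abbrev FlagOrbits : Type _ :=
  MulAction.orbitRel.Quotient (GL (Fin m) k)
    ((GL (Fin m) k ⧸ K) × (GL (Fin m) k ⧸ borel k m))

/-- The `GL_m`-orbit of a point of `GL_m / K × 𝓑`. -/
def flagOrbit (p : (GL (Fin m) k ⧸ K) × (GL (Fin m) k ⧸ borel k m)) : FlagOrbits K :=
  Quotient.mk'' p

variable {K}

/-- The map `B y ↦ G (y, B)` from Borel orbits to `G`-orbits on `GL_m / K × 𝓑`. -/
def toFlagOrbit : BorelOrbits K → FlagOrbits K :=
  Quotient.lift (fun y => flagOrbit K (y, QuotientGroup.mk 1)) (by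
    rintro y z ⟨b, rfl⟩
    refine Quotient.sound' ⟨(b : GL (Fin m) k), ?_⟩
    refine Prod.ext rfl ?_
    change ((b : GL (Fin m) k) • (QuotientGroup.mk 1 : GL (Fin m) k ⧸ borel k m)) = _
    rw [← QuotientGroup.mk_mul_of_mem (1 : GL (Fin m) k) b.2]
    simp [MulAction.Quotient.smul_mk])

theorem toFlagOrbit_bijective : Function.Bijective (toFlagOrbit (K := K)) := by
  constructor
  · intro O O' h
    induction O using Quotient.inductionOn' with | h y => ?_
    induction O' using Quotient.inductionOn' with | h z => ?_
    obtain ⟨g, hg⟩ := Quotient.exact' h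
    have h1 : g • z = y := congrArg Prod.fst hg
    have h2 : g • (QuotientGroup.mk 1 : GL (Fin m) k ⧸ borel k m) = QuotientGroup.mk 1 :=
      congrArg Prod.snd hg
    have h3 : g ∈ borel k m := by
      rw [MulAction.Quotient.smul_mk, eq_comm, QuotientGroup.eq] at h2
      simpa using h2
    exact Quotient.sound' ⟨⟨g, h3⟩, h1⟩
  · intro O
    induction O using Quotient.inductionOn' with | h p => ?_
    obtain ⟨y, f⟩ := p
    induction f using Quotient.inductionOn' with | h g => ?_
    refine ⟨borelOrbit K (g⁻¹ • y), Quotient.sound' ⟨g⁻¹, ?_⟩⟩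
    refine Prod.ext rfl ?_
    change g⁻¹ • (QuotientGroup.mk g : GL (Fin m) k ⧸ borel k m) = QuotientGroup.mk 1
    simp [MulAction.Quotient.smul_mk]

/-- The identification of Borel orbits on `GL_m / K` with `G`-orbits on `GL_m / K × 𝓑`. -/
def flagEquiv : BorelOrbits K ≃ FlagOrbits K :=
  Equiv.ofBijective toFlagOrbit toFlagOrbit_bijective

/-! ### Knop's action of simple reflections, and the weak Bruhat order -/

/-- Two Borel orbits lie in the same `P_s`-orbit. -/
def SameParabolicOrbit (i : Fin (m - 1)) (O O' : BorelOrbits K) : Prop :=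
  ∃ y ∈ O.orbit, ∃ p ∈ minParabolic k i, p • y ∈ O'.orbit

/-- The stabilizer in `P_s` of a point of `O` is contained in `B`; equivalently it fixes the
corresponding point of `P_s / B ≅ ℙ¹`. -/
def FixedType (i : Fin (m - 1)) (O : BorelOrbits K) : Prop :=
  ∀ y ∈ O.orbit, ∀ p ∈ minParabolic k i, p • y = y → p ∈ borel k m

/-- The simple reflection `s` interchanges the distinct Borel orbits `O` and `O'`. The Borel
orbits in `P_s y` are the orbits of the stabilizer `(P_s)_y` on `P_s / B ≅ ℙ¹`. There are four
types: one orbit (type `G`); a fixed point and its complement (type `U`); two fixed points and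
their complement (type `T`); a two-point orbit and its complement (type `N`). The reflection
interchanges the two orbits in type `U`, interchanges the two fixed points in type `T`, and
does nothing else. -/
def Swapped (i : Fin (m - 1)) (O O' : BorelOrbits K) : Prop :=
  O ≠ O' ∧ SameParabolicOrbit i O O' ∧
    ((FixedType i O ∧ FixedType i O') ∨
      ((FixedType i O ∨ FixedType i O') ∧
        ∀ O'' : BorelOrbits K, SameParabolicOrbit i O O'' → O'' = O ∨ O'' = O'))

open Classical in
/-- Knop's action of a simple reflection on the set of Borel orbits. -/
def knopRefl (i : Fin (m - 1)) (O : BorelOrbits K) : BorelOrbits K :=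
  if h : ∃ O', Swapped i O O' then h.choose else O

/-- The weak Bruhat order on Borel orbits: `O ≤ O'` if `O' = s_1 ⋯ s_r O` with simple
reflections such that each orbit `s_j ⋯ s_r O` contains `s_{j+1} ⋯ s_r O` in its Zariski
closure. -/
def WeakLE : BorelOrbits K → BorelOrbits K → Prop :=
  Relation.ReflTransGen fun O O' =>
    ∃ i : Fin (m - 1), O' = knopRefl i O ∧ O.orbit ⊆ closure[zariskiQuot K] O'.orbit

end Homogeneous

/-! ### The symmetric space `X = GL_{2n} / Sp_{2n}` -/

/-- Splitting `{1, …, 2n}` into its first and its second half. -/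
def halves (n : ℕ) : Fin n ⊕ Fin n ≃ Fin (2 * n) :=
  finSumFinEquiv.trans (finCongr (two_mul n).symm)

/-- The Gram matrix of the standard symplectic form. -/
def sympForm (k : Type*) [Field k] (n : ℕ) : Matrix (Fin (2 * n)) (Fin (2 * n)) k :=
  Matrix.reindex (halves n) (halves n) (Matrix.J (Fin n) k)

/-- `Sp_{2n}(k)`, the stabilizer of the form under `g ↦ g J gᵀ`. -/
def Sp (k : Type*) [Field k] (n : ℕ) : Subgroup (GL (Fin (2 * n)) k) where
  carrier := {g | (g : Matrix _ _ k) * sympForm k n * (g : Matrix _ _ k)ᵀ = sympForm k n}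
  one_mem' := by simp
  mul_mem' := fun {x y} hx hy => by
    simp only [Set.mem_ofPred_eq, Units.val_mul, Matrix.transpose_mul] at *
    calc _ = (x : Matrix (Fin (2 * n)) (Fin (2 * n)) k) * ((y : Matrix _ _ k) * sympForm k n * (y : Matrix _ _ k)ᵀ)
              * (x : Matrix (Fin (2 * n)) (Fin (2 * n)) k)ᵀ := by simp only [Matrix.mul_assoc]
      _ = _ := by rw [hy, hx]
  inv_mem' := fun {x} hx => by
    simp only [Set.mem_ofPred_eq] at *
    have h1 : ((x⁻¹ : GL (Fin (2 * n)) k) : Matrix (Fin (2 * n)) (Fin (2 * n)) k) * (x : Matrix (Fin (2 * n)) (Fin (2 * n)) k) = 1 := x.inv_mul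
    have h2 : (x : Matrix (Fin (2 * n)) (Fin (2 * n)) k)ᵀ * ((x⁻¹ : GL (Fin (2 * n)) k) : Matrix (Fin (2 * n)) (Fin (2 * n)) k)ᵀ = 1 := by
      rw [← Matrix.transpose_mul, h1, Matrix.transpose_one]
    calc _ = ((x⁻¹ : GL (Fin (2 * n)) k) : Matrix (Fin (2 * n)) (Fin (2 * n)) k) *
              ((x : Matrix (Fin (2 * n)) (Fin (2 * n)) k) * sympForm k n * (x : Matrix (Fin (2 * n)) (Fin (2 * n)) k)ᵀ) *
              ((x⁻¹ : GL (Fin (2 * n)) k) : Matrix (Fin (2 * n)) (Fin (2 * n)) k)ᵀ := by rw [hx]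
      _ = (((x⁻¹ : GL (Fin (2 * n)) k) : Matrix (Fin (2 * n)) (Fin (2 * n)) k) * (x : Matrix (Fin (2 * n)) (Fin (2 * n)) k)) * sympForm k n *
            ((x : Matrix (Fin (2 * n)) (Fin (2 * n)) k)ᵀ * ((x⁻¹ : GL (Fin (2 * n)) k) : Matrix (Fin (2 * n)) (Fin (2 * n)) k)ᵀ) := by
          simp only [Matrix.mul_assoc]
      _ = _ := by rw [h1, h2, Matrix.one_mul, Matrix.mul_one]

/-- Perfect matchings of `{1, …, 2n}`: partitions into pairs. -/
def Matching (n : ℕ) : Type :=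
  {P : Finpartition (Finset.univ : Finset (Fin (2 * n))) // ∀ p ∈ P.parts, p.card = 2}

/-- The antisymmetric monomial matrix of a perfect matching: the entries above the diagonal
whose index pair is matched are `1`, the ones below the diagonal `-1`, all others `0`. -/
def monomial (k : Type*) [Field k] {n : ℕ} (P : Matching n) :
    Matrix (Fin (2 * n)) (Fin (2 * n)) k :=
  Matrix.of fun i j =>
    if ({i, j} : Finset (Fin (2 * n))) ∈ P.1.parts then (if i < j then 1 else -1) else 0

/-- Under the identification `g Sp_{2n} ↦ g J gᵀ` of `X` with the nondegenerate antisymmetric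
matrices, the Borel orbit `O` contains the monomial matrix of the matching `P`. -/
def LabelX {k : Type*} [Field k] {n : ℕ} (O : BorelOrbits (Sp k n)) (P : Matching n) : Prop :=
  ∃ g : GL (Fin (2 * n)) k,
    (g : Matrix _ _ k) * sympForm k n * (g : Matrix _ _ k)ᵀ = monomial k P ∧
      O = borelOrbit (Sp k n) (QuotientGroup.mk g)

/-! ### The dual side: `G^∨ = GL_{2n}(ℂ)` -/

/-- The block matrix `(g a; 0 g)`. -/
def blockH {n : ℕ} (g a : Matrix (Fin n) (Fin n) ℂ) : Matrix (Fin (2 * n)) (Fin (2 * n)) ℂ :=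
  Matrix.reindex (halves n) (halves n) (Matrix.fromBlocks g a 0 g)

theorem blockH_mul {n : ℕ} (g a g' a' : Matrix (Fin n) (Fin n) ℂ) :
    blockH g a * blockH g' a' = blockH (g * g') (g * a' + a * g') := by
  simp [blockH, Matrix.submatrix_mul_equiv, Matrix.fromBlocks_multiply]

theorem blockH_one {n : ℕ} : blockH (1 : Matrix (Fin n) (Fin n) ℂ) 0 = 1 := by
  simp [blockH]

/-- The subgroup `H` of all matrices `(g a; 0 g)` with `g ∈ GL_n`, `a ∈ M_n`. -/
def H (n : ℕ) : Subgroup (GL (Fin (2 * n)) ℂ) where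
  carrier := {x | ∃ (g : GL (Fin n) ℂ) (a : Matrix (Fin n) (Fin n) ℂ),
    (x : Matrix _ _ ℂ) = blockH (g : Matrix _ _ ℂ) a}
  one_mem' := ⟨1, 0, by simp [blockH_one]⟩
  mul_mem' := by
    rintro x y ⟨g, a, hx⟩ ⟨g', a', hy⟩
    exact ⟨g * g', _, by rw [Units.val_mul, hx, hy, blockH_mul, Units.val_mul]⟩
  inv_mem' := by
    rintro x ⟨g, a, hx⟩
    refine ⟨g⁻¹, -((g⁻¹ : GL (Fin n) ℂ) : Matrix (Fin n) (Fin n) ℂ) * a * ((g⁻¹ : GL (Fin n) ℂ) : Matrix (Fin n) (Fin n) ℂ), ?_⟩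
    apply Units.inv_eq_of_mul_eq_one_right
    have h : (g : Matrix (Fin n) (Fin n) ℂ) * ((g⁻¹ : GL (Fin n) ℂ) : Matrix (Fin n) (Fin n) ℂ) = 1 := g.mul_inv
    rw [hx, blockH_mul, h, ← blockH_one]
    congr 1
    rw [← Matrix.mul_assoc, ← Matrix.mul_assoc, Matrix.mul_neg, h]
    simp

/-- `φ ∈ 𝔤^*` satisfies `(g⁻¹ φ)|_𝔥 = ψ`, where `𝔥` consists of the matrices `(x a; 0 x)` with
`x, a ∈ M_n`, `ψ (x a; 0 x) = tr a`, and `G^∨` acts on `𝔤^*` by the coadjoint action. -/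
def RestrictsToPsi {n : ℕ} (g : GL (Fin (2 * n)) ℂ)
    (φ : Module.Dual ℂ (Matrix (Fin (2 * n)) (Fin (2 * n)) ℂ)) : Prop :=
  ∀ x a : Matrix (Fin n) (Fin n) ℂ,
    φ ((g : Matrix _ _ ℂ) * blockH x a * ((g⁻¹ : GL _ ℂ) : Matrix _ _ ℂ)) = a.trace

/-- `φ ∈ 𝔤^*` satisfies `(g⁻¹ φ)|_𝔟 = 0`, where `𝔟` consists of the upper triangular
matrices. -/
def VanishesOnBorel {n : ℕ} (g : GL (Fin (2 * n)) ℂ)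
    (φ : Module.Dual ℂ (Matrix (Fin (2 * n)) (Fin (2 * n)) ℂ)) : Prop :=
  ∀ x : Matrix (Fin (2 * n)) (Fin (2 * n)) ℂ, x.BlockTriangular id →
    φ ((g : Matrix _ _ ℂ) * x * ((g⁻¹ : GL _ ℂ) : Matrix _ _ ℂ)) = 0

/-- The ambient space `G^∨/H × 𝓑 × 𝔤^*`. -/
abbrev Ambient (n : ℕ) : Type :=
  (GL (Fin (2 * n)) ℂ ⧸ H n) × (GL (Fin (2 * n)) ℂ ⧸ borel ℂ (2 * n)) ×
    Module.Dual ℂ (Matrix (Fin (2 * n)) (Fin (2 * n)) ℂ)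

/-- `Λ = M^∨ ×_{𝔤^*} T^*𝓑` as a subset of `G^∨/H × 𝓑 × 𝔤^*`. -/
def Lam (n : ℕ) : Set (Ambient n) :=
  {p | ∃ g₁ g₂ : GL (Fin (2 * n)) ℂ, p.1 = QuotientGroup.mk g₁ ∧ p.2.1 = QuotientGroup.mk g₂ ∧
    RestrictsToPsi g₁ p.2.2 ∧ VanishesOnBorel g₂ p.2.2}

/-- The projection `τ : Λ → G^∨/H × 𝓑`. -/
def tau {n : ℕ} (p : Lam n) :
    (GL (Fin (2 * n)) ℂ ⧸ H n) × (GL (Fin (2 * n)) ℂ ⧸ borel ℂ (2 * n)) :=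
  (p.1.1, p.1.2.1)

/-- The Zariski topology on `G^∨ × G^∨ × 𝔤^*`. The coordinates are the entries of the two
matrices and the values of the functional on the matrix units. -/
abbrev zariskiTriple (n : ℕ) : TopologicalSpace (GL (Fin (2 * n)) ℂ × GL (Fin (2 * n)) ℂ ×
    Module.Dual ℂ (Matrix (Fin (2 * n)) (Fin (2 * n)) ℂ)) :=
  zariski ℂ (σ := (Fin (2 * n) × Fin (2 * n)) ⊕ (Fin (2 * n) × Fin (2 * n)) ⊕
      (Fin (2 * n) × Fin (2 * n))) fun p =>
    Sum.elim (fun ij => p.1 ij.1 ij.2) (Sum.elim (fun ij => p.2.1 ij.1 ij.2)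
      (fun ij => p.2.2 (Matrix.single ij.1 ij.2 1)))

/-- The Zariski topology on `G^∨/H × 𝓑 × 𝔤^*`, the quotient of that on `G^∨ × G^∨ × 𝔤^*`. -/
abbrev zariskiAmbient (n : ℕ) : TopologicalSpace (Ambient n) :=
  TopologicalSpace.coinduced
    (fun p : GL (Fin (2 * n)) ℂ × GL (Fin (2 * n)) ℂ ×
        Module.Dual ℂ (Matrix (Fin (2 * n)) (Fin (2 * n)) ℂ) =>
      ((QuotientGroup.mk p.1, QuotientGroup.mk p.2.1, p.2.2) : Ambient n))
    (zariskiTriple n)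

/-- The Zariski topology on `Λ`. -/
abbrev zariskiLam (n : ℕ) : TopologicalSpace (Lam n) :=
  TopologicalSpace.induced Subtype.val (zariskiAmbient n)

/-- A `G^∨`-orbit on `G^∨/H × 𝓑` is relevant if it is in the image of `τ`. -/
def IsRelevant {n : ℕ} (O : FlagOrbits (H n)) : Prop :=
  ∃ p : Lam n, flagOrbit (H n) (tau p) = O

/-- The set of relevant `G^∨`-orbits on `G^∨/H × 𝓑`. -/
def RelevantOrbits (n : ℕ) : Type := {O : FlagOrbits (H n) // IsRelevant O}

/-- The relevant orbit `O` is the orbit of `(σ H, B^∨)` for a permutation `σ` with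
`σ(i) > σ(i + n)` for `1 ≤ i ≤ n`, and the pairs `{σ(i), σ(i + n)}` are those of the matching
`P`. Here `σ` is identified with the matrix that maps `e_j` to `e_{σ(j)}`. -/
def LabelR {n : ℕ} (O : RelevantOrbits n) (P : Matching n) : Prop :=
  ∃ (σ : Equiv.Perm (Fin (2 * n))) (w : GL (Fin (2 * n)) ℂ),
    (∀ i : Fin n, σ (halves n (Sum.inr i)) < σ (halves n (Sum.inl i))) ∧
    (∀ i : Fin n, ({σ (halves n (Sum.inl i)), σ (halves n (Sum.inr i))} : Finset (Fin (2 * n)))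
      ∈ P.1.parts) ∧
    (∀ i j, w i j = if i = σ j then 1 else 0) ∧
    O.1 = flagOrbit (H n) (QuotientGroup.mk w, QuotientGroup.mk 1)

open Classical in
/-- The modified action of a simple reflection: `s * O = s O` if `s O` is relevant, and
`s * O = O` otherwise. -/
def starRefl {n : ℕ} (i : Fin (2 * n - 1)) (O : RelevantOrbits n) : RelevantOrbits n :=
  if h : IsRelevant (flagEquiv (knopRefl i (flagEquiv.symm O.1))) then ⟨_, h⟩ else O

/-- The weak Bruhat order on Borel orbits of `G^∨/H`, restricted to the relevant orbits. -/
def RelevantLE {n : ℕ} (O O' : RelevantOrbits n) : Prop :=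
  WeakLE (flagEquiv.symm O.1) (flagEquiv.symm O'.1)

end SpDual

end

namespace SpDual

/-! ### The Zariski topology -/

section Zariski

variable {k : Type*} [Field k]

/-! Everything is compared with the set `FreeInv n` of fixed point free involutions `π` of `{1, …,
2n}`, on which the symmetric group acts by conjugation.

On `X`, the Borel group acts on alternating matrices `g J gᵀ` by congruence. Symplectic Gaussian
elimination with upper triangular matrices brings such a matrix to monomial shape, and the torus
normalizes its entries, so every orbit is some `orbX k π`. On the dual side `H` is the centralizer
of a square-zero matrix of rank `n`, so `G/H` is its conjugacy class. The trace form turns `φ` into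
a matrix `Y`, the condition on `𝔥` becomes `N Y + Y N = 1` (`forall_trace_blockH_iff`), and the
condition on `𝔟` says that `Y` is strictly upper triangular at the standard flag. Elimination splits
`N` into links `e_l ↦ e_i`. The existence of `Y` forces `l < i` in each link, so the relevant orbits
are exactly the `orbH π`, where `N` sends the smaller element of each pair to the larger one.
Different `π` are separated by ranks of corner blocks. These are invariant under the Borel group and
can only drop in a closure, so they also make closure inclusion antisymmetric.

For Knop's action compare `π i` with `π (i + 1)`. If `i` and `i + 1` are not partners, both sides
have one open and one closed orbit in the `P_s`-orbit, interchanged by `s`, with parameters `π` and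
`s π s`. On `X` the open one has `π i < π (i + 1)`, on the dual side it has `π (i + 1) < π i`, and
this is why the order is reversed. If `i` and `i + 1` are partners, `s` fixes the orbit on `X`. On
the dual side it leads from the relevant orbit, which is open, down to an irrelevant one, so `s * O
= O`. Such a step is never upward, hence an upward chain that starts at a relevant orbit meets only
relevant orbits (`weakLE_orbH_iff`).

`Λ` is the disjoint union of its strata over the relevant orbits. Each stratum is the image of `GL ×
affine space`, hence irreducible. The closures are pairwise incomparable because all strata have the
same dimension: the slice over the standard flag is parametrized birationally by `2n²` free
parameters, whatever `π` is. An inclusion of closures therefore gives equal vanishing ideals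
(`ker_eq_of_trdeg_le`), thus equal corner ranks, thus equal `π`. -/

theorem exists_poly_of_isOpen_zariski {σ E : Type*} {c : E → σ → k} {U : Set E}
    (hU : IsOpen[zariski k c] U) {x : E} (hx : x ∈ U) :
    ∃ p : MvPolynomial σ k, MvPolynomial.eval (c x) p ≠ 0 ∧
      ∀ y, MvPolynomial.eval (c y) p ≠ 0 → y ∈ U := by
  induction hU with
  | basic s hs =>
    obtain ⟨p, rfl⟩ := hs
    exact ⟨p, hx, fun y hy => hy⟩
  | univ => exact ⟨1, by simp, fun _ _ => trivial⟩
  | inter s t _ _ hs ht =>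
    obtain ⟨p, hp, hp'⟩ := hs hx.1
    obtain ⟨q, hq, hq'⟩ := ht hx.2
    refine ⟨p * q, by simp [hp, hq], fun y hy => ?_⟩
    rw [map_mul] at hy
    exact ⟨hp' y (left_ne_zero_of_mul hy), hq' y (right_ne_zero_of_mul hy)⟩
  | sUnion S _ ih =>
    obtain ⟨s, hs, hxs⟩ := hx
    obtain ⟨p, hp, hp'⟩ := ih s hs hxs
    exact ⟨p, hp, fun y hy => ⟨s, hs, hp' y hy⟩⟩

theorem isClosed_zariski_zeroLocus {σ E : Type*} (c : E → σ → k) (p : MvPolynomial σ k) :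
    IsClosed[zariski k c] {x | MvPolynomial.eval (c x) p = 0} := by
  let _ := zariski k c
  rw [← isOpen_compl_iff]
  exact TopologicalSpace.isOpen_generateFrom_of_mem ⟨p, rfl⟩

theorem continuous_zariski {σ E σ' E' : Type*} {c : E → σ → k} {c' : E' → σ' → k} {f : E → E'}
    (h : ∀ s, ∃ p : MvPolynomial σ k, ∀ x, c' (f x) s = MvPolynomial.eval (c x) p) :
    Continuous[zariski k c, zariski k c'] f := by
  choose q hq using h
  let _ := zariski k c
  refine continuous_generateFrom_iff.2 ?_
  rintro _ ⟨p, rfl⟩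
  refine TopologicalSpace.isOpen_generateFrom_of_mem ⟨MvPolynomial.bind₁ q p, ?_⟩
  ext x
  have : c' (f x) = fun s => MvPolynomial.eval (c x) (q s) := funext fun s => hq s x
  simp only [Set.mem_preimage, Set.mem_ofPred_eq, this]
  rw [← MvPolynomial.coe_aeval_eq_eval (c x), RingHom.coe_coe, MvPolynomial.aeval_bind₁]
  rfl

/-- The numerator of the value of the polynomial `f` at the fractions `num s / Δ`, over the
denominator `Δ ^ f.totalDegree`. -/
def clearDen {σ A : Type*} [CommRing A] [Algebra k A] (num : σ → A) (Δ : A)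
    (f : MvPolynomial σ k) : A :=
  ∑ d ∈ f.support, algebraMap k A (f.coeff d) * (d.prod fun s e => num s ^ e) *
    Δ ^ (f.totalDegree - d.sum fun _ e => e)

/-- Vanishing of a polynomial at a point with fractional coordinates becomes vanishing of a
polynomial expression in numerators and denominator. It serves both for continuity of rational maps
and for the generic point of a slice. -/
theorem aeval_mul_pow_eq_clearDen {σ A K : Type*} [CommRing A] [Algebra k A] [Field K]
    [Algebra k K] (φ : A →ₐ[k] K) (num : σ → A) {Δ : A} (hΔ : φ Δ ≠ 0) (f : MvPolynomial σ k) :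
    MvPolynomial.aeval (fun s => φ (num s) / φ Δ) f * φ Δ ^ f.totalDegree =
      φ (clearDen num Δ f) := by
  rw [clearDen, map_sum, MvPolynomial.aeval_def, MvPolynomial.eval₂_eq, Finset.sum_mul]
  refine Finset.sum_congr rfl fun d hd => ?_
  have hle : (d.sum fun _ e => e) ≤ f.totalDegree := MvPolynomial.le_totalDegree hd
  have h1 : ∏ i ∈ d.support, (φ (num i) / φ Δ) ^ d i =
      (∏ i ∈ d.support, φ (num i) ^ d i) / φ Δ ^ (d.sum fun _ e => e) := by
    simp only [div_pow, Finset.prod_div_distrib, Finsupp.sum, Finset.prod_pow_eq_pow_sum]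
  have h2 : φ Δ ^ f.totalDegree =
      φ Δ ^ (d.sum fun _ e => e) * φ Δ ^ (f.totalDegree - d.sum fun _ e => e) := by
    rw [← pow_add, Nat.add_sub_cancel' hle]
  rw [h1, h2]
  simp only [map_mul, map_pow, AlgHom.commutes, Finsupp.prod, map_prod]
  field_simp

end Zariski

/-! ### Elements of `GL_m` -/

section Elements

variable {k : Type*} [Field k] {m : ℕ}

theorem mem_borel_iff {g : GL (Fin m) k} :
    g ∈ borel k m ↔ ∀ a c : Fin m, c < a → g a c = 0 := Iff.rfl

/-- The index `i` of the simple reflection `(i, i+1)`. -/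
def lo (i : Fin (m - 1)) : Fin m := ⟨i, by omega⟩

/-- The index `i + 1` of the simple reflection `(i, i+1)`. -/
def hi (i : Fin (m - 1)) : Fin m := ⟨i + 1, by omega⟩

theorem simpleRefl_eq (i : Fin (m - 1)) : simpleRefl i = Equiv.swap (lo i) (hi i) := rfl

theorem lo_lt_hi (i : Fin (m - 1)) : lo i < hi i := by simp [lo, hi, Fin.lt_def]

theorem lo_ne_hi (i : Fin (m - 1)) : lo i ≠ hi i := (lo_lt_hi i).ne

theorem hi_lt_of_lo_lt {i : Fin (m - 1)} {a : Fin m} (h : lo i < a) (h' : a ≠ hi i) :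
    hi i < a := by
  simp only [lo, hi, Fin.lt_def, Fin.ext_iff, ne_eq] at *; omega

theorem mem_minParabolic_iff {i : Fin (m - 1)} {g : GL (Fin m) k} :
    g ∈ minParabolic k i ↔ ∀ a c : Fin m, c < a → ¬ (a = hi i ∧ c = lo i) → g a c = 0 := by
  -- The block function gives `i` and `i + 1` the same label, so the only position below the
  -- diagonal that stays free is `(i + 1, i)`.
  have : ∀ a c : Fin m, (if (c : ℕ) = i + 1 then (i : ℕ) else c) <
      (if (a : ℕ) = i + 1 then (i : ℕ) else a) ↔ c < a ∧ ¬ (a = hi i ∧ c = lo i) := by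
    intro a c
    simp only [lo, hi, Fin.lt_def, Fin.ext_iff]
    split_ifs <;> omega
  constructor
  · intro h a c h1 h2
    exact h ((this a c).2 ⟨h1, h2⟩)
  · intro h a c hac
    exact h a c ((this a c).1 hac).1 ((this a c).1 hac).2

theorem borel_le_minParabolic (i : Fin (m - 1)) : borel k m ≤ minParabolic k i := fun _ hg =>
  mem_minParabolic_iff.2 fun a c h _ => mem_borel_iff.1 hg a c h

theorem mem_borel_of_mem_minParabolic {i : Fin (m - 1)} {g : GL (Fin m) k}
    (hg : g ∈ minParabolic k i) (h : g (hi i) (lo i) = 0) : g ∈ borel k m :=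
  mem_borel_iff.2 fun a c hac => by
    by_cases hh : a = hi i ∧ c = lo i
    · rw [hh.1, hh.2, h]
    · exact mem_minParabolic_iff.1 hg a c hac hh

/-- The permutation matrix `e_j ↦ e_{σ j}`. -/
def permGL (k : Type*) [Field k] {m : ℕ} (σ : Equiv.Perm (Fin m)) : GL (Fin m) k where
  val := Matrix.of fun i j => if i = σ j then 1 else 0
  inv := Matrix.of fun i j => if i = σ⁻¹ j then 1 else 0
  val_inv := by
    ext i j
    simp [Matrix.mul_apply, Matrix.one_apply, Equiv.Perm.inv_def]
  inv_val := by
    ext i j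
    simp [Matrix.mul_apply, Matrix.one_apply, Equiv.Perm.inv_def]

theorem permGL_apply (σ : Equiv.Perm (Fin m)) (i j : Fin m) :
    permGL k σ i j = if i = σ j then 1 else 0 := rfl

theorem permGL_inv (σ : Equiv.Perm (Fin m)) : (permGL k σ)⁻¹ = permGL k σ⁻¹ := by
  ext i j; rfl

theorem permGL_mul_apply (σ : Equiv.Perm (Fin m)) (A : Matrix (Fin m) (Fin m) k) (i j : Fin m) :
    ((permGL k σ).1 * A) i j = A (σ⁻¹ i) j := by
  have : ∀ x, i = σ x ↔ x = σ⁻¹ i := fun x => by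
    rw [Equiv.Perm.inv_def, Equiv.eq_symm_apply, eq_comm]
  simp [Matrix.mul_apply, permGL_apply, this]

theorem mul_permGL_apply (σ : Equiv.Perm (Fin m)) (A : Matrix (Fin m) (Fin m) k) (i j : Fin m) :
    (A * (permGL k σ).1) i j = A i (σ j) := by
  simp [Matrix.mul_apply, permGL_apply]

theorem mul_permGL_transpose_apply (σ : Equiv.Perm (Fin m)) (A : Matrix (Fin m) (Fin m) k)
    (i j : Fin m) : (A * (permGL k σ).1ᵀ) i j = A i (σ⁻¹ j) := by
  have : ∀ x, j = σ x ↔ x = σ⁻¹ j := fun x => by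
    rw [Equiv.Perm.inv_def, Equiv.eq_symm_apply, eq_comm]
  simp [Matrix.mul_apply, permGL_apply, this]

/-- The elementary matrix `1 + x E_{ab}`, `a ≠ b`. -/
def elemGL {a b : Fin m} (h : a ≠ b) (x : k) : GL (Fin m) k where
  val := 1 + Matrix.single a b x
  inv := 1 - Matrix.single a b x
  val_inv := by simp [mul_sub, add_mul, h.symm]
  inv_val := by simp [mul_add, sub_mul, h.symm]

theorem coe_elemGL {a b : Fin m} (h : a ≠ b) (x : k) :
    (elemGL h x : Matrix (Fin m) (Fin m) k) = 1 + Matrix.single a b x := rfl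

theorem elemGL_inv {a b : Fin m} (h : a ≠ b) (x : k) : (elemGL h x)⁻¹ = elemGL h (-x) := by
  refine Units.ext ?_
  change 1 - Matrix.single a b x = 1 + Matrix.single a b (-x)
  rw [sub_eq_add_neg]
  congr 1
  ext i j
  simp only [Matrix.neg_apply, Matrix.single_apply]
  split_ifs <;> simp

theorem elemGL_apply {a b : Fin m} (h : a ≠ b) (x : k) (i j : Fin m) :
    elemGL h x i j = (if i = j then 1 else 0) + if a = i ∧ b = j then x else 0 := by
  simp [elemGL, Matrix.one_apply, Matrix.single_apply]

theorem elemGL_mem_borel {a b : Fin m} (h : a < b) (x : k) : elemGL h.ne x ∈ borel k m :=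
  mem_borel_iff.2 fun i j hij => by
    rw [elemGL_apply, if_neg hij.ne', if_neg, add_zero]
    rintro ⟨rfl, rfl⟩
    exact h.asymm hij

theorem elemGL_zero {a b : Fin m} (h : a ≠ b) : elemGL h (0 : k) = 1 := by
  ext i j; simp [elemGL]

theorem mul_elemGL_apply {a b : Fin m} (h : a ≠ b) (x : k) (A : Matrix (Fin m) (Fin m) k)
    (i j : Fin m) : (A * (elemGL h x).1) i j = A i j + if b = j then A i a * x else 0 := by
  rw [coe_elemGL, mul_add, mul_one, Matrix.add_apply]
  congr 1
  split_ifs with hj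
  · subst hj; simp
  · rw [Matrix.mul_single_apply_of_ne]; exact fun h => hj h.symm

/-- The lower unipotent element `1 + x E_{i+1,i}`. -/
def lowGL (i : Fin (m - 1)) (x : k) : GL (Fin m) k := elemGL (lo_ne_hi i).symm x

/-- The permutation matrix of a simple reflection. -/
def reflGL (k : Type*) [Field k] {m : ℕ} (i : Fin (m - 1)) : GL (Fin m) k :=
  permGL k (simpleRefl i)

theorem simpleRefl_inv (i : Fin (m - 1)) : (simpleRefl i)⁻¹ = simpleRefl i :=
  Equiv.swap_inv _ _

theorem reflGL_mul_self (i : Fin (m - 1)) : reflGL k i * reflGL k i = 1 := by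
  nth_rw 1 [reflGL, ← simpleRefl_inv, ← permGL_inv, reflGL]
  exact inv_mul_cancel _

theorem reflGL_mem (i : Fin (m - 1)) : reflGL k i ∈ minParabolic k i :=
  mem_minParabolic_iff.2 fun a c hac h => by
    rw [reflGL, permGL_apply, if_neg]
    intro hs
    rw [simpleRefl_eq] at hs
    rcases eq_or_ne c (lo i) with rfl | h1
    · rw [Equiv.swap_apply_left] at hs; exact h ⟨hs, rfl⟩
    rcases eq_or_ne c (hi i) with rfl | h2
    · rw [Equiv.swap_apply_right] at hs; subst hs; exact (lo_lt_hi i).asymm hac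
    · rw [Equiv.swap_apply_of_ne_of_ne h1 h2] at hs; exact hac.ne' hs

/-- `B \ P_s` is a projective line whose homogeneous coordinates are the entries `(i + 1, i)` and
`(i + 1, i + 1)`. Where the second is nonzero, the lower root subgroup gives an affine chart; the
remaining point is the coset of `s`. -/
theorem exists_eq_borel_mul_low {i : Fin (m - 1)} {p : GL (Fin m) k}
    (hp : p ∈ minParabolic k i) (h : p (hi i) (hi i) ≠ 0) :
    ∃ b ∈ borel k m, ∃ x, p = b * lowGL i x := by
  set x := p (hi i) (lo i) / p (hi i) (hi i) with hx
  refine ⟨p * (lowGL i x)⁻¹, ?_, x, by simp⟩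
  have hinv : (lowGL i x)⁻¹ = lowGL i (-x) := elemGL_inv _ _
  rw [hinv]
  refine mem_borel_iff.2 fun a c hac => ?_
  have key : (p * lowGL i (-x)) a c = p a c + if lo i = c then p a (hi i) * -x else 0 :=
    mul_elemGL_apply (lo_ne_hi i).symm (-x) p.1 a c
  rw [key]
  have hp' := mem_minParabolic_iff.1 hp
  split_ifs with hc
  · subst hc
    by_cases ha : a = hi i
    · subst ha; rw [hx]; field_simp; ring
    · rw [hp' a (lo i) hac (by simp [ha]), hp' a (hi i) (hi_lt_of_lo_lt hac ha) (by simp [ha])]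
      ring
  · rw [hp' a c hac (fun h => hc h.2.symm), add_zero]

theorem exists_eq_borel_mul_refl {i : Fin (m - 1)} {p : GL (Fin m) k}
    (hp : p ∈ minParabolic k i) (h : p (hi i) (hi i) = 0) :
    ∃ b ∈ borel k m, p = b * reflGL k i := by
  refine ⟨p * reflGL k i, ?_, by rw [mul_assoc, reflGL_mul_self, mul_one]⟩
  refine mem_borel_of_mem_minParabolic (i := i) (mul_mem hp (reflGL_mem i)) ?_
  have : (p * reflGL k i) (hi i) (lo i) = p (hi i) (simpleRefl i (lo i)) :=
    mul_permGL_apply (simpleRefl i) p.1 _ _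
  rw [this, simpleRefl_eq, Equiv.swap_apply_left, h]

end Elements

/-! ### Orbits in `GL_m / K` -/

section Orbits

variable {k : Type*} [Field k] {m : ℕ} {K : Subgroup (GL (Fin m) k)}

theorem mem_orbit_borelOrbit {y z : GL (Fin m) k ⧸ K} :
    y ∈ (borelOrbit K z).orbit ↔ ∃ b ∈ borel k m, y = b • z := by
  rw [borelOrbit, MulAction.orbitRel.Quotient.mem_orbit]
  constructor
  · intro h
    obtain ⟨b, hb⟩ := Quotient.exact' h
    exact ⟨b, b.2, hb.symm⟩
  · rintro ⟨b, hb, rfl⟩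
    exact Quotient.sound' ⟨⟨b, hb⟩, rfl⟩

theorem borelOrbit_eq_iff {y z : GL (Fin m) k ⧸ K} :
    borelOrbit K y = borelOrbit K z ↔ ∃ b ∈ borel k m, y = b • z := by
  rw [← mem_orbit_borelOrbit, MulAction.orbitRel.Quotient.mem_orbit]; rfl

theorem borelOrbit_smul {b : GL (Fin m) k} (hb : b ∈ borel k m) (z : GL (Fin m) k ⧸ K) :
    borelOrbit K (b • z) = borelOrbit K z :=
  borelOrbit_eq_iff.2 ⟨b, hb, rfl⟩

theorem exists_borelOrbit_eq (O : BorelOrbits K) :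
    ∃ g : GL (Fin m) k, O = borelOrbit K (QuotientGroup.mk g) := by
  induction O using Quotient.inductionOn' with | h y => ?_
  obtain ⟨g, rfl⟩ := QuotientGroup.mk_surjective y
  exact ⟨g, rfl⟩

theorem sameParabolicOrbit_borelOrbit {i : Fin (m - 1)} {y z : GL (Fin m) k ⧸ K} :
    SameParabolicOrbit i (borelOrbit K y) (borelOrbit K z) ↔ ∃ p ∈ minParabolic k i, p • y = z := by
  constructor
  · rintro ⟨y', hy', p, hp, hpz⟩
    obtain ⟨b, hb, rfl⟩ := mem_orbit_borelOrbit.1 hy'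
    obtain ⟨c, hc, h⟩ := mem_orbit_borelOrbit.1 hpz
    refine ⟨c⁻¹ * (p * b), mul_mem (inv_mem (borel_le_minParabolic i hc))
      (mul_mem hp (borel_le_minParabolic i hb)), ?_⟩
    rw [mul_smul, mul_smul, h, inv_smul_smul]
  · rintro ⟨p, hp, rfl⟩
    exact ⟨y, mem_orbit_borelOrbit.2 ⟨1, one_mem _, (one_smul _ _).symm⟩, p, hp,
      mem_orbit_borelOrbit.2 ⟨1, one_mem _, (one_smul _ _).symm⟩⟩

/-- Stabilizers of points in one Borel orbit are conjugate under `B`, so a single point decides. -/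
theorem fixedType_borelOrbit {i : Fin (m - 1)} {z : GL (Fin m) k ⧸ K}
    (h : ∀ p ∈ minParabolic k i, p • z = z → p ∈ borel k m) : FixedType i (borelOrbit K z) := by
  intro y hy p hp hpy
  obtain ⟨b, hb, rfl⟩ := mem_orbit_borelOrbit.1 hy
  have hb' := borel_le_minParabolic i hb
  have := h (b⁻¹ * (p * b)) (mul_mem (inv_mem hb') (mul_mem hp hb'))
    (by rw [mul_smul, mul_smul, hpy, inv_smul_smul])
  have h2 := mul_mem (mul_mem hb this) (inv_mem hb)
  simpa [mul_assoc] using h2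

/-- The lower unipotent root subgroup maps the point `z` into its Borel orbit: the Borel orbit
of `z` is dense in the orbit of the minimal parabolic subgroup. -/
def IsOpenType (i : Fin (m - 1)) (z : GL (Fin m) k ⧸ K) : Prop :=
  ∀ x : k, ∃ b ∈ borel k m, lowGL i x • z = b • z

/-- By the decomposition of `P_s` into `B U⁻` and `B s`, the orbit `P_s z` contains no Borel orbits
besides those of `z` and `s z`. -/
theorem IsOpenType.smul_eq_or {i : Fin (m - 1)} {z : GL (Fin m) k ⧸ K} (hz : IsOpenType i z)
    {p : GL (Fin m) k} (hp : p ∈ minParabolic k i) :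
    borelOrbit K (p • z) = borelOrbit K z ∨
      borelOrbit K (p • z) = borelOrbit K (reflGL k i • z) := by
  by_cases h : p (hi i) (hi i) = 0
  · obtain ⟨b, hb, rfl⟩ := exists_eq_borel_mul_refl hp h
    rw [mul_smul, borelOrbit_smul hb]
    exact Or.inr rfl
  · obtain ⟨b, hb, x, rfl⟩ := exists_eq_borel_mul_low hp h
    obtain ⟨c, hc, hx⟩ := hz x
    rw [mul_smul, borelOrbit_smul hb, hx, borelOrbit_smul hc]
    exact Or.inl rfl

theorem IsOpenType.sameParabolicOrbit {i : Fin (m - 1)} {z : GL (Fin m) k ⧸ K}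
    (hz : IsOpenType i z) {O O' : BorelOrbits K}
    (hO : O = borelOrbit K z ∨ O = borelOrbit K (reflGL k i • z))
    (h : SameParabolicOrbit i O O') :
    O' = borelOrbit K z ∨ O' = borelOrbit K (reflGL k i • z) := by
  obtain ⟨g, rfl⟩ := exists_borelOrbit_eq O'
  obtain rfl | rfl := hO
  · obtain ⟨p, hp, hpz⟩ := sameParabolicOrbit_borelOrbit.1 h
    rw [← hpz]; exact hz.smul_eq_or hp
  · obtain ⟨p, hp, hpz⟩ := sameParabolicOrbit_borelOrbit.1 h
    rw [← hpz, ← mul_smul]; exact hz.smul_eq_or (mul_mem hp (reflGL_mem i))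

theorem IsOpenType.knopRefl_of_eq {i : Fin (m - 1)} {z : GL (Fin m) k ⧸ K}
    (hz : IsOpenType i z) (h : borelOrbit K (reflGL k i • z) = borelOrbit K z) :
    knopRefl i (borelOrbit K z) = borelOrbit K z := by
  rw [knopRefl, dif_neg]
  rintro ⟨O', hne, hs, -⟩
  obtain h' | h' := hz.sameParabolicOrbit (Or.inl rfl) hs
  · exact hne h'.symm
  · exact hne (h'.trans h).symm

/-- This is type `U`: `P_s z` consists of exactly two Borel orbits and the closed one is of fixed
type, so the choice made in `knopRefl` has only one possible outcome. -/
theorem IsOpenType.knopRefl_pair {i : Fin (m - 1)} {z : GL (Fin m) k ⧸ K}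
    (hz : IsOpenType i z) (h : borelOrbit K (reflGL k i • z) ≠ borelOrbit K z)
    (hf : FixedType i (borelOrbit K (reflGL k i • z))) :
    knopRefl i (borelOrbit K z) = borelOrbit K (reflGL k i • z) ∧
      knopRefl i (borelOrbit K (reflGL k i • z)) = borelOrbit K z := by
  have hs : SameParabolicOrbit i (borelOrbit K z) (borelOrbit K (reflGL k i • z)) :=
    sameParabolicOrbit_borelOrbit.2 ⟨_, reflGL_mem i, rfl⟩
  have hs' : SameParabolicOrbit i (borelOrbit K (reflGL k i • z)) (borelOrbit K z) :=
    sameParabolicOrbit_borelOrbit.2 ⟨_, reflGL_mem i, by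
      rw [← mul_smul, reflGL_mul_self, one_smul]⟩
  have h1 : Swapped i (borelOrbit K z) (borelOrbit K (reflGL k i • z)) :=
    ⟨h.symm, hs, Or.inr ⟨Or.inr hf, fun O'' h'' => hz.sameParabolicOrbit (Or.inl rfl) h''⟩⟩
  have h2 : Swapped i (borelOrbit K (reflGL k i • z)) (borelOrbit K z) :=
    ⟨h, hs', Or.inr ⟨Or.inl hf, fun O'' h'' => (hz.sameParabolicOrbit (Or.inr rfl) h'').symm⟩⟩
  constructor
  · have hex : ∃ O', Swapped i (borelOrbit K z) O' := ⟨_, h1⟩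
    rw [knopRefl, dif_pos hex]
    exact (hz.sameParabolicOrbit (Or.inl rfl) hex.choose_spec.2.1).resolve_left
      hex.choose_spec.1.symm
  · have hex : ∃ O', Swapped i (borelOrbit K (reflGL k i • z)) O' := ⟨_, h2⟩
    rw [knopRefl, dif_pos hex]
    exact (hz.sameParabolicOrbit (Or.inr rfl) hex.choose_spec.2.1).resolve_right
      hex.choose_spec.1.symm

/-- The curve `t ↦ b s u(t) g`, with `u` the upper root subgroup of `s`, starts in the closed orbit.
For `t ≠ 0` the `(i + 1, i + 1)` entry of `s u(t)` is `t`, so `s u(t)` lies in `B U⁻` and the curve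
runs in the orbit of `z`. Over an infinite field a polynomial that is nonzero at `t = 0` is also
nonzero at some `t ≠ 0`. -/
theorem IsOpenType.subset_closure [Infinite k] {i : Fin (m - 1)} {z : GL (Fin m) k ⧸ K}
    (hz : IsOpenType i z) :
    (borelOrbit K (reflGL k i • z)).orbit ⊆ closure[zariskiQuot K] (borelOrbit K z).orbit := by
  intro y hy
  obtain ⟨b, hb, rfl⟩ := mem_orbit_borelOrbit.1 hy
  obtain ⟨g, rfl⟩ := QuotientGroup.mk_surjective z
  let _ := zariskiQuot K
  rw [mem_closure_iff]
  intro U hU hyU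
  have hU' : IsOpen[zariskiGL k m] ((QuotientGroup.mk : _ → GL (Fin m) k ⧸ K) ⁻¹' U) :=
    isOpen_coinduced.1 hU
  obtain ⟨p, hp, hpU⟩ := exists_poly_of_isOpen_zariski hU' (x := b * (reflGL k i * g)) hyU
  -- the curve `t ↦ b s u(t) g`
  let cur : Fin m × Fin m → Polynomial k := fun ij =>
    Polynomial.C ((b.1 * (reflGL k i).1 * g.1) ij.1 ij.2) +
      Polynomial.X * Polynomial.C
        ((b.1 * (reflGL k i).1 * (Matrix.single (lo i) (hi i) 1 : Matrix _ _ k) * g.1) ij.1 ij.2)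
  have hcur : ∀ t : k, (fun ij : Fin m × Fin m =>
      (b * (reflGL k i * elemGL (lo_ne_hi i) t * g)) ij.1 ij.2) =
      fun ij => (cur ij).eval t := by
    intro t
    funext ij
    have : Matrix.single (lo i) (hi i) t = t • Matrix.single (lo i) (hi i) (1 : k) := by
      simp
    simp only [cur, Units.val_mul, coe_elemGL, this, Polynomial.eval_add, Polynomial.eval_C,
      Polynomial.eval_mul, Polynomial.eval_X]
    simp only [mul_add, add_mul, mul_one, Matrix.mul_assoc, Matrix.mul_smul, Matrix.smul_mul,
      Matrix.add_apply, Matrix.smul_apply, smul_eq_mul]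
  set q : Polynomial k := MvPolynomial.aeval cur p with hq
  have hqe : ∀ t : k, q.eval t = MvPolynomial.eval (fun ij : Fin m × Fin m =>
      (b * (reflGL k i * elemGL (lo_ne_hi i) t * g)) ij.1 ij.2) p := by
    intro t
    rw [hcur, hq, ← Polynomial.coe_evalRingHom, MvPolynomial.aeval_def, MvPolynomial.hom_eval₂]
    have hc : (Polynomial.evalRingHom t).comp (algebraMap k (Polynomial k)) = RingHom.id k := by
      ext; simp
    rw [hc]
    rfl
  have hq0 : q ≠ 0 := by
    intro h0
    have := hqe 0
    rw [h0, Polynomial.eval_zero, elemGL_zero, mul_one] at this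
    exact hp this.symm
  -- The extra factor `X` secures `t ≠ 0`.
  obtain ⟨t, ht⟩ : ∃ t : k, (Polynomial.X * q).eval t ≠ 0 := by
    by_contra! hcon
    exact mul_ne_zero Polynomial.X_ne_zero hq0 (Polynomial.funext fun t => by simp [hcon t])
  rw [Polynomial.eval_mul, Polynomial.eval_X] at ht
  have ht0 : t ≠ 0 := left_ne_zero_of_mul ht
  have htU := hpU (b * (reflGL k i * elemGL (lo_ne_hi i) t * g))
    (by rw [← hqe]; exact right_ne_zero_of_mul ht)
  refine ⟨_, htU, mem_orbit_borelOrbit.2 ?_⟩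
  have hmem : reflGL k i * elemGL (lo_ne_hi i) t ∈ minParabolic k i :=
    mul_mem (reflGL_mem i) (borel_le_minParabolic i (elemGL_mem_borel (lo_lt_hi i) t))
  have hent : (reflGL k i * elemGL (lo_ne_hi i) t) (hi i) (hi i) = t := by
    have : (reflGL k i * elemGL (lo_ne_hi i) t) (hi i) (hi i) =
        reflGL k i (hi i) (hi i) + if hi i = hi i then reflGL k i (hi i) (lo i) * t else 0 :=
      mul_elemGL_apply (lo_ne_hi i) t (reflGL k i).1 (hi i) (hi i)
    rw [this, reflGL, permGL_apply, permGL_apply, simpleRefl_eq, Equiv.swap_apply_left,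
      Equiv.swap_apply_right]
    simp [(lo_ne_hi i).symm]
  obtain ⟨c, hc, x, hcx⟩ := exists_eq_borel_mul_low hmem (by rw [hent]; exact ht0)
  obtain ⟨d, hd, hdx⟩ := hz x
  refine ⟨b * (c * d), mul_mem hb (mul_mem hc hd), ?_⟩
  rw [hcx, mul_smul, mul_smul, ← hdx]
  simp only [MulAction.Quotient.smul_mk, smul_eq_mul, mul_assoc]

/-- Polynomial functions on `GL_m` that vanish on a Borel orbit vanish on its closure. -/
theorem eval_eq_zero_of_subset_closure {O O' : BorelOrbits K}
    (h : O.orbit ⊆ closure[zariskiQuot K] O'.orbit) (p : MvPolynomial (Fin m × Fin m) k)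
    (hp : ∀ g : GL (Fin m) k, QuotientGroup.mk g ∈ O'.orbit →
      MvPolynomial.eval (fun ij => g ij.1 ij.2) p = 0)
    {g : GL (Fin m) k} (hg : QuotientGroup.mk g ∈ O.orbit) :
    MvPolynomial.eval (fun ij => g ij.1 ij.2) p = 0 := by
  -- The polynomial need not be invariant under `K`, so all representatives of a coset are tested.
  -- The preimage in `GL` is then an intersection of right translates of a zero locus, which is
  -- closed.
  let C : Set (GL (Fin m) k ⧸ K) := {y | ∀ g : GL (Fin m) k, QuotientGroup.mk g = y →
    MvPolynomial.eval (fun ij => g ij.1 ij.2) p = 0}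
  have hC : IsClosed[zariskiQuot K] C := by
    refine isClosed_coinduced.2 ?_
    have : (QuotientGroup.mk : _ → GL (Fin m) k ⧸ K) ⁻¹' C = ⋂ κ : K, (fun g => g * κ.1) ⁻¹'
        {g | MvPolynomial.eval (fun ij : Fin m × Fin m => g ij.1 ij.2) p = 0} := by
      ext g
      simp only [Set.mem_preimage, Set.mem_iInter, Set.mem_ofPred_eq, C]
      constructor
      · intro h κ
        exact h _ (QuotientGroup.mk_mul_of_mem g κ.2)
      · intro h g' hg'
        have := h ⟨g⁻¹ * g', QuotientGroup.eq.1 hg'.symm⟩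
        simpa using this
    rw [this]
    let _ := zariskiGL k m
    refine isClosed_iInter fun κ => IsClosed.preimage ?_ (isClosed_zariski_zeroLocus _ p)
    refine continuous_zariski fun ij =>
      ⟨∑ l, MvPolynomial.X (ij.1, l) * MvPolynomial.C (κ.1 l ij.2), fun g => ?_⟩
    simp [Matrix.mul_apply]
  let _ := zariskiQuot K
  have hsub : closure O'.orbit ⊆ C := closure_minimal (fun y hy g hgy => hp g (hgy ▸ hy)) hC
  exact hsub (h hg) g rfl

end Orbits

end SpDual

namespace SpDual

/-! ### Corner ranks of partial monomial matrices -/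

section Corner

variable {k : Type*} [Field k] {m : ℕ}

/-- At most one nonzero entry in each row and in each column. -/
def IsPartialMonomial (M : Matrix (Fin m) (Fin m) k) : Prop :=
  (∀ i j j', M i j ≠ 0 → M i j' ≠ 0 → j = j') ∧ ∀ i i' j, M i j ≠ 0 → M i' j ≠ 0 → i = i'

open Classical in
/-- The positions of the nonzero entries. -/
noncomputable def entries (M : Matrix (Fin m) (Fin m) k) : Finset (Fin m × Fin m) :=
  Finset.univ.filter fun p => M p.1 p.2 ≠ 0

theorem mem_entries {M : Matrix (Fin m) (Fin m) k} {p : Fin m × Fin m} :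
    p ∈ entries M ↔ M p.1 p.2 ≠ 0 := by simp [entries]

/-- With rows and columns indexed by the positions in `T`, the submatrix is diagonal. -/
theorem IsPartialMonomial.det_ne_zero {M : Matrix (Fin m) (Fin m) k} (hM : IsPartialMonomial M)
    {T : Finset (Fin m × Fin m)} (hT : T ⊆ entries M) :
    (M.submatrix (fun t : T => t.1.1) (fun t : T => t.1.2)).det ≠ 0 := by
  have : M.submatrix (fun t : T => t.1.1) (fun t : T => t.1.2) =
      Matrix.diagonal fun t : T => M t.1.1 t.1.2 := by
    ext t t'
    rw [Matrix.submatrix_apply, Matrix.diagonal_apply]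
    split_ifs with h
    · rw [h]
    · by_contra hne
      have h1 := mem_entries.1 (hT t.2)
      have h2 := mem_entries.1 (hT t'.2)
      have h3 := hM.1 _ _ _ h1 hne
      rw [← h3] at h2
      exact h (Subtype.ext (Prod.ext (hM.2 _ _ _ h1 h2) h3))
  rw [this, Matrix.det_diagonal]
  exact Finset.prod_ne_zero_iff.2 fun t _ => mem_entries.1 (hT t.2)

/-- The conditions on `u` and `v` say that the corner `R × C` of `u M v` depends only on the corner
of `M`. The submatrix thus factors through the set of nonzero entries of `M` in the corner, and its
rank is at most their number. -/
theorem det_submatrix_eq_zero {M u v : Matrix (Fin m) (Fin m) k} {R C : Finset (Fin m)}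
    (hu : ∀ i ∈ R, ∀ x ∉ R, u i x = 0) (hv : ∀ j ∈ C, ∀ y ∉ C, v y j = 0)
    {T : Finset (Fin m × Fin m)} (hT : T ⊆ R ×ˢ C)
    (hcard : (entries M ∩ R ×ˢ C).card < T.card) :
    ((u * M * v).submatrix (fun t : T => t.1.1) (fun t : T => t.1.2)).det = 0 := by
  set T' := entries M ∩ R ×ˢ C with hT'
  have hfac : (u * M * v).submatrix (fun t : T => t.1.1) (fun t : T => t.1.2) =
      (Matrix.of fun (t : T) (s : T') => u t.1.1 s.1.1 * M s.1.1 s.1.2) *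
        Matrix.of fun (s : T') (t : T) => v s.1.2 t.1.2 := by
    ext t t'
    have ht := Finset.mem_product.1 (hT t.2)
    have ht' := Finset.mem_product.1 (hT t'.2)
    simp only [Matrix.submatrix_apply, Matrix.mul_apply, Matrix.of_apply, Finset.sum_mul]
    rw [Finset.sum_comm, ← Finset.sum_product',
      Finset.sum_coe_sort T' fun s => u t.1.1 s.1 * M s.1 s.2 * v s.2 t'.1.2]
    refine (Finset.sum_subset (Finset.subset_univ _) fun s _ hs => ?_).symm
    by_contra hne
    refine hs (Finset.mem_inter.2 ⟨mem_entries.2 fun h => hne (by rw [h]; ring),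
      Finset.mem_product.2 ⟨?_, ?_⟩⟩)
    · by_contra h
      exact hne (by rw [hu _ ht.1 _ h]; ring)
    · by_contra h
      exact hne (by rw [hv _ ht'.2 _ h]; ring)
  by_contra hdet
  have h1 := Matrix.rank_of_isUnit _ ((Matrix.isUnit_iff_isUnit_det _).2 (isUnit_iff_ne_zero.2 hdet))
  rw [hfac] at h1
  have h2 := (Matrix.rank_mul_le_left (Matrix.of fun (t : T) (s : T') =>
    u t.1.1 s.1.1 * M s.1.1 s.1.2) (Matrix.of fun (s : T') (t : T) => v s.1.2 t.1.2)).trans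
      (Matrix.rank_le_card_width _)
  rw [h1, Fintype.card_coe, Fintype.card_coe] at h2
  omega

/-- Semicontinuity of corner ranks: if every minor that dies on all `u M' v` dies on `M`, then the
minor on the entries of `M` in the corner bounds their number. -/
theorem card_corner_le {M M' : Matrix (Fin m) (Fin m) k} (hM : IsPartialMonomial M)
    {R C : Finset (Fin m)}
    (h : ∀ T : Finset (Fin m × Fin m), (∀ u v : Matrix (Fin m) (Fin m) k,
      (∀ i ∈ R, ∀ x ∉ R, u i x = 0) → (∀ j ∈ C, ∀ y ∉ C, v y j = 0) →
        ((u * M' * v).submatrix (fun t : T => t.1.1) (fun t : T => t.1.2)).det = 0) →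
      (M.submatrix (fun t : T => t.1.1) (fun t : T => t.1.2)).det = 0) :
    (entries M ∩ R ×ˢ C).card ≤ (entries M' ∩ R ×ˢ C).card := by
  by_contra! hlt
  exact hM.det_ne_zero Finset.inter_subset_left (h _ fun u v hu hv =>
    det_submatrix_eq_zero hu hv Finset.inter_subset_right hlt)

/-- Inclusion–exclusion: the second difference of the corner counts detects a single position. -/
theorem card_inter_insert_product {α : Type*} [DecidableEq α] (S : Finset (α × α)) {a b : α}
    {R C : Finset α} (ha : a ∉ R) (hb : b ∉ C) :
    ((S ∩ insert a R ×ˢ insert b C).card + (S ∩ R ×ˢ C).card =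
      (S ∩ R ×ˢ insert b C).card + (S ∩ insert a R ×ˢ C).card + if (a, b) ∈ S then 1 else 0) := by
  have key : ∀ X : Finset (α × α), (S ∩ X).card = ∑ p ∈ S, if p ∈ X then 1 else 0 := fun X => by
    rw [← Finset.filter_mem_eq_inter, Finset.card_filter]
  have h1 : (if (a, b) ∈ S then 1 else 0) = ∑ p ∈ S, if p = (a, b) then 1 else 0 := by
    rw [Finset.sum_ite_eq']
  rw [h1]
  simp only [key, ← Finset.sum_add_distrib]
  refine Finset.sum_congr rfl fun p _ => ?_
  obtain ⟨x, y⟩ := p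
  simp only [Finset.mem_product, Finset.mem_insert, Prod.mk.injEq]
  by_cases hx : x = a <;> by_cases hy : y = b
  · subst hx hy; simp [ha, hb]
  · subst hx; simp [ha, hy]
  · subst hy; simp [hb, hx]
  · simp [hx, hy]

/-- Apply the second difference to the corners with vertex `(a, b)`. For `lower = false` the corners
are at the lower right, as suits congruence `b A bᵀ`; for `lower = true` they are at the lower left,
as suits conjugation `b N b⁻¹`. -/
theorem eq_of_card_corner_eq {S S' : Finset (Fin m × Fin m)} (lower : Bool)
    (h : ∀ R C : Finset (Fin m), (∀ i ∈ R, ∀ x, i ≤ x → x ∈ R) →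
      (∀ j ∈ C, ∀ y, (if lower then y ≤ j else j ≤ y) → y ∈ C) →
      (S ∩ R ×ˢ C).card = (S' ∩ R ×ˢ C).card) : S = S' := by
  have hup : ∀ a : Fin m, ∃ R : Finset (Fin m), a ∉ R ∧ (∀ i ∈ R, ∀ x, i ≤ x → x ∈ R) ∧
      ∀ i ∈ insert a R, ∀ x, i ≤ x → x ∈ insert a R := fun a =>
    ⟨Finset.Ioi a, by simp, by simp only [Finset.mem_Ioi]; intros; order, by
      simp only [Finset.mem_insert, Finset.mem_Ioi]
      rintro i (rfl | hi) x hx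
      · exact hx.eq_or_lt.imp_left Eq.symm
      · right; order⟩
  have hdown : ∀ a : Fin m, ∃ C : Finset (Fin m), a ∉ C ∧
      (∀ j ∈ C, ∀ y, (if lower then y ≤ j else j ≤ y) → y ∈ C) ∧
      ∀ j ∈ insert a C, ∀ y, (if lower then y ≤ j else j ≤ y) → y ∈ insert a C := by
    intro a
    cases lower
    · simpa using hup a
    · refine ⟨Finset.Iio a, by simp, by simp only [Finset.mem_Iio, if_true]; intros; order, ?_⟩
      simp only [Finset.mem_insert, Finset.mem_Iio, if_true]
      rintro i (rfl | hi) x hx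
      · exact hx.eq_or_lt
      · right; order
  ext ⟨a, b⟩
  obtain ⟨R, ha, hR, hR'⟩ := hup a
  obtain ⟨C, hb, hC, hC'⟩ := hdown b
  have h1 := card_inter_insert_product S ha hb
  have h2 := card_inter_insert_product S' ha hb
  rw [h _ _ hR hC, h _ _ hR' hC, h _ _ hR hC', h _ _ hR' hC'] at h1
  have h3 : (if (a, b) ∈ S then 1 else 0) = if (a, b) ∈ S' then 1 else 0 := by omega
  by_cases hS : (a, b) ∈ S <;> by_cases hS' : (a, b) ∈ S' <;> simp_all

end Corner

end SpDual

namespace SpDual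

/-! ### Perfect matchings as fixed point free involutions -/

section Matchings

/-- Fixed point free involutions of `{1, …, 2n}`. -/
abbrev FreeInv (n : ℕ) : Type :=
  {π : Equiv.Perm (Fin (2 * n)) // (∀ x, π (π x) = x) ∧ ∀ x, π x ≠ x}

variable {n : ℕ}

theorem FreeInv.apply_apply (π : FreeInv n) (x : Fin (2 * n)) : π.1 (π.1 x) = x := π.2.1 x

theorem FreeInv.apply_ne (π : FreeInv n) (x : Fin (2 * n)) : π.1 x ≠ x := π.2.2 x

theorem FreeInv.apply_eq_iff (π : FreeInv n) {x y : Fin (2 * n)} : π.1 x = y ↔ x = π.1 y :=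
  ⟨fun h => by rw [← h, π.apply_apply], fun h => by rw [h, π.apply_apply]⟩

theorem FreeInv.lt_or_lt (π : FreeInv n) (x : Fin (2 * n)) : x < π.1 x ∨ π.1 x < x :=
  (π.apply_ne x).symm.lt_or_gt

/-- Conjugation; Knop's action on `X` and the operation `*` on relevant orbits both turn out to be
this action. -/
instance : MulAction (Equiv.Perm (Fin (2 * n))) (FreeInv n) where
  smul w π := ⟨w * π.1 * w⁻¹, fun x => by simp [π.apply_apply],
    fun x h => π.apply_ne (w⁻¹ x) (by
      rw [Equiv.Perm.mul_apply, Equiv.Perm.mul_apply] at h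
      rw [Equiv.Perm.eq_inv_iff_eq.2 h])⟩
  one_smul π := Subtype.ext (by simp [HSMul.hSMul])
  mul_smul v w π := Subtype.ext (by simp [HSMul.hSMul, mul_assoc])

theorem FreeInv.smul_apply (w : Equiv.Perm (Fin (2 * n))) (π : FreeInv n) (x : Fin (2 * n)) :
    (w • π).1 x = w (π.1 (w⁻¹ x)) := rfl

theorem Matching.existsUnique_partner (P : Matching n) (x : Fin (2 * n)) :
    ∃! y, ({x, y} : Finset (Fin (2 * n))) ∈ P.1.parts := by
  have hmem : P.1.part x ∈ P.1.parts := P.1.part_mem.2 (Finset.mem_univ x)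
  have hx : x ∈ P.1.part x := P.1.mem_part (Finset.mem_univ x)
  have hu : ∀ y z, ({x, y} : Finset (Fin (2 * n))) ∈ P.1.parts →
      ({x, z} : Finset (Fin (2 * n))) ∈ P.1.parts → y = z := by
    intro y z hy hz
    have h := P.1.eq_of_mem_parts hy hz (a := x) (by simp) (by simp)
    have hyx : y ≠ x := by
      rintro rfl
      have := P.2 _ hy
      simp at this
    have : y ∈ ({x, z} : Finset (Fin (2 * n))) := h ▸ (by simp)
    simpa [hyx] using this
  obtain ⟨a, b, hab, h⟩ := Finset.card_eq_two.1 (P.2 _ hmem)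
  rw [h] at hmem hx
  obtain rfl | hxb := Finset.mem_insert.1 hx
  · exact ⟨b, hmem, fun z hz => hu z b hz hmem⟩
  · rw [Finset.mem_singleton] at hxb
    subst hxb
    rw [Finset.pair_comm] at hmem
    exact ⟨a, hmem, fun z hz => hu z a hz hmem⟩

/-- The involution that interchanges the two elements of each pair of a matching. -/
noncomputable def Matching.toInv (P : Matching n) : FreeInv n := by
  have hs : ∀ x, ({x, (P.existsUnique_partner x).choose} : Finset (Fin (2 * n))) ∈ P.1.parts :=
    fun x => (P.existsUnique_partner x).choose_spec.1
  have hinv : ∀ x, (P.existsUnique_partner (P.existsUnique_partner x).choose).choose = x :=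
    fun x => ((P.existsUnique_partner _).choose_spec.2 x (by
      beta_reduce; rw [Finset.pair_comm]; exact hs x)).symm
  exact ⟨⟨fun x => (P.existsUnique_partner x).choose, fun x => (P.existsUnique_partner x).choose,
    hinv, hinv⟩, hinv, fun x hx => by
      have h1 := hs x
      have h2 : (P.existsUnique_partner x).choose = x := hx
      rw [h2] at h1
      have := P.2 _ h1
      simp at this⟩

theorem Matching.mem_parts_iff (P : Matching n) {x y : Fin (2 * n)} :
    ({x, y} : Finset (Fin (2 * n))) ∈ P.1.parts ↔ P.toInv.1 x = y := by
  constructor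
  · intro h
    exact ((P.existsUnique_partner x).choose_spec.2 y h).symm
  · rintro rfl
    exact (P.existsUnique_partner x).choose_spec.1

/-- The matching of a fixed point free involution. -/
def FreeInv.toMatching (π : FreeInv n) : Matching n :=
  ⟨Finpartition.ofExistsUnique (Finset.univ.image fun x => {x, π.1 x})
    (fun _ _ => Finset.subset_univ _)
    (fun a _ => ⟨{a, π.1 a}, by simp, by
      rintro t ⟨ht, hat⟩
      obtain ⟨x, -, rfl⟩ := Finset.mem_image.1 ht
      rw [Finset.mem_insert, Finset.mem_singleton] at hat
      obtain rfl | rfl := hat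
      · rfl
      · rw [π.apply_apply, Finset.pair_comm]⟩)
    (by simp),
    fun p hp => by
      obtain ⟨x, -, rfl⟩ := Finset.mem_image.1 hp
      exact Finset.card_pair (π.apply_ne x).symm⟩

/-- Perfect matchings correspond to fixed point free involutions. -/
noncomputable def matchingEquiv (n : ℕ) : Matching n ≃ FreeInv n where
  toFun := Matching.toInv
  invFun := FreeInv.toMatching
  left_inv P := by
    refine Subtype.ext (Finpartition.ext ?_)
    ext p
    constructor
    · intro hp
      obtain ⟨x, -, rfl⟩ := Finset.mem_image.1 hp
      exact P.mem_parts_iff.2 rfl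
    · intro hp
      obtain ⟨a, b, -, rfl⟩ := Finset.card_eq_two.1 (P.2 p hp)
      refine Finset.mem_image.2 ⟨a, Finset.mem_univ _, ?_⟩
      rw [P.mem_parts_iff.1 hp]
  right_inv π := by
    refine Subtype.ext (Equiv.ext fun x => ?_)
    rw [← Matching.mem_parts_iff]
    exact Finset.mem_image.2 ⟨x, Finset.mem_univ _, rfl⟩

/-- These permutations form the conjugacy class of cycle type `2ⁿ`, whose size is `(2n)! / (2ⁿ n!)`.
-/
theorem card_freeInv (n : ℕ) : Nat.card (FreeInv n) = Nat.doubleFactorial (2 * n - 1) := by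
  classical
  have hiff : ∀ π : Equiv.Perm (Fin (2 * n)), ((∀ x, π (π x) = x) ∧ ∀ x, π x ≠ x) ↔
      π.cycleType = Multiset.replicate n 2 := by
    intro π
    have : Fact (Nat.Prime 2) := ⟨Nat.prime_two⟩
    have hsq : (∀ x, π (π x) = x) ↔ π ^ 2 = 1 := by
      rw [sq, Equiv.ext_iff]; rfl
    have hsupp : (∀ x, π x ≠ x) ↔ π.support.card = 2 * n := by
      have h := Finset.card_eq_iff_eq_univ π.support
      rw [Fintype.card_fin] at h
      rw [h, Finset.eq_univ_iff_forall]
      simp [Equiv.Perm.mem_support]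
    rw [hsq, hsupp, Equiv.Perm.pow_prime_eq_one_iff, ← Equiv.Perm.sum_cycleType,
      Multiset.eq_replicate]
    constructor
    · rintro ⟨h1, h2⟩
      rw [Multiset.eq_replicate_card.2 h1, Multiset.sum_replicate, smul_eq_mul] at h2
      exact ⟨by omega, h1⟩
    · rintro ⟨h1, h2⟩
      refine ⟨h2, ?_⟩
      rw [Multiset.eq_replicate_card.2 h2, Multiset.sum_replicate, smul_eq_mul, h1, mul_comm]
  have h1 : Nat.card (FreeInv n) = (Finset.univ.filter fun π : Equiv.Perm (Fin (2 * n)) =>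
      π.cycleType = Multiset.replicate n 2).card := by
    rw [Nat.card_eq_fintype_card, Fintype.card_subtype]
    congr 1
    ext π
    simp [hiff]
  have h2 := Equiv.Perm.card_of_cycleType_mul_eq (Fin (2 * n)) (Multiset.replicate n 2)
  rw [← h1, if_pos ⟨by simp [mul_comm], fun a ha => (Multiset.eq_of_mem_replicate ha).ge⟩] at h2
  rw [Multiset.sum_replicate, Multiset.prod_replicate, Fintype.card_fin, smul_eq_mul,
    mul_comm n 2, Nat.sub_self, Nat.factorial_zero, one_mul] at h2
  have h3 : ∏ x ∈ (Multiset.replicate n 2).toFinset, ((Multiset.replicate n 2).count x).factorial =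
      n.factorial := by
    rcases Nat.eq_zero_or_pos n with rfl | hn
    · simp
    · rw [Multiset.toFinset_replicate, if_neg hn.ne']
      simp
  rw [h3] at h2
  -- For `n = 0` truncated subtraction gives `Nat.doubleFactorial 0 = 1`, in agreement with `(-1)!!
  -- = 1`.
  rcases Nat.eq_zero_or_pos n with rfl | hn
  · simpa using h2
  · obtain ⟨l, hl⟩ : ∃ l, 2 * n = l + 1 := ⟨2 * n - 1, by omega⟩
    have h4 := Nat.factorial_eq_mul_doubleFactorial l
    rw [← hl, Nat.doubleFactorial_two_mul, ← h2] at h4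
    have h5 : 0 < 2 ^ n * n.factorial := by positivity
    rw [show 2 * n - 1 = l by omega]
    refine Nat.eq_of_mul_eq_mul_right h5 ?_
    rw [h4, mul_comm]

end Matchings

end SpDual

namespace SpDual

/-! ### Alternating matrices up to upper triangular congruence -/

section Shear

variable {k : Type*} [Field k] {m : ℕ}

/-- The matrix `1 + c e_jᵀ`, where `c j = 0`. -/
def shearGL (j : Fin m) (c : Fin m → k) (hc : c j = 0) : GL (Fin m) k where
  val := 1 + Matrix.vecMulVec c (Pi.single j 1)
  inv := 1 - Matrix.vecMulVec c (Pi.single j 1)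
  val_inv := by
    simp [mul_sub, add_mul, Matrix.vecMulVec_mul_vecMulVec, hc]
  inv_val := by
    simp [mul_add, sub_mul, Matrix.vecMulVec_mul_vecMulVec, hc]

theorem shearGL_mul_apply (j : Fin m) (c : Fin m → k) (hc : c j = 0)
    (A : Matrix (Fin m) (Fin m) k) (a x : Fin m) :
    ((shearGL j c hc).1 * A) a x = A a x + c a * A j x := by
  simp [shearGL, add_mul, Matrix.vecMulVec_mul, Matrix.vecMulVec_apply]

theorem mul_shearGL_apply (j : Fin m) (c : Fin m → k) (hc : c j = 0)
    (A : Matrix (Fin m) (Fin m) k) (a x : Fin m) :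
    (A * (shearGL j c hc).1) a x = A a x + (A *ᵥ c) a * (Pi.single j 1 : Fin m → k) x := by
  simp [shearGL, mul_add, Matrix.mul_vecMulVec, Matrix.vecMulVec_apply]

theorem mul_shearGL_transpose_apply (j : Fin m) (c : Fin m → k) (hc : c j = 0)
    (A : Matrix (Fin m) (Fin m) k) (a x : Fin m) :
    (A * (shearGL j c hc).1ᵀ) a x = A a x + A a j * c x := by
  simp [shearGL, mul_add, Matrix.mul_vecMulVec, Matrix.vecMulVec_apply]

theorem shearGL_inv_mul_apply (j : Fin m) (c : Fin m → k) (hc : c j = 0)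
    (A : Matrix (Fin m) (Fin m) k) (a x : Fin m) :
    ((shearGL j c hc)⁻¹.1 * A) a x = A a x - c a * A j x := by
  change ((1 - Matrix.vecMulVec c (Pi.single j 1)) * A) a x = _
  simp [sub_mul, Matrix.vecMulVec_mul, Matrix.vecMulVec_apply]

theorem shearGL_mem_borel {j : Fin m} {c : Fin m → k} (hc : c j = 0)
    (h : ∀ a, j < a → c a = 0) : shearGL j c hc ∈ borel k m :=
  mem_borel_iff.2 fun a x hax => by
    have : shearGL j c hc a x = (1 : Matrix (Fin m) (Fin m) k) a x +
        c a * (1 : Matrix (Fin m) (Fin m) k) j x := by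
      have := shearGL_mul_apply j c hc 1 a x
      rwa [mul_one] at this
    rw [this, Matrix.one_apply_ne hax.ne', zero_add]
    rcases eq_or_ne j x with rfl | hjx
    · rw [h a hax, zero_mul]
    · rw [Matrix.one_apply_ne hjx, mul_zero]

end Shear

/-! ### Symplectic Gaussian elimination -/

section Alternating

variable {k : Type*} [Field k] {m : ℕ}

/-- Alternating matrices. -/
def IsAlt (A : Matrix (Fin m) (Fin m) k) : Prop :=
  (∀ i, A i i = 0) ∧ ∀ i j, A i j = -A j i

/-- The diagonal needs its own argument in characteristic 2: the terms indexed by `(p, q)` and `(q,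
p)` cancel and those with `p = q` vanish. -/
theorem IsAlt.congr {A : Matrix (Fin m) (Fin m) k} (hA : IsAlt A)
    (g : Matrix (Fin m) (Fin m) k) : IsAlt (g * A * gᵀ) := by
  have happ : ∀ i j, (g * A * gᵀ) i j = ∑ p : Fin m × Fin m, g i p.1 * A p.1 p.2 * g j p.2 := by
    intro i j
    simp only [Matrix.mul_apply, Matrix.transpose_apply, Finset.sum_mul]
    rw [Finset.sum_comm, Fintype.sum_prod_type]
  constructor
  · intro i
    rw [happ]
    refine Finset.sum_involution (fun p _ => p.swap) (fun p _ => ?_) (fun p _ hp h => hp ?_)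
      (fun p _ => Finset.mem_univ _) (fun p _ => Prod.swap_swap p)
    · rw [Prod.fst_swap, Prod.snd_swap, hA.2 p.2 p.1]; ring
    · have : p.2 = p.1 := congrArg Prod.fst h
      rw [this, hA.1]; ring
  · intro i j
    rw [happ, happ, ← Finset.sum_neg_distrib]
    refine Fintype.sum_equiv (Equiv.prodComm _ _) _ _ fun p => ?_
    simp only [Equiv.prodComm_apply, Prod.fst_swap, Prod.snd_swap]
    rw [hA.2 p.2 p.1]; ring

/-- Each row outside `S` has exactly one nonzero entry, and its column is outside `S`. -/
def IsMonomialOff (S : Finset (Fin m)) (A : Matrix (Fin m) (Fin m) k) : Prop :=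
  ∀ i ∉ S, ∃ j ∉ S, A i j ≠ 0 ∧ ∀ l, l ≠ j → A i l = 0

theorem IsMonomialOff.apply_eq_zero {S : Finset (Fin m)} {A : Matrix (Fin m) (Fin m) k}
    (h : IsMonomialOff S A) {i l : Fin m} (hi : i ∉ S) (hl : l ∈ S) : A i l = 0 := by
  obtain ⟨j, hj, -, h0⟩ := h i hi
  exact h0 l fun e => hj (e ▸ hl)

/-- One elimination step. Let `l` be the largest untreated index and `j < l` the last column where
row `l` is nonzero. Multiples of row `j` are added to rows above it to clear row `l`. Then multiples
of row `l`, the last one of `S`, clear row `j`. Both operations are upper triangular and their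
coefficients vanish outside `S`, so the pairs already split off survive. -/
theorem IsAlt.exists_monomialOff_sdiff {A : Matrix (Fin m) (Fin m) k} (hA : IsAlt A)
    (hdet : A.det ≠ 0) {S : Finset (Fin m)} (hS : S.Nonempty) (h : IsMonomialOff S A) :
    ∃ b ∈ borel k m, ∃ S' ⊂ S, IsMonomialOff S' (b.1 * A * b.1ᵀ) := by
  classical
  set l := S.max' hS with hl
  have hlS : l ∈ S := S.max'_mem hS
  have hSzero : ∀ {i x}, i ∈ S → x ∉ S → A i x = 0 := fun {i x} hi hx => by
    rw [hA.2, h.apply_eq_zero hx hi, neg_zero]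
  have hrow : ∃ x, A l x ≠ 0 := by
    by_contra! hcon
    exact hdet (Matrix.det_eq_zero_of_row_eq_zero l hcon)
  have hne : (Finset.univ.filter fun x => A l x ≠ 0).Nonempty :=
    hrow.imp fun x hx => by simpa using hx
  set j := (Finset.univ.filter fun x => A l x ≠ 0).max' hne with hj
  have hlj : A l j ≠ 0 := (Finset.mem_filter.1 (Finset.max'_mem _ hne)).2
  have hjmax : ∀ x, j < x → A l x = 0 := fun x hx => by
    by_contra hx0
    exact absurd (Finset.le_max' _ x (Finset.mem_filter.2 ⟨Finset.mem_univ x, hx0⟩)) hx.not_ge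
  have hjS : j ∈ S := by
    by_contra hjS
    exact hlj (hSzero hlS hjS)
  have hjl : j ≠ l := fun e => hlj (by rw [e, hA.1])
  have hjl' : j < l := lt_of_le_of_ne (S.le_max' j hjS) hjl
  have hAjl : A j l ≠ 0 := by rw [hA.2]; exact neg_ne_zero.2 hlj
  -- clear the row `l` by means of the column `j`
  let c : Fin m → k := fun x => if x = j then 0 else -A l x / A l j
  have hcj : c j = 0 := if_pos rfl
  have hc : ∀ x, x ≠ j → c x = -A l x / A l j := fun x hx => if_neg hx
  have hcl : c l = 0 := by rw [hc l hjl.symm, hA.1]; simp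
  have hcS : ∀ x, x ∉ S → c x = 0 := fun x hx => by
    rw [hc x (fun e => hx (e ▸ hjS)), hSzero hlS hx]; simp
  set b₁ := shearGL j c hcj with hb₁
  have hb₁B : b₁ ∈ borel k m := shearGL_mem_borel hcj fun a ha => by
    rw [hc a ha.ne', hjmax a ha]; simp
  set A₁ := b₁.1 * A * b₁.1ᵀ with hA₁
  have hA₁app : ∀ a x, A₁ a x = A a x + c a * A j x + A a j * c x := by
    intro a x
    rw [hA₁, mul_shearGL_transpose_apply, shearGL_mul_apply, shearGL_mul_apply, hA.1]; ring
  have hA₁alt : IsAlt A₁ := hA.congr _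
  have h₁l : ∀ x, x ≠ j → A₁ l x = 0 := fun x hx => by
    rw [hA₁app, hcl, hc x hx]; field_simp; ring
  have h₁j : ∀ x, A₁ j x = A j x := fun x => by rw [hA₁app, hcj, hA.1]; ring
  have h₁off : ∀ i x, i ∉ S → A₁ i x = A i x := fun i x hi => by
    rw [hA₁app, hcS i hi, h.apply_eq_zero hi hjS]; ring
  -- clear the row `j` by means of the column `l`
  let d : Fin m → k := fun x => if x = l then 0 else -A j x / A j l
  have hdl : d l = 0 := if_pos rfl
  have hd : ∀ x, x ≠ l → d x = -A j x / A j l := fun x hx => if_neg hx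
  have hdj : d j = 0 := by rw [hd j hjl, hA.1]; simp
  have hdS : ∀ x, x ∉ S → d x = 0 := fun x hx => by
    rw [hd x (fun e => hx (e ▸ hlS)), hSzero hjS hx]; simp
  set b₂ := shearGL l d hdl with hb₂
  have hb₂B : b₂ ∈ borel k m := shearGL_mem_borel hdl fun a ha =>
    hdS a fun haS => absurd (S.le_max' a haS) ha.not_ge
  have hA₂app : ∀ a x, (b₂.1 * A₁ * b₂.1ᵀ) a x = A₁ a x + d a * A₁ l x + A₁ a l * d x := by
    intro a x
    rw [mul_shearGL_transpose_apply, shearGL_mul_apply, shearGL_mul_apply, hA₁alt.1]; ring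
  refine ⟨b₂ * b₁, mul_mem hb₂B hb₁B, (S.erase l).erase j, ?_, ?_⟩
  · refine (Finset.erase_subset _ _).trans_ssubset (Finset.erase_ssubset hlS)
  · have hprod : (b₂ * b₁).1 * A * (b₂ * b₁).1ᵀ = b₂.1 * A₁ * b₂.1ᵀ := by
      rw [hA₁, Units.val_mul, Matrix.transpose_mul]
      simp only [Matrix.mul_assoc]
    rw [hprod]
    intro i hi
    have hi' : i = j ∨ i = l ∨ i ∉ S := by
      by_cases h1 : i = j
      · exact Or.inl h1
      by_cases h2 : i = l
      · exact Or.inr (Or.inl h2)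
      · exact Or.inr (Or.inr fun hiS => hi (Finset.mem_erase.2 ⟨h1, Finset.mem_erase.2 ⟨h2, hiS⟩⟩))
    obtain rfl | rfl | hiS := hi'
    · refine ⟨l, by simp, ?_, fun x hx => ?_⟩
      · rw [hA₂app, hdj, hdl, h₁j]; simpa using hAjl
      · rw [hA₂app, hdj, hd x hx, h₁j, h₁j]; field_simp; ring
    · refine ⟨j, by simp, ?_, fun x hx => ?_⟩
      · rw [hA₂app, hdl, hdj, hA₁alt.2, h₁j]; simpa using hAjl
      · rw [hA₂app, hdl, h₁l x hx, hA₁alt.1]; simp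
    · obtain ⟨p, hp, hp0, hp1⟩ := h i hiS
      have hiApp : ∀ x, (b₂.1 * A₁ * b₂.1ᵀ) i x = A i x := fun x => by
        rw [hA₂app, hdS i hiS, h₁off i _ hiS, h₁off i _ hiS, h.apply_eq_zero hiS hlS]; ring
      refine ⟨p, fun hp' => hp (Finset.mem_of_mem_erase (Finset.mem_of_mem_erase hp')), ?_, ?_⟩
      · rwa [hiApp]
      · intro x hx; rw [hiApp, hp1 x hx]

theorem IsAlt.exists_monomial {A : Matrix (Fin m) (Fin m) k} (hA : IsAlt A) (hdet : A.det ≠ 0) :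
    ∃ b ∈ borel k m, ∀ i, ∃ j, (b.1 * A * b.1ᵀ) i j ≠ 0 ∧ ∀ l, l ≠ j → (b.1 * A * b.1ᵀ) i l = 0 := by
  suffices H : ∀ (S : Finset (Fin m)) (A : Matrix (Fin m) (Fin m) k), IsAlt A → A.det ≠ 0 →
      IsMonomialOff S A → ∃ b ∈ borel k m, IsMonomialOff ∅ (b.1 * A * b.1ᵀ) by
    obtain ⟨b, hb, h⟩ := H Finset.univ A hA hdet fun i hi => absurd (Finset.mem_univ i) hi
    exact ⟨b, hb, fun i => (h i (Finset.notMem_empty i)).imp fun j hj => hj.2⟩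
  intro S
  induction S using Finset.strongInduction with | H S ih => ?_
  intro A hA hdet h
  rcases S.eq_empty_or_nonempty with rfl | hS
  · exact ⟨1, one_mem _, by simpa using h⟩
  · obtain ⟨b, hb, S', hS', h'⟩ := hA.exists_monomialOff_sdiff hdet hS h
    have hbu : b.1.det ≠ 0 := (Matrix.isUnits_det_units b).ne_zero
    obtain ⟨b', hb', h''⟩ := ih S' hS' _ (hA.congr b.1) (by
      rw [Matrix.det_mul, Matrix.det_mul, Matrix.det_transpose]
      exact mul_ne_zero (mul_ne_zero hbu hdet) hbu) h'
    refine ⟨b' * b, mul_mem hb' hb, ?_⟩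
    rw [Units.val_mul, Matrix.transpose_mul]
    simpa only [Matrix.mul_assoc] using h''

end Alternating

end SpDual

namespace SpDual

/-! ### Simple reflections acting on involutions -/

section Combinatorics

variable {n : ℕ}

theorem FreeInv.ext' {π π' : FreeInv n} (h : ∀ x, π.1 x = π'.1 x) : π = π' :=
  Subtype.ext (Equiv.ext h)

theorem simpleRefl_lo {m : ℕ} (i : Fin (m - 1)) : simpleRefl i (lo i) = hi i :=
  Equiv.swap_apply_left _ _

theorem simpleRefl_hi {m : ℕ} (i : Fin (m - 1)) : simpleRefl i (hi i) = lo i :=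
  Equiv.swap_apply_right _ _

theorem simpleRefl_of_ne {m : ℕ} {i : Fin (m - 1)} {x : Fin m} (h : x ≠ lo i) (h' : x ≠ hi i) :
    simpleRefl i x = x :=
  Equiv.swap_apply_of_ne_of_ne h h'

theorem FreeInv.refl_smul_apply (i : Fin (2 * n - 1)) (π : FreeInv n) (x : Fin (2 * n)) :
    (simpleRefl i • π).1 x = simpleRefl i (π.1 (simpleRefl i x)) := by
  rw [FreeInv.smul_apply, simpleRefl_inv]

theorem FreeInv.refl_smul_refl_smul (i : Fin (2 * n - 1)) (π : FreeInv n) :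
    simpleRefl i • simpleRefl i • π = π := by
  rw [← mul_smul, ← simpleRefl_inv]
  nth_rw 2 [simpleRefl_inv]
  rw [inv_mul_cancel, one_smul]

theorem FreeInv.refl_smul_of_matched {i : Fin (2 * n - 1)} {π : FreeInv n}
    (h : π.1 (lo i) = hi i) : simpleRefl i • π = π := by
  refine FreeInv.ext' fun x => ?_
  rw [FreeInv.refl_smul_apply]
  have h' : π.1 (hi i) = lo i := by rw [← h, π.apply_apply]
  rcases eq_or_ne x (lo i) with rfl | h1
  · rw [simpleRefl_lo, h', simpleRefl_lo, h]
  rcases eq_or_ne x (hi i) with rfl | h2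
  · rw [simpleRefl_hi, h, simpleRefl_hi, h']
  · rw [simpleRefl_of_ne h1 h2, simpleRefl_of_ne]
    · exact fun h3 => h2 (by rw [← h, ← h3, π.apply_apply])
    · exact fun h3 => h1 (by rw [← h', ← h3, π.apply_apply])

theorem FreeInv.refl_smul_lo {i : Fin (2 * n - 1)} {π : FreeInv n}
    (h : π.1 (lo i) ≠ hi i) : (simpleRefl i • π).1 (lo i) = π.1 (hi i) := by
  rw [FreeInv.refl_smul_apply, simpleRefl_lo, simpleRefl_of_ne _ (π.apply_ne _)]
  exact fun h' => h (by rw [← h', π.apply_apply])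

theorem FreeInv.refl_smul_hi {i : Fin (2 * n - 1)} {π : FreeInv n}
    (h : π.1 (lo i) ≠ hi i) : (simpleRefl i • π).1 (hi i) = π.1 (lo i) := by
  rw [FreeInv.refl_smul_apply, simpleRefl_hi, simpleRefl_of_ne (π.apply_ne _) h]

theorem FreeInv.refl_smul_unmatched {i : Fin (2 * n - 1)} {π : FreeInv n}
    (h : π.1 (lo i) ≠ hi i) : (simpleRefl i • π).1 (lo i) ≠ hi i := by
  rw [FreeInv.refl_smul_lo h]; exact π.apply_ne _

theorem FreeInv.refl_smul_ne {i : Fin (2 * n - 1)} {π : FreeInv n}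
    (h : π.1 (lo i) ≠ hi i) : simpleRefl i • π ≠ π := by
  intro e
  have h1 := FreeInv.refl_smul_lo h
  rw [e] at h1
  exact lo_ne_hi i (π.1.injective h1)

/-- The smaller elements of the pairs of the matching. -/
abbrev FreeInv.IsSource (π : FreeInv n) (x : Fin (2 * n)) : Prop := x < π.1 x

theorem FreeInv.isSource_apply_iff (π : FreeInv n) {x : Fin (2 * n)} :
    π.IsSource (π.1 x) ↔ ¬ π.IsSource x := by
  rw [FreeInv.IsSource, FreeInv.IsSource, π.apply_apply, not_lt]
  exact ⟨le_of_lt, fun h => lt_of_le_of_ne h (π.apply_ne x)⟩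

theorem FreeInv.card_source (π : FreeInv n) : Fintype.card {x // π.IsSource x} = n := by
  have h1 : Fintype.card {x // π.IsSource x} = Fintype.card {x // ¬ π.IsSource x} :=
    Fintype.card_congr (π.1.subtypeEquiv fun x => by
      rw [π.isSource_apply_iff, not_not])
  have h2 := Fintype.card_congr (Equiv.sumCompl π.IsSource)
  rw [Fintype.card_sum, Fintype.card_fin] at h2
  omega

/-- The larger elements fill the first half and their partners the second. The same `σ` produces a
point over the monomial shape on `X` and over `nilMat` on the dual side. -/
theorem FreeInv.exists_perm (π : FreeInv n) : ∃ σ : Equiv.Perm (Fin (2 * n)), ∀ i : Fin n,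
    σ (halves n (Sum.inr i)) < σ (halves n (Sum.inl i)) ∧
      π.1 (σ (halves n (Sum.inl i))) = σ (halves n (Sum.inr i)) := by
  have e : Fin n ≃ {x // π.IsSource x} := (Fintype.equivFinOfCardEq π.card_source).symm
  let f : Fin n ⊕ Fin n → Fin (2 * n) := Sum.elim (fun i => π.1 (e i).1) fun i => (e i).1
  have hf : Function.Injective f := by
    rintro (i | i) (j | j) h
    · exact congrArg _ (e.injective (Subtype.ext (π.1.injective h)))
    · exact absurd ((congrArg π.IsSource h).mpr (e j).2) (by
        simp only [f, Sum.elim_inl]; rw [π.isSource_apply_iff]; exact not_not.2 (e i).2)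
    · exact absurd ((congrArg π.IsSource h).mp (e i).2) (by
        simp only [f, Sum.elim_inl]; rw [π.isSource_apply_iff]; exact not_not.2 (e j).2)
    · exact congrArg _ (e.injective (Subtype.ext h))
  have hb : Function.Bijective f :=
    (Fintype.bijective_iff_injective_and_card f).2 ⟨hf, Fintype.card_congr (halves n)⟩
  refine ⟨(halves n).symm.trans (Equiv.ofBijective f hb), fun i => ?_⟩
  simp only [Equiv.trans_apply, Equiv.symm_apply_apply, Equiv.ofBijective_apply, f, Sum.elim_inl,
    Sum.elim_inr, π.apply_apply]
  exact ⟨(e i).2, trivial⟩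

end Combinatorics

/-! ### The symmetric space `GL_{2n} / Sp_{2n}` -/

section Symplectic

variable {k : Type*} [Field k] {n : ℕ}

/-- The alternating matrix `g J gᵀ`. -/
def gram (g : GL (Fin (2 * n)) k) : Matrix (Fin (2 * n)) (Fin (2 * n)) k :=
  g.1 * sympForm k n * g.1ᵀ

theorem sympForm_halves (k : Type*) [Field k] (n : ℕ) (a b : Fin n ⊕ Fin n) :
    sympForm k n (halves n a) (halves n b) = Matrix.J (Fin n) k a b := by
  simp [sympForm]

theorem isAlt_sympForm (k : Type*) [Field k] (n : ℕ) : IsAlt (sympForm k n) := by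
  constructor
  · intro i
    obtain ⟨a, rfl⟩ := (halves n).surjective i
    rw [sympForm_halves]
    rcases a with a | a <;> simp [Matrix.J]
  · intro i j
    obtain ⟨a, rfl⟩ := (halves n).surjective i
    obtain ⟨b, rfl⟩ := (halves n).surjective j
    rw [sympForm_halves, sympForm_halves]
    rcases a with a | a <;> rcases b with b | b <;> simp [Matrix.J, Matrix.one_apply, eq_comm]

theorem det_sympForm_ne_zero (k : Type*) [Field k] (n : ℕ) : (sympForm k n).det ≠ 0 := by
  rw [sympForm, Matrix.det_reindex_self]
  exact (Matrix.isUnit_det_J (Fin n) k).ne_zero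

theorem isAlt_gram (g : GL (Fin (2 * n)) k) : IsAlt (gram g) := (isAlt_sympForm k n).congr _

theorem det_gram_ne_zero (g : GL (Fin (2 * n)) k) : (gram g).det ≠ 0 := by
  have hg : g.1.det ≠ 0 := (Matrix.isUnits_det_units g).ne_zero
  rw [gram, Matrix.det_mul, Matrix.det_mul, Matrix.det_transpose]
  exact mul_ne_zero (mul_ne_zero hg (det_sympForm_ne_zero k n)) hg

theorem gram_mul (b g : GL (Fin (2 * n)) k) : gram (b * g) = b.1 * gram g * b.1ᵀ := by
  simp only [gram, Units.val_mul, Matrix.transpose_mul, Matrix.mul_assoc]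

theorem mk_eq_mk_iff_gram {g g' : GL (Fin (2 * n)) k} :
    (QuotientGroup.mk g : GL (Fin (2 * n)) k ⧸ Sp k n) = QuotientGroup.mk g' ↔ gram g = gram g' := by
  rw [QuotientGroup.eq]
  change gram (g⁻¹ * g') = sympForm k n ↔ _
  have h1 : gram (1 : GL (Fin (2 * n)) k) = sympForm k n := by simp [gram]
  constructor
  · intro h
    have h2 := gram_mul g (g⁻¹ * g')
    rw [mul_inv_cancel_left, h] at h2
    exact h2.symm
  · intro h
    rw [gram_mul, ← h, ← gram_mul, inv_mul_cancel, h1]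

/-- Since `Sp` is the stabilizer of the form, Borel orbits on `X` are classes of alternating
matrices under upper triangular congruence. -/
theorem borelOrbit_mk_eq_iff_gram {g g' : GL (Fin (2 * n)) k} :
    borelOrbit (Sp k n) (QuotientGroup.mk g) = borelOrbit (Sp k n) (QuotientGroup.mk g') ↔
      ∃ b ∈ borel k (2 * n), gram g = b.1 * gram g' * b.1ᵀ := by
  rw [borelOrbit_eq_iff]
  refine exists_congr fun b => and_congr_right fun _ => ?_
  rw [← gram_mul]
  exact mk_eq_mk_iff_gram

/-- The antisymmetric monomial matrix of an involution. -/
def mono (k : Type*) [Field k] {n : ℕ} (π : FreeInv n) : Matrix (Fin (2 * n)) (Fin (2 * n)) k :=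
  Matrix.of fun i j => if π.1 i = j then (if i < j then 1 else -1) else 0

theorem monomial_eq_mono (P : Matching n) : monomial k P = mono k P.toInv := by
  ext i j
  simp only [monomial, mono, Matrix.of_apply, P.mem_parts_iff]

/-- `A` is alternating and its nonzero entries are at the positions `(i, π i)`. -/
def HasShape (A : Matrix (Fin (2 * n)) (Fin (2 * n)) k) (π : FreeInv n) : Prop :=
  IsAlt A ∧ ∀ i j, A i j ≠ 0 ↔ π.1 i = j

theorem HasShape.apply_eq_zero {A : Matrix (Fin (2 * n)) (Fin (2 * n)) k} {π : FreeInv n}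
    (h : HasShape A π) {i j : Fin (2 * n)} (hij : π.1 i ≠ j) : A i j = 0 :=
  not_not.1 ((h.2 i j).not.2 hij)

theorem hasShape_mono (π : FreeInv n) : HasShape (mono k π) π := by
  refine ⟨⟨fun i => ?_, fun i j => ?_⟩, fun i j => ?_⟩
  · simp [mono, π.apply_ne i]
  · simp only [mono, Matrix.of_apply]
    by_cases h : π.1 i = j
    · have h' : π.1 j = i := by rw [← h, π.apply_apply]
      have hne : i ≠ j := fun e => π.apply_ne i (h.trans e.symm)
      rw [if_pos h, if_pos h']
      rcases hne.lt_or_gt with hl | hl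
      · rw [if_pos hl, if_neg hl.asymm, neg_neg]
      · rw [if_pos hl, if_neg hl.asymm]
    · rw [if_neg h, if_neg fun e => h (by rw [← e, π.apply_apply]), neg_zero]
  · simp only [mono, Matrix.of_apply]
    split_ifs with h <;> simp [h]

/-- An invertible diagonal matrix. -/
def diagGL {m : ℕ} (d : Fin m → k) (hd : ∀ i, d i ≠ 0) : GL (Fin m) k where
  val := Matrix.diagonal d
  inv := Matrix.diagonal fun i => (d i)⁻¹
  val_inv := by simp [hd]
  inv_val := by simp [hd]

theorem diagGL_mem_borel {m : ℕ} (d : Fin m → k) (hd : ∀ i, d i ≠ 0) :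
    diagGL d hd ∈ borel k m :=
  mem_borel_iff.2 fun _ _ h => Matrix.diagonal_apply_ne _ h.ne'

/-- One scalar per pair is enough: the larger index is scaled by the inverse of the entry above the
diagonal, and the sign below it follows by antisymmetry. -/
theorem HasShape.exists_diag {A : Matrix (Fin (2 * n)) (Fin (2 * n)) k} {π : FreeInv n}
    (h : HasShape A π) : ∃ t ∈ borel k (2 * n), t.1 * A * t.1ᵀ = mono k π := by
  have hA : ∀ i, A i (π.1 i) ≠ 0 := fun i => (h.2 _ _).2 rfl
  let d : Fin (2 * n) → k := fun i => if i < π.1 i then 1 else (A (π.1 i) i)⁻¹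
  have hd : ∀ i, d i ≠ 0 := fun i => by
    simp only [d]
    split_ifs
    · exact one_ne_zero
    · exact inv_ne_zero ((h.2 _ _).2 (π.apply_apply i))
  refine ⟨diagGL d hd, diagGL_mem_borel d hd, ?_⟩
  ext i j
  have h1 : ((diagGL d hd).1 * A * (diagGL d hd).1ᵀ) i j = d i * A i j * d j := by
    simp [diagGL]
  rw [h1]
  simp only [mono, Matrix.of_apply]
  by_cases hij : π.1 i = j
  · subst hij
    rw [if_pos rfl]
    simp only [d, π.apply_apply]
    rcases π.lt_or_lt i with hl | hl
    · rw [if_pos hl, if_neg hl.asymm, if_pos hl, one_mul, mul_inv_cancel₀ (hA i)]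
    · rw [if_neg hl.asymm, if_pos hl, if_neg hl.asymm, mul_one, h.1.2 i, mul_neg,
        inv_mul_cancel₀ ((h.2 _ _).2 (π.apply_apply i))]
  · rw [if_neg hij, h.apply_eq_zero hij, mul_zero, zero_mul]

theorem exists_hasShape_gram (π : FreeInv n) :
    ∃ g : GL (Fin (2 * n)) k, HasShape (gram g) π := by
  obtain ⟨σ, hσ⟩ := π.exists_perm
  refine ⟨permGL k σ, isAlt_gram _, fun i j => ?_⟩
  obtain ⟨a, rfl⟩ := σ.surjective i
  obtain ⟨b, rfl⟩ := σ.surjective j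
  obtain ⟨a, rfl⟩ := (halves n).surjective a
  obtain ⟨b, rfl⟩ := (halves n).surjective b
  rw [gram, mul_permGL_transpose_apply, permGL_mul_apply, Equiv.Perm.inv_def,
    Equiv.symm_apply_apply, Equiv.symm_apply_apply, sympForm_halves]
  have h2 : ∀ i, π.1 (σ (halves n (Sum.inr i))) = σ (halves n (Sum.inl i)) := fun i => by
    rw [← (hσ i).2, π.apply_apply]
  rcases a with a | a <;> rcases b with b | b <;>
    simp [Matrix.J, (hσ _).2, h2, Matrix.one_apply]

theorem exists_gram_eq_mono (π : FreeInv n) : ∃ g : GL (Fin (2 * n)) k, gram g = mono k π := by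
  obtain ⟨g, hg⟩ := exists_hasShape_gram (k := k) π
  obtain ⟨t, -, ht⟩ := hg.exists_diag
  exact ⟨t * g, by rw [gram_mul, ht]⟩

/-- A point of `GL_{2n} / Sp_{2n}` over the monomial matrix of `π`. -/
noncomputable def reprX (k : Type*) [Field k] {n : ℕ} (π : FreeInv n) : GL (Fin (2 * n)) k :=
  (exists_gram_eq_mono π).choose

theorem gram_reprX (π : FreeInv n) : gram (reprX k π) = mono k π :=
  (exists_gram_eq_mono π).choose_spec

/-- The Borel orbit of the monomial matrix of `π`. -/
noncomputable def orbX (k : Type*) [Field k] {n : ℕ} (π : FreeInv n) : BorelOrbits (Sp k n) :=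
  borelOrbit (Sp k n) (QuotientGroup.mk (reprX k π))

theorem borelOrbit_eq_orbX {g : GL (Fin (2 * n)) k} {π : FreeInv n} (h : HasShape (gram g) π) :
    borelOrbit (Sp k n) (QuotientGroup.mk g) = orbX k π := by
  obtain ⟨t, ht, h'⟩ := h.exists_diag
  refine (borelOrbit_mk_eq_iff_gram.2 ⟨t, ht, ?_⟩).symm
  rw [gram_reprX, h']

/-- After elimination, antisymmetry makes the map from a row to its nonzero column an involution,
and the zero diagonal excludes fixed points. -/
theorem exists_eq_orbX (O : BorelOrbits (Sp k n)) : ∃ π, O = orbX k π := by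
  obtain ⟨g, rfl⟩ := exists_borelOrbit_eq O
  obtain ⟨b, hb, h⟩ := (isAlt_gram g).exists_monomial (det_gram_ne_zero g)
  rw [← gram_mul] at h
  choose f hf hf' using h
  have halt := isAlt_gram (b * g)
  have huniq : ∀ i j, gram (b * g) i j ≠ 0 → f i = j := fun i j hij => by
    by_contra hne
    exact hij (hf' i j (Ne.symm hne))
  have hinv : ∀ i, f (f i) = i := fun i => huniq _ _ (by
    rw [halt.2]; exact neg_ne_zero.2 (hf i))
  let π : FreeInv n := ⟨⟨f, f, hinv, hinv⟩, hinv, fun i (hi : f i = i) => hf i (by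
    rw [hi, halt.1])⟩
  refine ⟨π, ?_⟩
  rw [← borelOrbit_eq_orbX (g := b * g) (π := π) ⟨halt, fun i j => ⟨huniq i j, ?_⟩⟩]
  · exact (borelOrbit_smul hb (QuotientGroup.mk g)).symm
  · rintro rfl
    exact hf i

end Symplectic

end SpDual

namespace SpDual

/-! ### Closures and Knop's action on the Borel orbits of `X` -/

section SymplecticClosure

variable {k : Type*} [Field k] {n : ℕ}

theorem isPartialMonomial_mono (π : FreeInv n) : IsPartialMonomial (mono k π) := by
  have h := (hasShape_mono (k := k) π).2
  constructor
  · intro i j j' h1 h2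
    rw [← (h _ _).1 h1, ← (h _ _).1 h2]
  · intro i i' j h1 h2
    exact π.1.injective (((h _ _).1 h1).trans ((h _ _).1 h2).symm)

theorem exists_poly_minor_gram (T : Finset (Fin (2 * n) × Fin (2 * n))) :
    ∃ p : MvPolynomial (Fin (2 * n) × Fin (2 * n)) k, ∀ g : GL (Fin (2 * n)) k,
      MvPolynomial.eval (fun ij => g ij.1 ij.2) p =
        ((gram g).submatrix (fun t : T => t.1.1) (fun t : T => t.1.2)).det := by
  let G : Matrix (Fin (2 * n)) (Fin (2 * n)) (MvPolynomial (Fin (2 * n) × Fin (2 * n)) k) :=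
    Matrix.of fun i j => MvPolynomial.X (i, j)
  refine ⟨((G * (sympForm k n).map MvPolynomial.C * Gᵀ).submatrix
    (fun t : T => t.1.1) (fun t : T => t.1.2)).det, fun g => ?_⟩
  rw [RingHom.map_det]
  congr 1
  ext t t'
  simp [gram, Matrix.mul_apply, G]

/-- Minors of `g J gᵀ` are polynomials in `g`, and upper triangular congruence preserves lower right
corners, so corner ranks cannot grow on passing to the closure. -/
theorem card_corner_le_of_closure {π π' : FreeInv n}
    (h : (orbX k π).orbit ⊆ closure[zariskiQuot (Sp k n)] (orbX k π').orbit)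
    {R C : Finset (Fin (2 * n))} (hR : ∀ i ∈ R, ∀ x, i ≤ x → x ∈ R)
    (hC : ∀ j ∈ C, ∀ y, j ≤ y → y ∈ C) :
    (entries (mono k π) ∩ R ×ˢ C).card ≤ (entries (mono k π') ∩ R ×ˢ C).card := by
  refine card_corner_le (isPartialMonomial_mono π) fun T hT => ?_
  obtain ⟨p, hp⟩ := exists_poly_minor_gram (k := k) T
  have hmem : QuotientGroup.mk (reprX k π) ∈ (orbX k π).orbit :=
    mem_orbit_borelOrbit.2 ⟨1, one_mem _, (one_smul _ _).symm⟩
  have := eval_eq_zero_of_subset_closure h p (fun g hg => ?_) hmem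
  · rwa [hp, gram_reprX] at this
  · obtain ⟨b, hb, hgb⟩ := mem_orbit_borelOrbit.1 hg
    have h1 : gram g = gram (b * reprX k π') := mk_eq_mk_iff_gram.1 hgb
    rw [hp, h1, gram_mul, gram_reprX]
    refine hT _ _ (fun i hi x hx => mem_borel_iff.1 hb i x ?_) fun j hj y hy => ?_
    · exact not_le.1 fun hle => hx (hR i hi x hle)
    · exact mem_borel_iff.1 hb j y (not_le.1 fun hle => hy (hC j hj y hle))

theorem orbX_closure_antisymm {π π' : FreeInv n}
    (h : (orbX k π).orbit ⊆ closure[zariskiQuot (Sp k n)] (orbX k π').orbit)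
    (h' : (orbX k π').orbit ⊆ closure[zariskiQuot (Sp k n)] (orbX k π).orbit) : π = π' := by
  have he : entries (mono k π) = entries (mono k π') :=
    eq_of_card_corner_eq false fun R C hR hC => le_antisymm
      (card_corner_le_of_closure h hR (by simpa using hC))
      (card_corner_le_of_closure h' hR (by simpa using hC))
  refine FreeInv.ext' fun x => ?_
  have h1 : (x, π.1 x) ∈ entries (mono k π) := mem_entries.2 (((hasShape_mono π).2 _ _).2 rfl)
  rw [he, mem_entries] at h1
  exact (((hasShape_mono π').2 _ _).1 h1).symm

theorem orbX_injective : Function.Injective (orbX k : FreeInv n → BorelOrbits (Sp k n)) := by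
  intro π π' h
  have hc : (orbX k π).orbit ⊆ closure[zariskiQuot (Sp k n)] (orbX k π).orbit := by
    let _ := zariskiQuot (Sp k n)
    exact subset_closure
  refine orbX_closure_antisymm (k := k) ?_ ?_
  · rw [← h]; exact hc
  · rw [← h]; exact hc

/-- There is no term quadratic in `y`, because its coefficient is the diagonal entry `A b b`. -/
theorem IsAlt.elemGL_congr_apply {m : ℕ} {A : Matrix (Fin m) (Fin m) k} (hA : IsAlt A)
    {a b : Fin m} (h : a ≠ b) (y : k) (i j : Fin m) :
    ((elemGL h y).1 * A * (elemGL h y).1ᵀ) i j =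
      A i j + (if a = i then y * A b j else 0) + if a = j then y * A i b else 0 := by
  have h1 : ∀ (M : Matrix (Fin m) (Fin m) k) i j, ((elemGL h y).1 * M) i j =
      M i j + if a = i then y * M b j else 0 := by
    intro M i j
    rw [coe_elemGL, add_mul, one_mul, Matrix.add_apply]
    congr 1
    split_ifs with hi
    · subst hi; simp
    · rw [Matrix.single_mul_apply_of_ne]; exact fun e => hi e.symm
  have h2 : ∀ (M : Matrix (Fin m) (Fin m) k) i j, (M * (elemGL h y).1ᵀ) i j =
      M i j + if a = j then y * M i b else 0 := by
    intro M i j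
    rw [← Matrix.transpose_transpose M, ← Matrix.transpose_mul, Matrix.transpose_apply, h1]
    rfl
  rw [h2, h1, h1]
  by_cases hi : a = i <;> by_cases hj : a = j <;> simp [hi, hj, hA.1]

/-- If `i` and `i + 1` are partners, the lower unipotent element preserves the form. Otherwise it
changes only the entry `(i + 1, π i)` and its transpose. Adding `y` times row `π (i + 1)` to row `π
i` changes the same two entries, and is upper triangular because `π i < π (i + 1)`; matching the two
changes determines `y`. -/
theorem isOpenType_reprX {i : Fin (2 * n - 1)} {π : FreeInv n}
    (h : π.1 (lo i) = hi i ∨ π.1 (lo i) < π.1 (hi i)) :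
    IsOpenType i (QuotientGroup.mk (reprX k π) : GL (Fin (2 * n)) k ⧸ Sp k n) := by
  intro x
  have hs := hasShape_mono (k := k) π
  set A := mono k π with hA
  suffices H : ∃ b ∈ borel k (2 * n), (lowGL i x).1 * A * (lowGL i x).1ᵀ = b.1 * A * b.1ᵀ by
    obtain ⟨b, hb, hbA⟩ := H
    refine ⟨b, hb, mk_eq_mk_iff_gram.2 ?_⟩
    change gram (lowGL i x * reprX k π) = gram (b * reprX k π)
    rw [gram_mul, gram_mul, gram_reprX, hbA]
  by_cases hm : π.1 (lo i) = hi i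
  · have hm' : π.1 (hi i) = lo i := by rw [← hm, π.apply_apply]
    refine ⟨1, one_mem _, ?_⟩
    ext a c
    rw [lowGL, hs.1.elemGL_congr_apply]
    simp only [Units.val_one, one_mul, Matrix.transpose_one, mul_one]
    by_cases ha : hi i = a <;> by_cases hc : hi i = c
    · subst ha; subst hc
      rw [hs.1.2 (lo i)]; simp
    · subst ha
      rw [hs.apply_eq_zero (i := lo i) (j := c) (by rwa [hm])]; simp [hc]
    · subst hc
      rw [hs.apply_eq_zero (i := a) (j := lo i) (fun e => ha (by rw [← hm, ← e, π.apply_apply]))]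
      simp [ha]
    · simp [ha, hc]
  · have hlt := h.resolve_left hm
    set a := π.1 (hi i) with ha
    set b := π.1 (lo i) with hb
    have hane : A (hi i) a ≠ 0 := (hs.2 _ _).2 rfl
    set y := x * A (lo i) b / A (hi i) a with hy
    have hy1 : y * A (hi i) a = x * A (lo i) b := by rw [hy]; field_simp
    have hbh : b ≠ hi i := hm
    have e1 : ∀ j, j ≠ b → A (lo i) j = 0 := fun j hj => hs.apply_eq_zero hj.symm
    have e2 : ∀ j, j ≠ hi i → A a j = 0 := fun j hj => hs.apply_eq_zero (by
      rw [ha, π.apply_apply]; exact hj.symm)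
    refine ⟨elemGL hlt.ne y, elemGL_mem_borel hlt y, ?_⟩
    ext p q
    rw [lowGL, hs.1.elemGL_congr_apply, hs.1.elemGL_congr_apply, hs.1.2 p (lo i), hs.1.2 p a,
      add_assoc, add_assoc]
    congr 1
    have e3 : A (hi i) a = -A a (hi i) := hs.1.2 _ _
    by_cases hp : hi i = p
    · subst hp
      rw [if_pos rfl, if_neg hbh, zero_add, e1 (hi i) hbh.symm]
      by_cases hq : b = q
      · subst hq
        rw [if_pos rfl, ← e3, hy1]; simp
      · rw [if_neg hq, e1 q (Ne.symm hq)]; simp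
    · rw [if_neg hp, zero_add, e2 p (Ne.symm hp)]
      by_cases hq : hi i = q
      · subst hq
        rw [if_pos rfl, if_neg hbh, add_zero]
        by_cases hp' : b = p
        · subst hp'
          rw [if_pos rfl, mul_neg, ← hy1, e3]; ring
        · rw [if_neg hp', e1 p (Ne.symm hp')]; simp
      · rw [if_neg hq, e2 q (Ne.symm hq)]; simp

theorem hasShape_gram_refl {g : GL (Fin (2 * n)) k} {π : FreeInv n} (h : HasShape (gram g) π)
    (i : Fin (2 * n - 1)) : HasShape (gram (reflGL k i * g)) (simpleRefl i • π) := by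
  refine ⟨isAlt_gram _, fun a b => ?_⟩
  rw [gram_mul, reflGL, mul_permGL_transpose_apply, permGL_mul_apply, h.2, simpleRefl_inv,
    FreeInv.refl_smul_apply]
  nth_rw 2 [← simpleRefl_inv]
  rw [Equiv.Perm.eq_inv_iff_eq]

theorem borelOrbit_refl_smul_reprX (i : Fin (2 * n - 1)) (π : FreeInv n) :
    borelOrbit (Sp k n) (reflGL k i • QuotientGroup.mk (reprX k π)) = orbX k (simpleRefl i • π) :=
  borelOrbit_eq_orbX (hasShape_gram_refl (by rw [gram_reprX]; exact hasShape_mono π) i)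

/-- For `p` in the stabilizer, compare the entries of `p A = A p⁻ᵀ` at `(i + 1, π i)`. The left side
is a nonzero multiple of `p (i + 1) i`. The right side is a multiple of the `(π i, π (i + 1))` entry
of `p⁻¹`, which is below the diagonal and, as `π i ≠ i + 1`, not the free entry of `P_s`. -/
theorem fixedType_orbX {i : Fin (2 * n - 1)} {π : FreeInv n}
    (hm : π.1 (lo i) ≠ hi i) (h : π.1 (hi i) < π.1 (lo i)) : FixedType i (orbX k π) := by
  refine fixedType_borelOrbit fun p hp hpz => mem_borel_of_mem_minParabolic hp ?_
  have hs := hasShape_mono (k := k) π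
  have h1 : gram (p * reprX k π) = gram (reprX k π) := mk_eq_mk_iff_gram.1 hpz
  rw [gram_mul, gram_reprX] at h1
  have h2 : p.1 * mono k π = mono k π * (p⁻¹).1ᵀ := by
    have h3 : p.1ᵀ * (p⁻¹).1ᵀ = 1 := by
      rw [← Matrix.transpose_mul, ← Units.val_mul, inv_mul_cancel]; simp
    rw [← h1, Matrix.mul_assoc (p.1 * mono k π), h3, mul_one, h1]
  have h4 := congrFun (congrFun h2 (hi i)) (π.1 (lo i))
  rw [Matrix.mul_apply, Matrix.mul_apply, Finset.sum_eq_single (lo i),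
    Finset.sum_eq_single (π.1 (hi i))] at h4
  · have h5 : (p⁻¹) (π.1 (lo i)) (π.1 (hi i)) = 0 :=
      mem_minParabolic_iff.1 (inv_mem hp) _ _ h fun e => hm e.1
    rw [Matrix.transpose_apply, h5, mul_zero] at h4
    exact (mul_eq_zero.1 h4).resolve_right ((hs.2 _ _).2 rfl)
  · intro l _ hl
    rw [hs.apply_eq_zero hl.symm, zero_mul]
  · simp
  · intro l _ hl
    rw [hs.apply_eq_zero fun e => hl (π.1.injective e), mul_zero]
  · simp

/-- For partners the `P_s`-orbit is a single Borel orbit. Otherwise exactly one of `π` and `s π s`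
satisfies the inequality of the open orbit, and `IsOpenType.knopRefl_pair` applied to it settles
both. -/
theorem knopRefl_orbX (i : Fin (2 * n - 1)) (π : FreeInv n) :
    knopRefl i (orbX k π) = orbX k (simpleRefl i • π) := by
  by_cases hm : π.1 (lo i) = hi i
  · have := (isOpenType_reprX (k := k) (Or.inl hm)).knopRefl_of_eq (by
      rw [borelOrbit_refl_smul_reprX, FreeInv.refl_smul_of_matched hm]; rfl)
    rw [FreeInv.refl_smul_of_matched hm]
    exact this
  · have key : ∀ π : FreeInv n, π.1 (lo i) ≠ hi i → π.1 (lo i) < π.1 (hi i) →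
        knopRefl i (orbX k π) = orbX k (simpleRefl i • π) ∧
          knopRefl i (orbX k (simpleRefl i • π)) = orbX k π := by
      intro π hm hlt
      have h := (isOpenType_reprX (k := k) (Or.inr hlt)).knopRefl_pair
      rw [borelOrbit_refl_smul_reprX] at h
      refine h (fun e => FreeInv.refl_smul_ne hm (orbX_injective e)) (fixedType_orbX ?_ ?_)
      · exact FreeInv.refl_smul_unmatched hm
      · rwa [FreeInv.refl_smul_lo hm, FreeInv.refl_smul_hi hm]
    rcases lt_or_gt_of_ne (fun e => lo_ne_hi i (π.1.injective e)) with hlt | hlt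
    · exact (key π hm hlt).1
    · have := (key (simpleRefl i • π) (FreeInv.refl_smul_unmatched hm) (by
        rwa [FreeInv.refl_smul_lo hm, FreeInv.refl_smul_hi hm])).2
      rwa [FreeInv.refl_smul_refl_smul] at this

theorem orbX_subset_closure_iff [Infinite k] {i : Fin (2 * n - 1)} {π : FreeInv n}
    (hm : π.1 (lo i) ≠ hi i) :
    (orbX k π).orbit ⊆ closure[zariskiQuot (Sp k n)] (orbX k (simpleRefl i • π)).orbit ↔
      π.1 (hi i) < π.1 (lo i) := by
  have key : ∀ π : FreeInv n, π.1 (lo i) ≠ hi i → π.1 (lo i) < π.1 (hi i) →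
      (orbX k (simpleRefl i • π)).orbit ⊆ closure[zariskiQuot (Sp k n)] (orbX k π).orbit := by
    intro π _ hlt
    rw [← borelOrbit_refl_smul_reprX]
    exact (isOpenType_reprX (k := k) (Or.inr hlt)).subset_closure
  constructor
  · intro h
    by_contra hlt
    have hlt' := lt_of_le_of_ne (not_lt.1 hlt) fun e => lo_ne_hi i (π.1.injective e)
    exact FreeInv.refl_smul_ne hm (orbX_closure_antisymm (key π hm hlt') h)
  · intro hlt
    have := key (simpleRefl i • π) (FreeInv.refl_smul_unmatched hm) (by
      rwa [FreeInv.refl_smul_lo hm, FreeInv.refl_smul_hi hm])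
    rwa [FreeInv.refl_smul_refl_smul] at this

end SymplecticClosure

end SpDual

namespace SpDual

/-! ### Square-zero matrices up to upper triangular conjugation -/

section SquareZero

variable {k : Type*} [Field k] {m : ℕ}

/-- Strictly upper triangular matrices. -/
def StrictUpper {R : Type*} [Zero R] (Y : Matrix (Fin m) (Fin m) R) : Prop :=
  ∀ i j, j ≤ i → Y i j = 0

theorem StrictUpper.mul_left {R : Type*} [CommRing R] {Y b : Matrix (Fin m) (Fin m) R}
    (hY : StrictUpper Y) (hb : ∀ a c : Fin m, c < a → b a c = 0) : StrictUpper (b * Y) :=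
  fun i j hij => (Matrix.mul_apply ..).trans <| Finset.sum_eq_zero fun l _ => by
    rcases lt_or_ge l i with h | h
    · rw [hb i l h, zero_mul]
    · rw [hY l j (hij.trans h), mul_zero]

theorem StrictUpper.mul_right {R : Type*} [CommRing R] {Y b : Matrix (Fin m) (Fin m) R}
    (hY : StrictUpper Y) (hb : ∀ a c : Fin m, c < a → b a c = 0) : StrictUpper (Y * b) :=
  fun i j hij => (Matrix.mul_apply ..).trans <| Finset.sum_eq_zero fun l _ => by
    rcases lt_or_ge j l with h | h
    · rw [hb l j h, mul_zero]
    · rw [hY i l (h.trans hij), zero_mul]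

theorem StrictUpper.conj {Y : Matrix (Fin m) (Fin m) k} (hY : StrictUpper Y)
    {b : GL (Fin m) k} (hb : b ∈ borel k m) : StrictUpper (b.1 * Y * b⁻¹.1) :=
  (hY.mul_left (mem_borel_iff.1 hb)).mul_right (mem_borel_iff.1 (inv_mem hb))

theorem conj_anticomm {R : Type*} [CommRing R] (b : GL (Fin m) R) {N Y : Matrix (Fin m) (Fin m) R}
    (h : N * Y + Y * N = 1) :
    (b.1 * N * b⁻¹.1) * (b.1 * Y * b⁻¹.1) + (b.1 * Y * b⁻¹.1) * (b.1 * N * b⁻¹.1) = 1 := by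
  have hb : b⁻¹.1 * b.1 = 1 := b.inv_mul
  have hb' : b.1 * b⁻¹.1 = 1 := b.mul_inv
  calc _ = b.1 * N * (b⁻¹.1 * b.1) * Y * b⁻¹.1 + b.1 * Y * (b⁻¹.1 * b.1) * N * b⁻¹.1 := by
        simp only [Matrix.mul_assoc]
    _ = b.1 * (N * Y + Y * N) * b⁻¹.1 := by
        rw [hb]; simp only [mul_one, Matrix.mul_assoc, mul_add, add_mul]
    _ = 1 := by rw [h, mul_one, hb']

theorem conj_sq_zero {R : Type*} [CommRing R] (b : GL (Fin m) R) {N : Matrix (Fin m) (Fin m) R}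
    (h : N * N = 0) : (b.1 * N * b⁻¹.1) * (b.1 * N * b⁻¹.1) = 0 := by
  have hb : b⁻¹.1 * b.1 = 1 := b.inv_mul
  calc _ = b.1 * (N * (b⁻¹.1 * b.1) * N) * b⁻¹.1 := by simp only [Matrix.mul_assoc]
    _ = 0 := by rw [hb, mul_one, h]; simp

/-- `N e_l` is a nonzero multiple of `e_i`, and `e_l`, `e_i` span a direct summand. -/
structure IsLink (N : Matrix (Fin m) (Fin m) k) (l i : Fin m) : Prop where
  ne_zero : N i l ≠ 0
  col_source : ∀ x, x ≠ i → N x l = 0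
  row_target : ∀ y, y ≠ l → N i y = 0
  row_source : ∀ y, N l y = 0
  col_target : ∀ x, N x i = 0

/-- The indices outside `S` are linked among themselves. -/
def IsLinkedOff (S : Finset (Fin m)) (N : Matrix (Fin m) (Fin m) k) : Prop :=
  ∀ a ∉ S, ∃ c ∉ S, IsLink N a c ∨ IsLink N c a

theorem IsLinkedOff.apply_eq_zero {S : Finset (Fin m)} {N : Matrix (Fin m) (Fin m) k}
    (h : IsLinkedOff S N) {a x : Fin m} (ha : a ∉ S) (hx : x ∈ S) : N a x = 0 ∧ N x a = 0 := by
  obtain ⟨c, hc, hl | hl⟩ := h a ha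
  · exact ⟨hl.row_source x, hl.col_source x fun e => hc (e ▸ hx)⟩
  · exact ⟨hl.row_target x fun e => hc (e ▸ hx), hl.col_target x⟩

/-- The matrix `1 - e_l dᵀ`, where `d l = 0`. -/
def rowShearGL (l : Fin m) (d : Fin m → k) (hd : d l = 0) : GL (Fin m) k where
  val := 1 - Matrix.vecMulVec (Pi.single l 1) d
  inv := 1 + Matrix.vecMulVec (Pi.single l 1) d
  val_inv := by
    simp [mul_add, sub_mul, Matrix.vecMulVec_mul_vecMulVec, hd]
  inv_val := by
    simp [mul_sub, add_mul, Matrix.vecMulVec_mul_vecMulVec, hd]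

theorem mul_rowShearGL_apply (l : Fin m) (d : Fin m → k) (hd : d l = 0)
    (A : Matrix (Fin m) (Fin m) k) (a x : Fin m) :
    (A * (rowShearGL l d hd).1) a x = A a x - A a l * d x := by
  simp [rowShearGL, mul_sub, Matrix.mul_vecMulVec, Matrix.vecMulVec_apply]

theorem rowShearGL_inv_mul_apply (l : Fin m) (d : Fin m → k) (hd : d l = 0)
    (A : Matrix (Fin m) (Fin m) k) {a : Fin m} (ha : a ≠ l) (x : Fin m) :
    ((rowShearGL l d hd)⁻¹.1 * A) a x = A a x := by
  change ((1 + Matrix.vecMulVec (Pi.single l 1) d) * A) a x = _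
  simp [add_mul, Matrix.vecMulVec_mul, Matrix.vecMulVec_apply, ha]

theorem rowShearGL_mem_borel {l : Fin m} {d : Fin m → k} (hd : d l = 0)
    (h : ∀ a, a < l → d a = 0) : rowShearGL l d hd ∈ borel k m :=
  mem_borel_iff.2 fun a x hax => by
    have : rowShearGL l d hd a x = (1 : Matrix (Fin m) (Fin m) k) a x -
        (1 : Matrix (Fin m) (Fin m) k) a l * d x := by
      have := mul_rowShearGL_apply l d hd 1 a x
      rwa [one_mul] at this
    rw [this, Matrix.one_apply_ne hax.ne', zero_sub]
    rcases eq_or_ne a l with rfl | hal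
    · rw [h x hax, mul_zero, neg_zero]
    · rw [Matrix.one_apply_ne hal, zero_mul, neg_zero]

/-- One elimination step for conjugation. Let `l` be the first index of `S` with a nonzero column
and `i` the last row where this column is nonzero. Replacing `e_i` by a multiple of `N e_l` is upper
triangular because `i` is last. Subtracting multiples of `e_l` from later basis vectors then clears
row `i`, upper triangular because `l` is first. Now `N² = 0` makes `e_l` and `e_i` span a direct
summand. -/
theorem exists_linkedOff_sdiff {N : Matrix (Fin m) (Fin m) k} (hN : N * N = 0)
    (hY : ∃ Y, N * Y + Y * N = 1) {S : Finset (Fin m)} (hS : S.Nonempty)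
    (h : IsLinkedOff S N) :
    ∃ b ∈ borel k m, ∃ S' ⊂ S, IsLinkedOff S' (b.1 * N * b⁻¹.1) := by
  classical
  -- This is the only use of `Y`: if all columns in `S` vanished, a diagonal entry of `N Y + Y N` at
  -- an index of `S` would be `0`.
  have hex : (S.filter fun x => ∃ a, N a x ≠ 0).Nonempty := by
    by_contra hcon
    have hz : ∀ x ∈ S, ∀ a, N a x = 0 := by
      intro x hx a
      by_contra hne
      exact hcon ⟨x, Finset.mem_filter.2 ⟨hx, a, hne⟩⟩
    obtain ⟨Y, hY⟩ := hY
    obtain ⟨a, ha⟩ := hS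
    have h1 : (N * Y + Y * N) a a = 0 := by
      rw [Matrix.add_apply, Matrix.mul_apply, Matrix.mul_apply, Finset.sum_eq_zero,
        Finset.sum_eq_zero, add_zero]
      · intro y _; rw [hz a ha, mul_zero]
      · intro y _
        have : N a y = 0 := by
          by_cases hy : y ∈ S
          · exact hz y hy a
          · exact (h.apply_eq_zero hy ha).2
        rw [this, zero_mul]
    rw [hY, Matrix.one_apply_eq] at h1
    exact one_ne_zero h1
  set l := (S.filter fun x => ∃ a, N a x ≠ 0).min' hex with hl
  obtain ⟨hlS, hlcol⟩ := Finset.mem_filter.1 (Finset.min'_mem _ hex)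
  rw [← hl] at hlS hlcol
  have hlmin : ∀ x ∈ S, x < l → ∀ a, N a x = 0 := fun x hx hxl a => by
    by_contra hne
    exact absurd (Finset.min'_le _ x (Finset.mem_filter.2 ⟨hx, a, hne⟩)) hxl.not_ge
  have hne : (Finset.univ.filter fun x => N x l ≠ 0).Nonempty :=
    hlcol.imp fun x hx => by simpa using hx
  set i := (Finset.univ.filter fun x => N x l ≠ 0).max' hne with hi
  have hil : N i l ≠ 0 := (Finset.mem_filter.1 (Finset.max'_mem _ hne)).2
  have himax : ∀ x, i < x → N x l = 0 := fun x hx => by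
    by_contra hx0
    exact absurd (Finset.le_max' _ x (Finset.mem_filter.2 ⟨Finset.mem_univ x, hx0⟩)) hx.not_ge
  have hiS : i ∈ S := by
    by_contra hiS
    exact hil (h.apply_eq_zero hiS hlS).1
  -- If `i = l`, the earlier entries of row `l` and the later entries of column `l` vanish, so the
  -- `(l, l)` entry of `N²` is the square of `N l l`.
  have hine : i ≠ l := by
    intro e
    have h0 : (N * N) l l = 0 := by rw [hN]; rfl
    rw [Matrix.mul_apply, Finset.sum_eq_single l] at h0
    · rw [e] at hil
      exact hil (mul_self_eq_zero.1 h0)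
    · intro y _ hyl
      rcases lt_or_gt_of_ne hyl with hlt | hgt
      · have : N l y = 0 := by
          by_cases hy : y ∈ S
          · exact hlmin y hy hlt l
          · exact (h.apply_eq_zero hy hlS).2
        rw [this, zero_mul]
      · rw [himax y (e ▸ hgt), mul_zero]
    · simp
  -- replace `e_i` by `N e_l`
  let c : Fin m → k := fun x => if x = i then 0 else N x l / N i l
  have hci : c i = 0 := if_pos rfl
  have hc : ∀ x, x ≠ i → c x = N x l / N i l := fun x hx => if_neg hx
  have hcS : ∀ x, x ∉ S → c x = 0 := fun x hx => by
    rw [hc x (fun e => hx (e ▸ hiS)), (h.apply_eq_zero hx hlS).1, zero_div]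
  set u₁ := shearGL i c hci with hu₁
  have hu₁B : u₁ ∈ borel k m := shearGL_mem_borel hci fun a ha => by
    rw [hc a ha.ne', himax a ha, zero_div]
  -- The vector `e_i + c` is a multiple of `N e_l`, hence killed by `N`.
  have hNc : ∀ a, (N *ᵥ c) a = -N a i := by
    intro a
    have h0 : (N * N) a l = 0 := by rw [hN]; rfl
    have h1 : ∀ y, N a y * c y * N i l = N a y * N y l - (if y = i then N a y * N i l else 0) := by
      intro y
      by_cases hy : y = i
      · subst hy; rw [hci, if_pos rfl]; ring
      · rw [hc y hy, if_neg hy]; field_simp; ring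
    have h2 : (N *ᵥ c) a * N i l = -N a i * N i l := by
      rw [Matrix.mulVec, dotProduct, Finset.sum_mul, Finset.sum_congr rfl fun y _ => h1 y,
        Finset.sum_sub_distrib, ← Matrix.mul_apply, h0, Finset.sum_ite_eq']
      simp
    exact mul_right_cancel₀ hil h2
  set N₁ := u₁⁻¹.1 * (N * u₁.1) with hN₁
  have hN₁app : ∀ a x, N₁ a x = if x = i then 0 else N a x - c a * N i x := by
    intro a x
    rw [hN₁, shearGL_inv_mul_apply, mul_shearGL_apply, mul_shearGL_apply, hNc, hNc]
    by_cases hx : x = i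
    · subst hx; simp
    · simp [hx]
  have h₁l : ∀ a, a ≠ i → N₁ a l = 0 := fun a ha => by
    rw [hN₁app, if_neg hine.symm, hc a ha]; field_simp; ring
  have h₁il : N₁ i l = N i l := by rw [hN₁app, if_neg hine.symm, hci]; ring
  have h₁off : ∀ a x, (a ∉ S ∨ x ∉ S) → N₁ a x = N a x := by
    rintro a x (ha | hx)
    · rw [hN₁app, hcS a ha]
      split_ifs with hx
      · rw [hx, (h.apply_eq_zero ha hiS).1]
      · ring
    · rw [hN₁app, if_neg (fun e : x = i => hx (e ▸ hiS)), (h.apply_eq_zero hx hiS).2]; ring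
  -- clear the row `i`
  let d : Fin m → k := fun x => if x = l then 0 else N₁ i x / N i l
  have hdl : d l = 0 := if_pos rfl
  have hd : ∀ x, x ≠ l → d x = N₁ i x / N i l := fun x hx => if_neg hx
  set u₂ := rowShearGL l d hdl with hu₂
  have hu₂B : u₂ ∈ borel k m := rowShearGL_mem_borel hdl fun a ha => by
    have : N₁ i a = 0 := by
      by_cases haS : a ∈ S
      · rw [hN₁app, hlmin a haS ha]; simp
      · rw [h₁off i a (Or.inr haS), (h.apply_eq_zero haS hiS).2]
    rw [hd a ha.ne, this, zero_div]
  set N₂ := u₂⁻¹.1 * (N₁ * u₂.1) with hN₂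
  have hconj : ((u₁ * u₂)⁻¹).1 * N * ((u₁ * u₂)⁻¹)⁻¹.1 = N₂ := by
    rw [hN₂, hN₁, inv_inv, mul_inv_rev, Units.val_mul, Units.val_mul]
    simp only [Matrix.mul_assoc]
  have hN₂sq : N₂ * N₂ = 0 := by rw [← hconj]; exact conj_sq_zero _ hN
  have hN₂app : ∀ a x, a ≠ l → N₂ a x = N₁ a x - N₁ a l * d x := fun a x ha => by
    rw [hN₂, rowShearGL_inv_mul_apply _ _ _ _ ha, mul_rowShearGL_apply]
  have h₂il : N₂ i l = N i l := by rw [hN₂app i l hine, hdl, h₁il]; ring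
  have h₂i : ∀ x, x ≠ l → N₂ i x = 0 := fun x hx => by
    rw [hN₂app i x hine, hd x hx, h₁il]; field_simp; ring
  -- Row `i` has its only nonzero entry in column `l`, so row `i` of `N₂² = 0` is a multiple of row
  -- `l`.
  have h₂l : ∀ x, N₂ l x = 0 := fun x => by
    have h0 : (N₂ * N₂) i x = 0 := by rw [hN₂sq]; rfl
    rw [Matrix.mul_apply, Finset.sum_eq_single l (fun y _ hy => by rw [h₂i y hy, zero_mul])
      (by simp), h₂il] at h0
    exact (mul_eq_zero.1 h0).resolve_left hil
  have h₂other : ∀ a x, a ≠ l → a ≠ i → N₂ a x = N₁ a x := fun a x h1 h2 => by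
    rw [hN₂app a x h1, h₁l a h2]; ring
  have hlink : IsLink N₂ l i := by
    refine ⟨by rwa [h₂il], fun x hx => ?_, h₂i, h₂l, fun x => ?_⟩
    · by_cases hxl : x = l
      · rw [hxl, h₂l]
      · rw [h₂other x l hxl hx, h₁l x hx]
    · by_cases hxl : x = l
      · rw [hxl, h₂l]
      · by_cases hxi : x = i
        · rw [hxi, h₂i i hine]
        · rw [h₂other x i hxl hxi, hN₁app, if_pos rfl]
  have h₂off : ∀ a x, (a ∉ S ∨ x ∉ S) → N₂ a x = N a x := by
    intro a x hax
    by_cases hal : a = l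
    · subst hal
      have hx := hax.resolve_left (not_not.2 hlS)
      rw [h₂l, (h.apply_eq_zero hx hlS).2]
    by_cases hai : a = i
    · subst hai
      have hx := hax.resolve_left (not_not.2 hiS)
      rw [h₂i x (fun e => hx (e ▸ hlS)), (h.apply_eq_zero hx hiS).2]
    · rw [h₂other a x hal hai, h₁off a x hax]
  refine ⟨(u₁ * u₂)⁻¹, inv_mem (mul_mem hu₁B hu₂B), (S.erase l).erase i,
    (Finset.erase_subset _ _).trans_ssubset (Finset.erase_ssubset hlS), ?_⟩
  rw [hconj]
  have hsub : ∀ {x}, x ∉ S → x ∉ (S.erase l).erase i := fun hx hx' =>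
    hx (Finset.mem_of_mem_erase (Finset.mem_of_mem_erase hx'))
  have hkeep : ∀ {a c}, a ∉ S → c ∉ S → IsLink N a c → IsLink N₂ a c := fun {a c} ha hc hac =>
    ⟨by rw [h₂off c a (Or.inl hc)]; exact hac.ne_zero,
      fun x hx => by rw [h₂off x a (Or.inr ha)]; exact hac.col_source x hx,
      fun y hy => by rw [h₂off c y (Or.inl hc)]; exact hac.row_target y hy,
      fun y => by rw [h₂off a y (Or.inl ha)]; exact hac.row_source y,
      fun x => by rw [h₂off x c (Or.inr hc)]; exact hac.col_target x⟩
  intro a ha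
  by_cases hai : a = i
  · exact ⟨l, by simp, Or.inr (hai ▸ hlink)⟩
  by_cases hal : a = l
  · exact ⟨i, by simp, Or.inl (hal ▸ hlink)⟩
  have haS : a ∉ S := fun haS => ha (Finset.mem_erase.2 ⟨hai, Finset.mem_erase.2 ⟨hal, haS⟩⟩)
  obtain ⟨c', hc', hcc⟩ := h a haS
  exact ⟨c', hsub hc', hcc.imp (hkeep haS hc') (hkeep hc' haS)⟩

theorem exists_linked {N : Matrix (Fin m) (Fin m) k} (hN : N * N = 0)
    (hY : ∃ Y, N * Y + Y * N = 1) :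
    ∃ b ∈ borel k m, ∀ a, ∃ c, IsLink (b.1 * N * b⁻¹.1) a c ∨ IsLink (b.1 * N * b⁻¹.1) c a := by
  suffices H : ∀ (S : Finset (Fin m)) (N : Matrix (Fin m) (Fin m) k), N * N = 0 →
      (∃ Y, N * Y + Y * N = 1) → IsLinkedOff S N →
        ∃ b ∈ borel k m, IsLinkedOff ∅ (b.1 * N * b⁻¹.1) by
    obtain ⟨b, hb, h⟩ := H Finset.univ N hN hY fun i hi => absurd (Finset.mem_univ i) hi
    exact ⟨b, hb, fun i => (h i (Finset.notMem_empty i)).imp fun j hj => hj.2⟩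
  intro S
  induction S using Finset.strongInduction with | H S ih => ?_
  intro N hN hY h
  rcases S.eq_empty_or_nonempty with rfl | hS
  · exact ⟨1, one_mem _, by simpa using h⟩
  · obtain ⟨b, hb, S', hS', h'⟩ := exists_linkedOff_sdiff hN hY hS h
    obtain ⟨b', hb', h''⟩ := ih S' hS' _ (conj_sq_zero b hN)
      (hY.imp' _ fun Y hY => conj_anticomm b hY) h'
    refine ⟨b' * b, mul_mem hb' hb, ?_⟩
    rw [mul_inv_rev, Units.val_mul, Units.val_mul]
    simpa only [Matrix.mul_assoc] using h''

end SquareZero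

end SpDual

namespace SpDual

/-! ### `GL_{2n} / H` as a conjugacy class of square-zero matrices -/

section DualSide

variable {n : ℕ}

/-- The nilpotent matrix `(0 1; 0 0)`, whose centralizer is `H`. -/
def nilBase (n : ℕ) : Matrix (Fin (2 * n)) (Fin (2 * n)) ℂ := blockH 0 1

theorem nilBase_halves (a b : Fin n ⊕ Fin n) : nilBase n (halves n a) (halves n b) =
    (Matrix.fromBlocks 0 1 0 0 : Matrix (Fin n ⊕ Fin n) (Fin n ⊕ Fin n) ℂ) a b := by
  simp [nilBase, blockH]

/-- The matrix `g (0 1; 0 0) g⁻¹`. -/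
noncomputable def conjN (g : GL (Fin (2 * n)) ℂ) : Matrix (Fin (2 * n)) (Fin (2 * n)) ℂ :=
  g.1 * nilBase n * g⁻¹.1

theorem exists_reindex_fromBlocks (Y : Matrix (Fin (2 * n)) (Fin (2 * n)) ℂ) :
    ∃ p q r s : Matrix (Fin n) (Fin n) ℂ,
      Y = Matrix.reindex (halves n) (halves n) (Matrix.fromBlocks p q r s) := by
  let Z := (Matrix.reindex (halves n) (halves n)).symm Y
  refine ⟨Z.toBlocks₁₁, Z.toBlocks₁₂, Z.toBlocks₂₁, Z.toBlocks₂₂, ?_⟩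
  rw [Matrix.fromBlocks_toBlocks, Equiv.apply_symm_apply]

theorem nilBase_eq (n : ℕ) : nilBase n =
    Matrix.reindex (halves n) (halves n) (Matrix.fromBlocks 0 1 0 0) := rfl

theorem mem_H_iff {g : GL (Fin (2 * n)) ℂ} : g ∈ H n ↔ g.1 * nilBase n = nilBase n * g.1 := by
  constructor
  · rintro ⟨h, a, hg⟩
    rw [hg, nilBase, blockH_mul, blockH_mul]
    simp
  · intro h
    obtain ⟨p, q, r, s, hg⟩ := exists_reindex_fromBlocks g.1
    rw [hg, nilBase_eq] at h
    simp only [Matrix.reindex_apply, Matrix.submatrix_mul_equiv, Matrix.fromBlocks_multiply] at h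
    have h' : Matrix.fromBlocks _ _ _ _ = Matrix.fromBlocks _ _ _ _ :=
      (Matrix.reindex (halves n) (halves n)).injective h
    rw [Matrix.fromBlocks_inj] at h'
    simp only [mul_zero, zero_mul, mul_one, one_mul, add_zero, zero_add] at h'
    obtain ⟨h1, h2, -, -⟩ := h'
    subst h2
    subst h1
    have hdet : p.det ≠ 0 := by
      intro h0
      have : g.1.det = p.det * p.det := by
        rw [hg, Matrix.det_reindex_self, Matrix.det_fromBlocks_zero₂₁]
      rw [h0, mul_zero] at this
      exact (Matrix.isUnits_det_units g).ne_zero this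
    exact ⟨Matrix.GeneralLinearGroup.mkOfDetNeZero p hdet, q, hg⟩

theorem conjN_mul (b g : GL (Fin (2 * n)) ℂ) : conjN (b * g) = b.1 * conjN g * b⁻¹.1 := by
  simp only [conjN, mul_inv_rev, Units.val_mul, Matrix.mul_assoc]

theorem mk_eq_mk_iff_conjN {g g' : GL (Fin (2 * n)) ℂ} :
    (QuotientGroup.mk g : GL (Fin (2 * n)) ℂ ⧸ H n) = QuotientGroup.mk g' ↔
      conjN g = conjN g' := by
  rw [QuotientGroup.eq, mem_H_iff]
  have hg : g⁻¹.1 * g.1 = 1 := g.inv_mul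
  have hg' : g.1 * g⁻¹.1 = 1 := g.mul_inv
  have h1 : g'⁻¹.1 * g'.1 = 1 := g'.inv_mul
  have h1' : g'.1 * g'⁻¹.1 = 1 := g'.mul_inv
  rw [Units.val_mul]
  constructor
  · intro h
    calc conjN g = g.1 * (nilBase n * (g⁻¹.1 * g'.1)) * g'⁻¹.1 := by
          rw [conjN, ← Matrix.mul_assoc (nilBase n), ← Matrix.mul_assoc g.1, Matrix.mul_assoc _ g'.1,
            h1', mul_one, ← Matrix.mul_assoc g.1]
      _ = (g.1 * g⁻¹.1) * g'.1 * nilBase n * g'⁻¹.1 := by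
          rw [← h]; simp only [Matrix.mul_assoc]
      _ = conjN g' := by rw [hg', one_mul, conjN]
  · intro h
    calc g⁻¹.1 * g'.1 * nilBase n = g⁻¹.1 * (g'.1 * nilBase n * g'⁻¹.1) * g'.1 := by
          simp only [Matrix.mul_assoc, h1, mul_one]
      _ = g⁻¹.1 * conjN g * g'.1 := by rw [h, conjN]
      _ = (g⁻¹.1 * g.1) * nilBase n * (g⁻¹.1 * g'.1) := by
          rw [conjN]; simp only [Matrix.mul_assoc]
      _ = _ := by rw [hg, one_mul]

theorem borelOrbit_mk_eq_iff_conjN {g g' : GL (Fin (2 * n)) ℂ} :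
    borelOrbit (H n) (QuotientGroup.mk g) = borelOrbit (H n) (QuotientGroup.mk g') ↔
      ∃ b ∈ borel ℂ (2 * n), conjN g = b.1 * conjN g' * b⁻¹.1 := by
  rw [borelOrbit_eq_iff]
  refine exists_congr fun b => and_congr_right fun _ => ?_
  rw [← conjN_mul]
  exact mk_eq_mk_iff_conjN

theorem submatrix_add_submatrix {ι κ : Type*} (e : κ → ι) (A B : Matrix ι ι ℂ) :
    A.submatrix e e + B.submatrix e e = (A + B).submatrix e e := rfl

theorem trace_fromBlocks {ι κ : Type*} [Fintype ι] [Fintype κ] (A : Matrix ι ι ℂ)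
    (B : Matrix ι κ ℂ) (C : Matrix κ ι ℂ) (D : Matrix κ κ ℂ) :
    (Matrix.fromBlocks A B C D).trace = A.trace + D.trace := by
  simp [Matrix.trace]

theorem nilBase_sq (n : ℕ) : nilBase n * nilBase n = 0 := by
  rw [nilBase, blockH_mul]; simp [blockH]

theorem conjN_sq (g : GL (Fin (2 * n)) ℂ) : conjN g * conjN g = 0 :=
  conj_sq_zero g (nilBase_sq n)

/-! ### Functionals as matrices -/

/-- The matrix `Y` with `φ x = tr (Y x)`. -/
def dualMatrix (φ : Module.Dual ℂ (Matrix (Fin (2 * n)) (Fin (2 * n)) ℂ)) :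
    Matrix (Fin (2 * n)) (Fin (2 * n)) ℂ :=
  Matrix.of fun i j => φ (Matrix.single j i 1)

/-- The functional `x ↦ tr (Y x)`. -/
def traceDual (Y : Matrix (Fin (2 * n)) (Fin (2 * n)) ℂ) :
    Module.Dual ℂ (Matrix (Fin (2 * n)) (Fin (2 * n)) ℂ) :=
  Matrix.traceLinearMap _ ℂ ℂ ∘ₗ LinearMap.mulLeft ℂ Y

theorem traceDual_apply (Y x : Matrix (Fin (2 * n)) (Fin (2 * n)) ℂ) :
    traceDual Y x = (Y * x).trace := rfl

theorem dualMatrix_traceDual (Y : Matrix (Fin (2 * n)) (Fin (2 * n)) ℂ) :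
    dualMatrix (traceDual Y) = Y := by
  ext i j
  simp [dualMatrix, traceDual_apply, Matrix.trace_mul_single]

theorem traceDual_dualMatrix (φ : Module.Dual ℂ (Matrix (Fin (2 * n)) (Fin (2 * n)) ℂ)) :
    traceDual (dualMatrix φ) = φ := by
  refine Matrix.ext_linearMap ℂ fun i j => LinearMap.ext_ring ?_
  simp [dualMatrix, traceDual_apply, Matrix.trace_mul_single]

theorem apply_eq_trace (φ : Module.Dual ℂ (Matrix (Fin (2 * n)) (Fin (2 * n)) ℂ))
    (x : Matrix (Fin (2 * n)) (Fin (2 * n)) ℂ) : φ x = (dualMatrix φ * x).trace := by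
  rw [← traceDual_apply, traceDual_dualMatrix]

theorem apply_conj_eq_trace (φ : Module.Dual ℂ (Matrix (Fin (2 * n)) (Fin (2 * n)) ℂ))
    (g : GL (Fin (2 * n)) ℂ) (x : Matrix (Fin (2 * n)) (Fin (2 * n)) ℂ) :
    φ (g.1 * x * g⁻¹.1) = (g⁻¹.1 * dualMatrix φ * g.1 * x).trace := by
  rw [apply_eq_trace, ← Matrix.mul_assoc, Matrix.trace_mul_comm]
  simp only [Matrix.mul_assoc]

theorem trace_submatrix_equiv {ι κ : Type*} [Fintype ι] [Fintype κ] (e : κ ≃ ι)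
    (A : Matrix ι ι ℂ) : (A.submatrix e e).trace = A.trace :=
  Fintype.sum_equiv e _ _ fun _ => rfl

/-- For `Y` with blocks `p q r s`, the pairing with `𝔥` is `tr ((p + s) x) + tr (r a)` and the
anticommutator has blocks `r, p + s, 0, r`. By nondegeneracy of the trace both conditions read `r =
1`, `p + s = 0`. -/
theorem forall_trace_blockH_iff {Y : Matrix (Fin (2 * n)) (Fin (2 * n)) ℂ} :
    (∀ x a, (Y * blockH x a).trace = a.trace) ↔ nilBase n * Y + Y * nilBase n = 1 := by
  obtain ⟨p, q, r, s, rfl⟩ := exists_reindex_fromBlocks Y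
  have h1 : ∀ x a, (Matrix.reindex (halves n) (halves n) (Matrix.fromBlocks p q r s) *
      blockH x a).trace = ((p + s) * x).trace + (r * a).trace := by
    intro x a
    rw [blockH, Matrix.reindex_apply, Matrix.reindex_apply, Matrix.submatrix_mul_equiv,
      Matrix.fromBlocks_multiply, trace_submatrix_equiv, trace_fromBlocks]
    simp only [mul_zero, add_zero, Matrix.trace_add, add_mul]
    ring
  have h2 : nilBase n * Matrix.reindex (halves n) (halves n) (Matrix.fromBlocks p q r s) +
      Matrix.reindex (halves n) (halves n) (Matrix.fromBlocks p q r s) * nilBase n =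
      Matrix.reindex (halves n) (halves n) (Matrix.fromBlocks r (p + s) 0 r) := by
    rw [nilBase_eq, Matrix.reindex_apply, Matrix.reindex_apply, Matrix.submatrix_mul_equiv,
      Matrix.submatrix_mul_equiv, Matrix.fromBlocks_multiply, Matrix.fromBlocks_multiply]
    rw [submatrix_add_submatrix, Matrix.fromBlocks_add, Matrix.reindex_apply]
    simp [add_comm]
  have h3 : (1 : Matrix (Fin (2 * n)) (Fin (2 * n)) ℂ) =
      Matrix.reindex (halves n) (halves n) (Matrix.fromBlocks 1 0 0 1) := by
    simp [Matrix.fromBlocks_one]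
  rw [h2, h3, (Matrix.reindex (halves n) (halves n)).injective.eq_iff, Matrix.fromBlocks_inj]
  simp only [h1]
  constructor
  · intro h
    have hr : r = 1 := Matrix.ext_iff_trace_mul_right.2 fun a => by simpa using h 0 a
    have hps : p + s = 0 := Matrix.ext_iff_trace_mul_right.2 fun x => by simpa using h x 0
    exact ⟨hr, hps, trivial, hr⟩
  · rintro ⟨hr, hps, -, -⟩ x a
    rw [hr, hps]; simp

theorem restrictsToPsi_iff {g : GL (Fin (2 * n)) ℂ}
    {φ : Module.Dual ℂ (Matrix (Fin (2 * n)) (Fin (2 * n)) ℂ)} :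
    RestrictsToPsi g φ ↔ conjN g * dualMatrix φ + dualMatrix φ * conjN g = 1 := by
  have h1 : RestrictsToPsi g φ ↔ nilBase n * (g⁻¹.1 * dualMatrix φ * g.1) +
      (g⁻¹.1 * dualMatrix φ * g.1) * nilBase n = 1 := by
    rw [← forall_trace_blockH_iff]
    refine forall_congr' fun x => forall_congr' fun a => ?_
    rw [← apply_conj_eq_trace, Matrix.coe_units_inv]
  rw [h1]
  have hg : g.1 * g⁻¹.1 = 1 := g.mul_inv
  have hg' : g⁻¹.1 * g.1 = 1 := g.inv_mul
  constructor
  · intro h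
    have h2 := conj_anticomm g h
    have h3 : g.1 * (g⁻¹.1 * dualMatrix φ * g.1) * g⁻¹.1 = dualMatrix φ := by
      rw [Matrix.mul_assoc, Matrix.mul_assoc _ g.1, hg, mul_one, ← Matrix.mul_assoc, hg, one_mul]
    rwa [h3] at h2
  · intro h
    have h2 := conj_anticomm g⁻¹ h
    have h3 : g⁻¹.1 * conjN g * g⁻¹⁻¹.1 = nilBase n := by
      rw [inv_inv, conjN, Matrix.mul_assoc, Matrix.mul_assoc _ g⁻¹.1, hg', mul_one,
        ← Matrix.mul_assoc, hg', one_mul]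
    rw [h3, inv_inv] at h2
    exact h2

/-- Under the trace form the annihilator of the upper triangular matrices is the space of strictly
upper triangular ones. -/
theorem forall_trace_upper_iff {m : ℕ} {Y : Matrix (Fin m) (Fin m) ℂ} :
    (∀ x : Matrix (Fin m) (Fin m) ℂ, x.BlockTriangular id → (Y * x).trace = 0) ↔
      StrictUpper Y := by
  constructor
  · intro h i j hij
    have := h (Matrix.single j i 1) (by
      intro a c hac
      rw [Matrix.single_apply, if_neg]
      rintro ⟨rfl, rfl⟩
      exact absurd hac (not_lt.2 hij))
    simpa [Matrix.trace_mul_single] using this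
  · intro h x hx
    rw [Matrix.trace, Finset.sum_eq_zero]
    intro i _
    rw [Matrix.diag_apply, Matrix.mul_apply, Finset.sum_eq_zero]
    intro l _
    rcases lt_or_ge i l with hl | hl
    · rw [hx hl, mul_zero]
    · rw [h i l hl, zero_mul]

theorem vanishesOnBorel_iff {g : GL (Fin (2 * n)) ℂ}
    {φ : Module.Dual ℂ (Matrix (Fin (2 * n)) (Fin (2 * n)) ℂ)} :
    VanishesOnBorel g φ ↔ StrictUpper (g⁻¹.1 * dualMatrix φ * g.1) := by
  rw [← forall_trace_upper_iff]
  refine forall_congr' fun x => forall_congr' fun _ => ?_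
  rw [← apply_conj_eq_trace, Matrix.coe_units_inv]

/-- Membership may be tested on any representatives: the first condition involves only `conjN g₁`,
and changing `g₂` within its coset conjugates by an element of `B`, which preserves strict upper
triangularity. -/
theorem mem_Lam_iff {g₁ g₂ : GL (Fin (2 * n)) ℂ}
    {φ : Module.Dual ℂ (Matrix (Fin (2 * n)) (Fin (2 * n)) ℂ)} :
    ((QuotientGroup.mk g₁, QuotientGroup.mk g₂, φ) : Ambient n) ∈ Lam n ↔
      conjN g₁ * dualMatrix φ + dualMatrix φ * conjN g₁ = 1 ∧
        StrictUpper (g₂⁻¹.1 * dualMatrix φ * g₂.1) := by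
  constructor
  · rintro ⟨h₁, h₂, e₁, e₂, hψ, hb⟩
    refine ⟨?_, ?_⟩
    · rw [mk_eq_mk_iff_conjN.1 e₁]
      exact restrictsToPsi_iff.1 hψ
    · have hmem : g₂⁻¹ * h₂ ∈ borel ℂ (2 * n) := QuotientGroup.eq.1 e₂
      have h := (vanishesOnBorel_iff.1 hb).conj hmem
      have he : (g₂⁻¹ * h₂).1 * (h₂⁻¹.1 * dualMatrix φ * h₂.1) * (g₂⁻¹ * h₂)⁻¹.1 =
          g₂⁻¹.1 * dualMatrix φ * g₂.1 := by
        have e1 : h₂.1 * h₂⁻¹.1 = 1 := h₂.mul_inv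
        rw [mul_inv_rev, inv_inv, Units.val_mul, Units.val_mul]
        calc _ = g₂⁻¹.1 * (h₂.1 * h₂⁻¹.1) * dualMatrix φ * (h₂.1 * h₂⁻¹.1) * g₂.1 := by
              simp only [Matrix.mul_assoc]
          _ = _ := by rw [e1, mul_one, mul_one]
      rwa [he] at h
  · rintro ⟨h1, h2⟩
    exact ⟨g₁, g₂, rfl, rfl, restrictsToPsi_iff.2 h1, vanishesOnBorel_iff.2 h2⟩

theorem isRelevant_iff {g : GL (Fin (2 * n)) ℂ} :
    IsRelevant (flagOrbit (H n) (QuotientGroup.mk g, QuotientGroup.mk 1)) ↔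
      ∃ Y, StrictUpper Y ∧ conjN g * Y + Y * conjN g = 1 := by
  constructor
  · rintro ⟨⟨⟨y, f, φ⟩, hp⟩, he⟩
    obtain ⟨γ, hγ⟩ := Quotient.exact' he
    have h1 : γ • (QuotientGroup.mk g : GL (Fin (2 * n)) ℂ ⧸ H n) = y := congrArg Prod.fst hγ
    have h2 : γ • (QuotientGroup.mk 1 : GL (Fin (2 * n)) ℂ ⧸ borel ℂ (2 * n)) = f :=
      congrArg Prod.snd hγ
    rw [MulAction.Quotient.smul_mk] at h1 h2
    subst h1 h2
    rw [smul_eq_mul, smul_eq_mul, mul_one] at hp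
    obtain ⟨h3, h4⟩ := mem_Lam_iff.1 hp
    refine ⟨_, h4, ?_⟩
    have h5 := conj_anticomm γ⁻¹ h3
    rw [inv_inv, conjN_mul] at h5
    have h6 : γ⁻¹.1 * (γ.1 * conjN g * γ⁻¹.1) * γ.1 = conjN g := by
      have e : γ⁻¹.1 * γ.1 = 1 := γ.inv_mul
      calc _ = (γ⁻¹.1 * γ.1) * conjN g * (γ⁻¹.1 * γ.1) := by simp only [Matrix.mul_assoc]
        _ = _ := by rw [e, one_mul, mul_one]
    rwa [h6] at h5
  · rintro ⟨Y, hY, h⟩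
    refine ⟨⟨(QuotientGroup.mk g, QuotientGroup.mk 1, traceDual Y), mem_Lam_iff.2 ⟨?_, ?_⟩⟩, rfl⟩
    · rwa [dualMatrix_traceDual]
    · rw [dualMatrix_traceDual]; simpa using hY

end DualSide

end SpDual

namespace SpDual

/-! ### Borel orbits on `GL_{2n} / H` -/

section NilShape

variable {k : Type*} [Field k] {n : ℕ}

/-- The square-zero matrix that maps the smaller element of each pair to the larger one. -/
def nilMat (R : Type*) [Zero R] [One R] {n : ℕ} (π : FreeInv n) :
    Matrix (Fin (2 * n)) (Fin (2 * n)) R :=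
  Matrix.of fun j x => if π.1 x = j ∧ x < j then 1 else 0

theorem nilMat_apply (R : Type*) [Zero R] [One R] (π : FreeInv n) (j x : Fin (2 * n)) :
    nilMat R π j x = if π.1 x = j ∧ x < j then 1 else 0 := rfl

/-- The nonzero entries of `N` are at the positions of those of `nilMat k π`. -/
def HasNilShape (N : Matrix (Fin (2 * n)) (Fin (2 * n)) k) (π : FreeInv n) : Prop :=
  ∀ j x, N j x ≠ 0 ↔ π.1 x = j ∧ x < j

theorem hasNilShape_nilMat (π : FreeInv n) : HasNilShape (nilMat k π) π := fun j x => by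
  rw [nilMat_apply]; split_ifs with h <;> simp [h]

theorem HasNilShape.isPartialMonomial {N : Matrix (Fin (2 * n)) (Fin (2 * n)) k} {π : FreeInv n}
    (h : HasNilShape N π) : IsPartialMonomial N := by
  constructor
  · intro i j j' h1 h2
    exact π.1.injective (((h _ _).1 h1).1.trans ((h _ _).1 h2).1.symm)
  · intro i i' j h1 h2
    rw [← ((h _ _).1 h1).1, ← ((h _ _).1 h2).1]

theorem HasNilShape.exists_diag {N : Matrix (Fin (2 * n)) (Fin (2 * n)) k} {π : FreeInv n}
    (h : HasNilShape N π) : ∃ t ∈ borel k (2 * n), t.1 * N * t⁻¹.1 = nilMat k π := by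
  let d : Fin (2 * n) → k := fun i => if π.1 i < i then (N i (π.1 i))⁻¹ else 1
  have hd : ∀ i, d i ≠ 0 := fun i => by
    simp only [d]
    split_ifs with hi
    · exact inv_ne_zero ((h _ _).2 ⟨π.apply_apply i, hi⟩)
    · exact one_ne_zero
  refine ⟨diagGL d hd, diagGL_mem_borel d hd, ?_⟩
  ext i j
  have h1 : ((diagGL d hd).1 * N * (diagGL d hd)⁻¹.1) i j = d i * N i j * (d j)⁻¹ := by
    change (Matrix.diagonal d * N * Matrix.diagonal fun i => (d i)⁻¹) i j = _
    simp
  rw [h1, nilMat_apply]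
  by_cases hij : π.1 j = i ∧ j < i
  · obtain ⟨rfl, hj⟩ := hij
    have hN : N (π.1 j) j ≠ 0 := (h _ _).2 ⟨rfl, hj⟩
    simp only [d, π.apply_apply]
    rw [if_pos hj, if_neg hj.asymm, if_pos ⟨trivial, hj⟩, inv_mul_cancel₀ hN]; simp
  · rw [if_neg hij, not_not.1 ((h i j).not.2 hij)]; simp

end NilShape

/-! ### Normal forms, separation of orbits and relevance on the dual side -/

section DualOrbits

variable {n : ℕ}

/-- The inverse in `conjN g` is replaced by the adjugate; the resulting factor `det g` is harmless
for vanishing of minors. -/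
theorem exists_poly_minor_conjN (T : Finset (Fin (2 * n) × Fin (2 * n))) :
    ∃ p : MvPolynomial (Fin (2 * n) × Fin (2 * n)) ℂ, ∀ g : GL (Fin (2 * n)) ℂ,
      MvPolynomial.eval (fun ij => g ij.1 ij.2) p =
        ((g.1.det • conjN g).submatrix (fun t : T => t.1.1) (fun t : T => t.1.2)).det := by
  let G : Matrix (Fin (2 * n)) (Fin (2 * n)) (MvPolynomial (Fin (2 * n) × Fin (2 * n)) ℂ) :=
    Matrix.of fun i j => MvPolynomial.X (i, j)
  refine ⟨((G * (nilBase n).map MvPolynomial.C * G.adjugate).submatrix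
    (fun t : T => t.1.1) (fun t : T => t.1.2)).det, fun g => ?_⟩
  set ev := MvPolynomial.eval (fun ij : Fin (2 * n) × Fin (2 * n) => g ij.1 ij.2) with hev
  have hG : ev.mapMatrix G = g.1 := by
    ext i j; simp [G, hev]
  have hN : ev.mapMatrix ((nilBase n).map MvPolynomial.C) = nilBase n := by
    ext i j; simp [hev]
  have hadj : g.1.det • conjN g = g.1 * nilBase n * g.1.adjugate := by
    have : g.1.adjugate = g.1.det • g⁻¹.1 := by
      have h1 : g.1.adjugate = g.1.adjugate * (g.1 * g⁻¹.1) := by rw [g.mul_inv, mul_one]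
      rw [h1, ← Matrix.mul_assoc, Matrix.adjugate_mul]; simp
    rw [this, conjN, Matrix.mul_smul]
  rw [RingHom.map_det, hadj, ← hG, ← RingHom.map_adjugate, ← hN, ← map_mul, ← map_mul, hN]
  rfl

theorem card_corner_le_of_closure_conjN {g g' : GL (Fin (2 * n)) ℂ}
    (hg : IsPartialMonomial (conjN g))
    (h : (borelOrbit (H n) (QuotientGroup.mk g)).orbit ⊆
      closure[zariskiQuot (H n)] (borelOrbit (H n) (QuotientGroup.mk g')).orbit)
    {R C : Finset (Fin (2 * n))} (hR : ∀ i ∈ R, ∀ x, i ≤ x → x ∈ R)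
    (hC : ∀ j ∈ C, ∀ y, y ≤ j → y ∈ C) :
    (entries (conjN g) ∩ R ×ˢ C).card ≤ (entries (conjN g') ∩ R ×ˢ C).card := by
  refine card_corner_le hg fun T hT => ?_
  obtain ⟨p, hp⟩ := exists_poly_minor_conjN (n := n) T
  have hmem : QuotientGroup.mk g ∈ (borelOrbit (H n) (QuotientGroup.mk g)).orbit :=
    mem_orbit_borelOrbit.2 ⟨1, one_mem _, (one_smul _ _).symm⟩
  have := eval_eq_zero_of_subset_closure h p (fun γ hγ => ?_) hmem
  · rw [hp, Matrix.submatrix_smul, Pi.smul_apply, Pi.smul_apply, Matrix.det_smul] at this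
    exact (mul_eq_zero.1 this).resolve_left (pow_ne_zero _ (Matrix.isUnits_det_units g).ne_zero)
  · obtain ⟨b, hb, hgb⟩ := mem_orbit_borelOrbit.1 hγ
    have h1 : conjN γ = conjN (b * g') := mk_eq_mk_iff_conjN.1 hgb
    rw [hp, h1, conjN_mul, ← Matrix.smul_mul, ← Matrix.smul_mul]
    refine hT _ _ (fun i hi x hx => ?_) fun j hj y hy => ?_
    · rw [Matrix.smul_apply, mem_borel_iff.1 hb i x (not_le.1 fun hle => hx (hR i hi x hle)),
        smul_zero]
    · exact mem_borel_iff.1 (inv_mem hb) y j (not_le.1 fun hle => hy (hC j hj y hle))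

theorem entries_conjN_eq_of_closure {g g' : GL (Fin (2 * n)) ℂ}
    (hg : IsPartialMonomial (conjN g)) (hg' : IsPartialMonomial (conjN g'))
    (h : (borelOrbit (H n) (QuotientGroup.mk g)).orbit ⊆
      closure[zariskiQuot (H n)] (borelOrbit (H n) (QuotientGroup.mk g')).orbit)
    (h' : (borelOrbit (H n) (QuotientGroup.mk g')).orbit ⊆
      closure[zariskiQuot (H n)] (borelOrbit (H n) (QuotientGroup.mk g)).orbit) :
    entries (conjN g) = entries (conjN g') :=
  eq_of_card_corner_eq true fun _ _ hR hC => le_antisymm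
    (card_corner_le_of_closure_conjN hg h hR (by simpa using hC))
    (card_corner_le_of_closure_conjN hg' h' hR (by simpa using hC))

theorem conjN_permGL {π : FreeInv n} {σ : Equiv.Perm (Fin (2 * n))}
    (hσ : ∀ i : Fin n, σ (halves n (Sum.inr i)) < σ (halves n (Sum.inl i)) ∧
      π.1 (σ (halves n (Sum.inl i))) = σ (halves n (Sum.inr i))) :
    conjN (permGL ℂ σ) = nilMat ℂ π := by
  ext i j
  obtain ⟨a, rfl⟩ := σ.surjective i
  obtain ⟨b, rfl⟩ := σ.surjective j
  obtain ⟨a, rfl⟩ := (halves n).surjective a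
  obtain ⟨b, rfl⟩ := (halves n).surjective b
  rw [conjN, permGL_inv, mul_permGL_apply, permGL_mul_apply, Equiv.Perm.inv_def,
    Equiv.symm_apply_apply, Equiv.symm_apply_apply, nilBase_halves, nilMat_apply]
  have h2 : ∀ i, π.1 (σ (halves n (Sum.inr i))) = σ (halves n (Sum.inl i)) := fun i => by
    rw [← (hσ i).2, π.apply_apply]
  rcases a with a | a <;> rcases b with b | b
  · simp [(hσ _).2]
  · simp only [h2, Matrix.fromBlocks_apply₁₂, Matrix.one_apply]
    by_cases hab : a = b
    · subst hab; simp [(hσ a).1]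
    · rw [if_neg hab, if_neg]
      rintro ⟨h, -⟩
      exact hab (by simpa using h.symm)
  · simp only [(hσ _).2, Matrix.fromBlocks_apply₂₁, Matrix.zero_apply]
    rw [if_neg]
    rintro ⟨h, h'⟩
    rw [← h] at h'
    exact h'.asymm (hσ b).1
  · simp [h2]

theorem exists_conjN_eq_nilMat (π : FreeInv n) : ∃ g : GL (Fin (2 * n)) ℂ, conjN g = nilMat ℂ π := by
  obtain ⟨σ, hσ⟩ := π.exists_perm
  exact ⟨permGL ℂ σ, conjN_permGL hσ⟩

/-- A point of `GL_{2n} / H` over the square-zero matrix of `π`. -/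
noncomputable def reprH {n : ℕ} (π : FreeInv n) : GL (Fin (2 * n)) ℂ :=
  (exists_conjN_eq_nilMat π).choose

theorem conjN_reprH (π : FreeInv n) : conjN (reprH π) = nilMat ℂ π :=
  (exists_conjN_eq_nilMat π).choose_spec

/-- The Borel orbit of the square-zero matrix of `π`. -/
noncomputable def orbH {n : ℕ} (π : FreeInv n) : BorelOrbits (H n) :=
  borelOrbit (H n) (QuotientGroup.mk (reprH π))

theorem borelOrbit_eq_orbH {g : GL (Fin (2 * n)) ℂ} {π : FreeInv n}
    (h : HasNilShape (conjN g) π) : borelOrbit (H n) (QuotientGroup.mk g) = orbH π := by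
  obtain ⟨t, ht, h'⟩ := h.exists_diag
  refine (borelOrbit_mk_eq_iff_conjN.2 ⟨t, ht, ?_⟩).symm
  rw [conjN_reprH, h']

theorem hasNilShape_conjN_reprH (π : FreeInv n) : HasNilShape (conjN (reprH π)) π := by
  rw [conjN_reprH]; exact hasNilShape_nilMat π

theorem eq_of_entries_nilMat {π π' : FreeInv n}
    (he : entries (nilMat ℂ π) = entries (nilMat ℂ π')) : π = π' := by
  have key : ∀ x, π.IsSource x → π'.1 x = π.1 x := fun x hx => by
    have h1 : (π.1 x, x) ∈ entries (nilMat ℂ π) :=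
      mem_entries.2 ((hasNilShape_nilMat π _ _).2 ⟨rfl, hx⟩)
    rw [he, mem_entries] at h1
    exact ((hasNilShape_nilMat π' _ _).1 h1).1
  refine FreeInv.ext' fun x => ?_
  by_cases hx : π.IsSource x
  · exact (key x hx).symm
  · have h1 := key (π.1 x) (π.isSource_apply_iff.2 hx)
    rw [π.apply_apply] at h1
    rw [← π'.apply_eq_iff.1 h1]

theorem orbH_closure_antisymm {π π' : FreeInv n}
    (h : (orbH π).orbit ⊆ closure[zariskiQuot (H n)] (orbH π').orbit)
    (h' : (orbH π').orbit ⊆ closure[zariskiQuot (H n)] (orbH π).orbit) : π = π' := by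
  have he := entries_conjN_eq_of_closure (hasNilShape_conjN_reprH π).isPartialMonomial
    (hasNilShape_conjN_reprH π').isPartialMonomial h h'
  rw [conjN_reprH, conjN_reprH] at he
  exact eq_of_entries_nilMat he

theorem orbH_injective : Function.Injective (orbH : FreeInv n → BorelOrbits (H n)) := by
  intro π π' h
  have hc : (orbH π).orbit ⊆ closure[zariskiQuot (H n)] (orbH π).orbit := by
    let _ := zariskiQuot (H n)
    exact subset_closure
  refine orbH_closure_antisymm ?_ ?_
  · rw [← h]; exact hc
  · rw [← h]; exact hc

/-- On the plane of each pair, `nilMat` and its transpose are the two off-diagonal matrix units,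
whose anticommutator is the identity. So the transpose is an explicit solution `Y`, and it is
strictly upper triangular. -/
theorem nilMat_anticomm (R : Type*) [CommRing R] (π : FreeInv n) :
    nilMat R π * (nilMat R π)ᵀ + (nilMat R π)ᵀ * nilMat R π = 1 := by
  ext i j
  rw [Matrix.add_apply, Matrix.mul_apply, Matrix.mul_apply]
  simp only [Matrix.transpose_apply, nilMat_apply]
  rw [Finset.sum_eq_single (π.1 i), Finset.sum_eq_single (π.1 i)]
  · simp only [π.apply_apply, Matrix.one_apply]
    by_cases hij : i = j
    · subst hij
      rcases π.lt_or_lt i with h | h <;> simp [h, h.asymm]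
    · simp [hij, Ne.symm hij]
  · intro l _ hl; rw [if_neg (fun e => hl e.1.symm), zero_mul]
  · simp
  · intro l _ hl; rw [if_neg (fun e => hl (π.apply_eq_iff.1 e.1)), zero_mul]
  · simp

theorem strictUpper_nilMat_transpose (R : Type*) [CommRing R] (π : FreeInv n) :
    StrictUpper (nilMat R π)ᵀ := fun i j hij => by
  rw [Matrix.transpose_apply, nilMat_apply, if_neg]
  exact fun h => absurd h.2 (not_lt.2 hij)

theorem flagEquiv_borelOrbit (g : GL (Fin (2 * n)) ℂ) :
    flagEquiv (borelOrbit (H n) (QuotientGroup.mk g)) =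
      flagOrbit (H n) (QuotientGroup.mk g, QuotientGroup.mk 1) := rfl

theorem isRelevant_orbH (π : FreeInv n) : IsRelevant (flagEquiv (orbH π)) := by
  rw [orbH, flagEquiv_borelOrbit, isRelevant_iff, conjN_reprH]
  exact ⟨_, strictUpper_nilMat_transpose ℂ π, nilMat_anticomm ℂ π⟩

/-- After elimination `N` is a sum of links. Relevance fixes the direction of each link, and the
links define `π`. -/
theorem exists_eq_orbH {O : BorelOrbits (H n)} (hO : IsRelevant (flagEquiv O)) :
    ∃ π, O = orbH π := by
  obtain ⟨g, rfl⟩ := exists_borelOrbit_eq O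
  rw [flagEquiv_borelOrbit, isRelevant_iff] at hO
  obtain ⟨Y, hY, hNY⟩ := hO
  obtain ⟨b, hb, h⟩ := exists_linked (conjN_sq g) ⟨Y, hNY⟩
  have hY' := hY.conj hb
  have hNY' := conj_anticomm b hNY
  set Y' := b.1 * Y * b⁻¹.1
  rw [← conjN_mul] at h hNY'
  set N := conjN (b * g) with hN
  -- The `(l, l)` entry of `N Y' + Y' N` is `Y' l i * N i l`. It equals `1`, so `Y' l i ≠ 0` and the
  -- strictly upper triangular `Y'` forces `l < i`.
  have hlt : ∀ l i, IsLink N l i → l < i := by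
    intro l i hl
    by_contra hle
    have h1 : (N * Y' + Y' * N) l l = 0 := by
      rw [Matrix.add_apply, Matrix.mul_apply, Matrix.mul_apply, Finset.sum_eq_zero,
        Finset.sum_eq_zero, add_zero]
      · intro x _
        by_cases hx : x = i
        · rw [hx, hY' l i (not_lt.1 hle), zero_mul]
        · rw [hl.col_source x hx, mul_zero]
      · intro x _; rw [hl.row_source, zero_mul]
    rw [hNY', Matrix.one_apply_eq] at h1
    exact one_ne_zero h1
  choose f hf using h
  have huniq : ∀ a c, IsLink N a c ∨ IsLink N c a → f a = c := by
    intro a c hac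
    rcases hf a with h1 | h1 <;> rcases hac with h2 | h2
    · by_contra hne
      exact h2.ne_zero (h1.col_source c (Ne.symm hne))
    · exact absurd (h2.col_target (f a)) h1.ne_zero
    · exact absurd (h1.col_target c) h2.ne_zero
    · by_contra hne
      exact h1.ne_zero (h2.row_target (f a) hne)
  have hinv : ∀ a, f (f a) = a := fun a => huniq _ _ (hf a).symm
  have hfree : ∀ a, f a ≠ a := fun a ha => by
    have := hf a
    rw [ha, or_self] at this
    exact absurd (this.row_source a) this.ne_zero
  let π : FreeInv n := ⟨⟨f, f, hinv, hinv⟩, hinv, hfree⟩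
  refine ⟨π, ?_⟩
  rw [← borelOrbit_eq_orbH (g := b * g) (π := π)]
  · exact (borelOrbit_smul hb (QuotientGroup.mk g)).symm
  · intro j x
    rw [← hN]
    change N j x ≠ 0 ↔ f x = j ∧ x < j
    constructor
    · intro hjx
      rcases hf x with h1 | h1
      · have : f x = j := by
          by_contra hne
          exact hjx (h1.col_source j (Ne.symm hne))
        exact ⟨this, this ▸ hlt _ _ h1⟩
      · exact absurd (h1.col_target j) hjx
    · rintro ⟨rfl, hx⟩
      rcases hf x with h1 | h1
      · exact h1.ne_zero
      · exact absurd (hlt _ _ h1) hx.asymm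

end DualOrbits

end SpDual

namespace SpDual

/-! ### Simple reflections on the Borel orbits of `GL_{2n} / H` -/

section DualKnop

variable {n : ℕ}

/-- The hypothesis on `N b a` removes the term quadratic in `y`. -/
theorem elemGL_conj_apply {k : Type*} [Field k] {m : ℕ} {N : Matrix (Fin m) (Fin m) k}
    {a b : Fin m} (h : a ≠ b) (y : k) (hN : N b a = 0) (i j : Fin m) :
    ((elemGL h y).1 * N * (elemGL h y)⁻¹.1) i j =
      N i j + (if a = i then y * N b j else 0) - if b = j then y * N i a else 0 := by
  have h1 : ∀ (M : Matrix (Fin m) (Fin m) k) i j, ((elemGL h y).1 * M) i j =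
      M i j + if a = i then y * M b j else 0 := by
    intro M i j
    rw [coe_elemGL, add_mul, one_mul, Matrix.add_apply]
    congr 1
    split_ifs with hi
    · subst hi; simp
    · rw [Matrix.single_mul_apply_of_ne]; exact fun e => hi e.symm
  rw [elemGL_inv, mul_elemGL_apply, h1, h1]
  by_cases hi : a = i
  · subst hi
    by_cases hj : b = j
    · subst hj
      simp [hN]
      ring
    · simp [hj]
  · by_cases hj : b = j <;> simp [hi, hj, sub_eq_add_neg, mul_comm y]

section Entries

variable {R : Type*} [Zero R] [One R] {π : FreeInv n} {a : Fin (2 * n)}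

theorem nilMat_row_source (ha : a < π.1 a) (x : Fin (2 * n)) : nilMat R π a x = 0 := by
  rw [nilMat_apply, if_neg]
  rintro ⟨rfl, h'⟩
  rw [π.apply_apply] at ha
  exact ha.asymm h'

theorem nilMat_col_source (ha : a < π.1 a) (x : Fin (2 * n)) :
    nilMat R π x a = if π.1 a = x then 1 else 0 := by
  rw [nilMat_apply]
  by_cases h : π.1 a = x
  · subst h; simp [ha]
  · simp [h]

theorem nilMat_row_sink (ha : π.1 a < a) (x : Fin (2 * n)) :
    nilMat R π a x = if π.1 a = x then 1 else 0 := by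
  rw [nilMat_apply]
  by_cases h : π.1 a = x
  · subst h; simp [ha, π.apply_apply]
  · rw [if_neg h, if_neg]
    exact fun e => h (π.apply_eq_iff.1 e.1).symm

theorem nilMat_col_sink (ha : π.1 a < a) (x : Fin (2 * n)) : nilMat R π x a = 0 := by
  rw [nilMat_apply, if_neg]
  rintro ⟨rfl, h'⟩
  exact ha.asymm h'

end Entries

/-- If `i` is the smaller element of its pair and `i + 1` the larger one of its own, the lower
unipotent element commutes with `nilMat`. If both are smaller, or both larger, conjugation by it
changes one entry, and the root element at `(π (i + 1), π i)` with parameter `-x` makes the same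
change. It is upper triangular because `π (i + 1) < π i`, the inequality opposite to that on `X`. -/
theorem isOpenType_reprH {i : Fin (2 * n - 1)} {π : FreeInv n} (h : π.1 (hi i) < π.1 (lo i)) :
    IsOpenType i (QuotientGroup.mk (reprH π) : GL (Fin (2 * n)) ℂ ⧸ H n) := by
  intro x
  set N := nilMat ℂ π with hN
  suffices H : ∃ b ∈ borel ℂ (2 * n), (lowGL i x).1 * N * (lowGL i x)⁻¹.1 = b.1 * N * b⁻¹.1 by
    obtain ⟨b, hb, hbA⟩ := H
    refine ⟨b, hb, mk_eq_mk_iff_conjN.2 ?_⟩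
    change conjN (lowGL i x * reprH π) = conjN (b * reprH π)
    rw [conjN_mul, conjN_mul, conjN_reprH, hbA]
  have hlow : N (lo i) (hi i) = 0 := by
    rw [hN, nilMat_apply, if_neg]
    exact fun e => e.2.asymm (lo_lt_hi i)
  rcases π.lt_or_lt (lo i) with hlo | hlo
  · rcases π.lt_or_lt (hi i) with hhi | hhi
    · refine ⟨elemGL h.ne (-x), elemGL_mem_borel h _, ?_⟩
      have hm : π.1 (lo i) ≠ hi i := by
        intro e
        rw [← e, π.apply_apply, e] at hhi
        exact hhi.asymm (lo_lt_hi i)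
      have h1 : π.1 (π.1 (lo i)) < π.1 (lo i) := by rwa [π.apply_apply]
      have h2 : π.1 (π.1 (hi i)) < π.1 (hi i) := by rwa [π.apply_apply]
      have hab : N (π.1 (lo i)) (π.1 (hi i)) = 0 := nilMat_col_sink h2 _
      ext p q
      rw [lowGL, elemGL_conj_apply _ _ hlow, elemGL_conj_apply _ _ hab, hN,
        nilMat_row_source hlo, nilMat_col_source hhi, nilMat_row_sink h1, nilMat_col_sink h2,
        π.apply_apply]
      by_cases hp : π.1 (hi i) = p <;> by_cases hq : lo i = q <;> simp [hp, hq]; ring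
    · refine ⟨1, one_mem _, ?_⟩
      ext p q
      rw [lowGL, elemGL_conj_apply _ _ hlow, hN, nilMat_row_source hlo, nilMat_col_sink hhi]
      simp
  -- The inequality `π (i + 1) < π i < i` leaves no case with `i` larger and `i + 1` smaller in
  -- their pairs.
  · have hhi : π.1 (hi i) < hi i := h.trans (hlo.trans (lo_lt_hi i))
    refine ⟨elemGL h.ne (-x), elemGL_mem_borel h _, ?_⟩
    have h1 : π.1 (lo i) < π.1 (π.1 (lo i)) := by rwa [π.apply_apply]
    have h2 : π.1 (hi i) < π.1 (π.1 (hi i)) := by rwa [π.apply_apply]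
    have hab : N (π.1 (lo i)) (π.1 (hi i)) = 0 := nilMat_row_source h1 _
    ext p q
    rw [lowGL, elemGL_conj_apply _ _ hlow, elemGL_conj_apply _ _ hab, hN,
      nilMat_row_sink hlo, nilMat_col_sink hhi, nilMat_row_source h1, nilMat_col_source h2,
      π.apply_apply]
    by_cases hp : hi i = p <;> by_cases hq : π.1 (lo i) = q <;> simp [hp, hq]

theorem conjN_refl_apply (i : Fin (2 * n - 1)) (g : GL (Fin (2 * n)) ℂ) (a b : Fin (2 * n)) :
    conjN (reflGL ℂ i * g) a b = conjN g (simpleRefl i a) (simpleRefl i b) := by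
  rw [conjN_mul, reflGL, permGL_inv, mul_permGL_apply, permGL_mul_apply, simpleRefl_inv]

theorem simpleRefl_lt_iff {m : ℕ} {i : Fin (m - 1)} {a b : Fin m}
    (h : ¬ (a = lo i ∧ b = hi i)) (h' : ¬ (a = hi i ∧ b = lo i)) :
    simpleRefl i a < simpleRefl i b ↔ a < b := by
  have hlo := Fin.val_mk (show (i : ℕ) < m by omega)
  have key : ∀ x : Fin m, (simpleRefl i x : ℕ) =
      if (x : ℕ) = i then (i : ℕ) + 1 else if (x : ℕ) = i + 1 then (i : ℕ) else x := by
    intro x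
    rw [simpleRefl_eq, Equiv.swap_apply_def]
    simp only [Fin.ext_iff, lo, hi]
    split_ifs <;> simp_all
  simp only [Fin.lt_def, key]
  simp only [Fin.ext_iff, lo, hi] at h h'
  split_ifs <;> omega

/-- A simple reflection preserves the order of every two indices except `i` and `i + 1`, so unless
these are partners each smaller element still maps to the larger one. -/
theorem hasNilShape_conjN_refl {i : Fin (2 * n - 1)} {π : FreeInv n} {g : GL (Fin (2 * n)) ℂ}
    (h : HasNilShape (conjN g) π) (hm : π.1 (lo i) ≠ hi i) :
    HasNilShape (conjN (reflGL ℂ i * g)) (simpleRefl i • π) := by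
  intro j x
  rw [conjN_refl_apply, h, FreeInv.refl_smul_apply]
  have h1 : π.1 (simpleRefl i x) = simpleRefl i j ↔ simpleRefl i (π.1 (simpleRefl i x)) = j := by
    nth_rw 2 [← simpleRefl_inv]
    rw [Equiv.Perm.eq_inv_iff_eq]
  rw [h1]
  refine and_congr_right fun e => ?_
  rw [← h1] at e
  refine simpleRefl_lt_iff ?_ ?_
  · rintro ⟨rfl, rfl⟩
    rw [simpleRefl_lo, simpleRefl_hi] at e
    exact hm (π.apply_eq_iff.1 e).symm
  · rintro ⟨rfl, rfl⟩
    rw [simpleRefl_lo, simpleRefl_hi] at e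
    exact hm e

theorem borelOrbit_refl_smul_reprH {i : Fin (2 * n - 1)} {π : FreeInv n}
    (hm : π.1 (lo i) ≠ hi i) :
    borelOrbit (H n) (reflGL ℂ i • QuotientGroup.mk (reprH π)) = orbH (simpleRefl i • π) :=
  borelOrbit_eq_orbH (hasNilShape_conjN_refl (hasNilShape_conjN_reprH π) hm)

theorem comm_of_smul_eq {p g : GL (Fin (2 * n)) ℂ}
    (h : p • (QuotientGroup.mk g : GL (Fin (2 * n)) ℂ ⧸ H n) = QuotientGroup.mk g) :
    p.1 * conjN g = conjN g * p.1 := by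
  have h1 : conjN (p * g) = conjN g := mk_eq_mk_iff_conjN.1 h
  have hp : p⁻¹.1 * p.1 = 1 := p.inv_mul
  rw [conjN_mul] at h1
  nth_rw 2 [← h1]
  rw [Matrix.mul_assoc _ _ p.1, hp, mul_one]

/-- The stabilizer commutes with `nilMat`. Comparing one entry of the two products equates `p (i +
1) i` either with `0` or with the entry of `p` at `(π (i + 1), π i)`. The latter is below the
diagonal and, as `π (i + 1) ≠ i + 1`, not the free entry of `P_s`. -/
theorem fixedType_orbH {i : Fin (2 * n - 1)} {π : FreeInv n}
    (hm : π.1 (lo i) ≠ hi i) (h : π.1 (lo i) < π.1 (hi i)) : FixedType i (orbH π) := by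
  refine fixedType_borelOrbit fun p hp hpz => mem_borel_of_mem_minParabolic hp ?_
  have hc := comm_of_smul_eq hpz
  rw [conjN_reprH] at hc
  have h0 : p (π.1 (hi i)) (π.1 (lo i)) = 0 :=
    mem_minParabolic_iff.1 hp _ _ h fun e => π.apply_ne _ e.1
  rcases π.lt_or_lt (lo i) with hlo | hlo
  · have hhi : hi i < π.1 (hi i) := by
      have h1 := hi_lt_of_lo_lt hlo hm
      exact h1.trans h
    have h2 : π.1 (π.1 (hi i)) < π.1 (hi i) := by rwa [π.apply_apply]
    have h1 := congrFun (congrFun hc (π.1 (hi i))) (lo i)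
    rw [Matrix.mul_apply, Matrix.mul_apply] at h1
    simp only [nilMat_col_source hlo, nilMat_row_sink h2, π.apply_apply] at h1
    simpa [h0] using h1.symm
  · have h1 := congrFun (congrFun hc (hi i)) (π.1 (lo i))
    have h2 : π.1 (lo i) < π.1 (π.1 (lo i)) := by rwa [π.apply_apply]
    rw [Matrix.mul_apply, Matrix.mul_apply] at h1
    rcases π.lt_or_lt (hi i) with hhi | hhi
    · simp only [nilMat_col_source h2, nilMat_row_source hhi, π.apply_apply] at h1
      simpa using h1
    · simp only [nilMat_col_source h2, nilMat_row_sink hhi, π.apply_apply] at h1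
      simpa [h0] using h1

theorem knopRefl_orbH_of_unmatched {i : Fin (2 * n - 1)} {π : FreeInv n}
    (hm : π.1 (lo i) ≠ hi i) : knopRefl i (orbH π) = orbH (simpleRefl i • π) := by
  have key : ∀ π : FreeInv n, π.1 (lo i) ≠ hi i → π.1 (hi i) < π.1 (lo i) →
      knopRefl i (orbH π) = orbH (simpleRefl i • π) ∧
        knopRefl i (orbH (simpleRefl i • π)) = orbH π := by
    intro π hm hlt
    have h := (isOpenType_reprH hlt).knopRefl_pair
    rw [borelOrbit_refl_smul_reprH hm] at h
    refine h (fun e => FreeInv.refl_smul_ne hm (orbH_injective e)) (fixedType_orbH ?_ ?_)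
    · exact FreeInv.refl_smul_unmatched hm
    · rwa [FreeInv.refl_smul_lo hm, FreeInv.refl_smul_hi hm]
  rcases lt_or_gt_of_ne (fun e => lo_ne_hi i (π.1.injective e)) with hlt | hlt
  · have := (key (simpleRefl i • π) (FreeInv.refl_smul_unmatched hm) (by
      rwa [FreeInv.refl_smul_lo hm, FreeInv.refl_smul_hi hm])).2
    rwa [FreeInv.refl_smul_refl_smul] at this
  · exact (key π hm hlt).1

theorem orbH_subset_closure_iff {i : Fin (2 * n - 1)} {π : FreeInv n}
    (hm : π.1 (lo i) ≠ hi i) :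
    (orbH π).orbit ⊆ closure[zariskiQuot (H n)] (orbH (simpleRefl i • π)).orbit ↔
      π.1 (lo i) < π.1 (hi i) := by
  have key : ∀ π : FreeInv n, π.1 (lo i) ≠ hi i → π.1 (hi i) < π.1 (lo i) →
      (orbH (simpleRefl i • π)).orbit ⊆ closure[zariskiQuot (H n)] (orbH π).orbit := by
    intro π hm hlt
    rw [← borelOrbit_refl_smul_reprH hm]
    exact (isOpenType_reprH hlt).subset_closure
  constructor
  · intro h
    by_contra hlt
    have hlt' := lt_of_le_of_ne (not_lt.1 hlt) fun e => lo_ne_hi i (π.1.injective e).symm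
    exact FreeInv.refl_smul_ne hm (orbH_closure_antisymm (key π hm hlt') h)
  · intro hlt
    have := key (simpleRefl i • π) (FreeInv.refl_smul_unmatched hm) (by
      rwa [FreeInv.refl_smul_lo hm, FreeInv.refl_smul_hi hm])
    rwa [FreeInv.refl_smul_refl_smul] at this

/-! The matched case: the reflection reverses the pair `{i, i+1}`. -/

section Matched

variable {i : Fin (2 * n - 1)} {π : FreeInv n}

theorem conjN_refl_row_hi (hm : π.1 (lo i) = hi i) (x : Fin (2 * n)) :
    conjN (reflGL ℂ i * reprH π) (hi i) x = 0 := by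
  rw [conjN_refl_apply, conjN_reprH, simpleRefl_hi]
  exact nilMat_row_source (by rw [hm]; exact lo_lt_hi i) _

theorem conjN_refl_col_hi (hm : π.1 (lo i) = hi i) (x : Fin (2 * n)) :
    conjN (reflGL ℂ i * reprH π) x (hi i) = if lo i = x then 1 else 0 := by
  rw [conjN_refl_apply, conjN_reprH, simpleRefl_hi,
    nilMat_col_source (by rw [hm]; exact lo_lt_hi i), hm]
  have h : hi i = simpleRefl i x ↔ lo i = x := by
    rw [← (simpleRefl i).injective.eq_iff (a := lo i), simpleRefl_lo]
  simp only [h]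

/-- The reflected matrix sends `e_{i+1}` to `e_i`, against the order. The `(i + 1, i + 1)` entry of
`N Y + Y N` is then the entry of `Y` at `(i + 1, i)`, which is `0` instead of `1`. -/
theorem not_isRelevant_refl (hm : π.1 (lo i) = hi i) :
    ¬ IsRelevant (flagEquiv (borelOrbit (H n) (reflGL ℂ i • QuotientGroup.mk (reprH π)))) := by
  intro hr
  obtain ⟨Y, hY, hNY⟩ := isRelevant_iff.1 hr
  have h1 : (conjN (reflGL ℂ i * reprH π) * Y + Y * conjN (reflGL ℂ i * reprH π))
      (hi i) (hi i) = 0 := by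
    rw [Matrix.add_apply, Matrix.mul_apply, Matrix.mul_apply]
    simp [conjN_refl_row_hi hm, conjN_refl_col_hi hm, hY _ _ (lo_lt_hi i).le]
  have h2 : (1 : Matrix (Fin (2 * n)) (Fin (2 * n)) ℂ) (hi i) (hi i) = 0 := by
    rw [← hNY]; exact h1
  rw [Matrix.one_apply_eq] at h2
  exact one_ne_zero h2

theorem fixedType_refl_of_matched (hm : π.1 (lo i) = hi i) :
    FixedType i (borelOrbit (H n) (reflGL ℂ i • QuotientGroup.mk (reprH π))) := by
  refine fixedType_borelOrbit fun p hp hpz => mem_borel_of_mem_minParabolic hp ?_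
  have hc : p.1 * conjN (reflGL ℂ i * reprH π) = conjN (reflGL ℂ i * reprH π) * p.1 :=
    comm_of_smul_eq hpz
  have h1 := congrFun (congrFun hc (hi i)) (hi i)
  rw [Matrix.mul_apply, Matrix.mul_apply] at h1
  simpa [conjN_refl_row_hi hm, conjN_refl_col_hi hm] using h1

theorem isOpenType_of_matched (hm : π.1 (lo i) = hi i) :
    IsOpenType i (QuotientGroup.mk (reprH π) : GL (Fin (2 * n)) ℂ ⧸ H n) :=
  isOpenType_reprH (by rw [hm, ← hm, π.apply_apply, hm]; exact lo_lt_hi i)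

theorem knopRefl_orbH_of_matched (hm : π.1 (lo i) = hi i) :
    knopRefl i (orbH π) = borelOrbit (H n) (reflGL ℂ i • QuotientGroup.mk (reprH π)) :=
  ((isOpenType_of_matched hm).knopRefl_pair (fun e => not_isRelevant_refl hm (by
    rw [e]; exact isRelevant_orbH π)) (fixedType_refl_of_matched hm)).1

/-- The relevant orbit is the open one, so its closure contains the reflected orbit. The opposite
inclusion would give both monomial matrices the same nonzero positions. -/
theorem not_subset_closure_of_matched (hm : π.1 (lo i) = hi i) :
    ¬ (orbH π).orbit ⊆ closure[zariskiQuot (H n)] (knopRefl i (orbH π)).orbit := by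
  rw [knopRefl_orbH_of_matched hm]
  intro h
  have h' := (isOpenType_of_matched hm).subset_closure
  have hpm := (hasNilShape_conjN_reprH π).isPartialMonomial
  have he := entries_conjN_eq_of_closure (g := reprH π) (g' := reflGL ℂ i * reprH π) hpm
    ⟨fun a b b' h1 h2 => (simpleRefl i).injective (hpm.1 (simpleRefl i a) _ _
        (by rwa [conjN_refl_apply] at h1) (by rwa [conjN_refl_apply] at h2)),
      fun a a' b h1 h2 => (simpleRefl i).injective (hpm.2 _ _ (simpleRefl i b)
        (by rwa [conjN_refl_apply] at h1) (by rwa [conjN_refl_apply] at h2))⟩ h h'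
  have h1 : (hi i, lo i) ∈ entries (conjN (reprH π)) :=
    mem_entries.2 ((hasNilShape_conjN_reprH π _ _).2 ⟨hm, lo_lt_hi i⟩)
  rw [he, mem_entries] at h1
  exact h1 (conjN_refl_row_hi hm _)

end Matched

end DualKnop

end SpDual

namespace SpDual

/-! ### Labels, the correspondence of orbits and the weak order -/

section Correspondence

variable {n : ℕ} {k : Type*} [Field k]

theorem labelX_iff {O : BorelOrbits (Sp k n)} {P : Matching n} :
    LabelX O P ↔ O = orbX k P.toInv := by
  constructor
  · rintro ⟨g, hg, rfl⟩
    refine borelOrbit_eq_orbX ?_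
    rw [show gram g = mono k P.toInv from hg.trans (monomial_eq_mono P)]
    exact hasShape_mono _
  · rintro rfl
    exact ⟨reprX k P.toInv, (gram_reprX _).trans (monomial_eq_mono P).symm, rfl⟩

theorem labelR_iff {O : RelevantOrbits n} {P : Matching n} :
    LabelR O P ↔ O.1 = flagEquiv (orbH P.toInv) := by
  constructor
  · rintro ⟨σ, w, h1, h2, h3, h4⟩
    have hw : w = permGL ℂ σ := by
      ext i j
      rw [h3, permGL_apply]
    have hN : conjN w = nilMat ℂ P.toInv := by
      rw [hw]
      exact conjN_permGL fun i => ⟨h1 i, P.mem_parts_iff.1 (h2 i)⟩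
    rw [h4, ← flagEquiv_borelOrbit, borelOrbit_eq_orbH (π := P.toInv)]
    rw [hN]
    exact hasNilShape_nilMat _
  · intro h
    obtain ⟨σ, hσ⟩ := P.toInv.exists_perm
    refine ⟨σ, permGL ℂ σ, fun i => (hσ i).1, fun i => P.mem_parts_iff.2 (hσ i).2,
      fun i j => permGL_apply _ _ _, ?_⟩
    rw [h, ← flagEquiv_borelOrbit, borelOrbit_eq_orbH (π := P.toInv)]
    rw [conjN_permGL hσ]
    exact hasNilShape_nilMat _

/-- The Borel orbits on `X` are indexed by the fixed-point-free involutions. -/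
noncomputable def orbitEquivX (k : Type*) [Field k] [Infinite k] (n : ℕ) :
    FreeInv n ≃ BorelOrbits (Sp k n) :=
  Equiv.ofBijective (orbX k) ⟨orbX_injective, fun O => (exists_eq_orbX O).imp fun _ h => h.symm⟩

theorem RelevantOrbits.val_inj {O O' : RelevantOrbits n} : O.1 = O'.1 ↔ O = O' :=
  ⟨Subtype.ext, fun h => h ▸ rfl⟩

/-- The relevant orbits are indexed by the fixed-point-free involutions. -/
noncomputable def orbitEquivR (n : ℕ) : FreeInv n ≃ RelevantOrbits n :=
  Equiv.ofBijective (fun π => ⟨flagEquiv (orbH π), isRelevant_orbH π⟩)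
    ⟨fun π π' h => orbH_injective (flagEquiv.injective (congrArg Subtype.val h)), fun O => by
      obtain ⟨π, hπ⟩ := exists_eq_orbH (O := flagEquiv.symm O.1) (by
        rw [Equiv.apply_symm_apply]; exact O.2)
      exact ⟨π, RelevantOrbits.val_inj.1 (flagEquiv.eq_symm_apply.1 hπ.symm)⟩⟩

theorem orbitEquivX_apply [Infinite k] (π : FreeInv n) : orbitEquivX k n π = orbX k π := rfl

theorem orbitEquivR_apply (π : FreeInv n) : (orbitEquivR n π).1 = flagEquiv (orbH π) := rfl

theorem flagEquiv_symm_orbitEquivR (π : FreeInv n) :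
    flagEquiv.symm (orbitEquivR n π).1 = orbH π := flagEquiv.symm_apply_apply _

theorem labelX_orbitEquivX [Infinite k] {π : FreeInv n} {P : Matching n} :
    LabelX (orbitEquivX k n π) P ↔ matchingEquiv n P = π := by
  rw [labelX_iff, ← orbitEquivX_apply, (orbitEquivX k n).injective.eq_iff, eq_comm]
  rfl

theorem labelR_orbitEquivR {π : FreeInv n} {P : Matching n} :
    LabelR (orbitEquivR n π) P ↔ matchingEquiv n P = π := by
  rw [labelR_iff, ← orbitEquivR_apply, RelevantOrbits.val_inj, (orbitEquivR n).injective.eq_iff,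
    eq_comm]
  rfl

/-- For partners `i` and `i + 1` the reflected orbit is irrelevant, and the convention `s * O = O`
agrees with the fact that conjugation by `s` fixes `π`. -/
theorem starRefl_orbitEquivR (i : Fin (2 * n - 1)) (π : FreeInv n) :
    starRefl i (orbitEquivR n π) = orbitEquivR n (simpleRefl i • π) := by
  by_cases hm : π.1 (lo i) = hi i
  · rw [FreeInv.refl_smul_of_matched hm]
    refine dif_neg ?_
    rw [flagEquiv_symm_orbitEquivR, knopRefl_orbH_of_matched hm]
    exact not_isRelevant_refl hm
  · have h : flagEquiv (knopRefl i (flagEquiv.symm (orbitEquivR n π).1)) =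
        (orbitEquivR n (simpleRefl i • π)).1 := by
      rw [flagEquiv_symm_orbitEquivR, knopRefl_orbH_of_unmatched hm, orbitEquivR_apply]
    refine (dif_pos ?_).trans (RelevantOrbits.val_inj.1 h)
    rw [h]
    exact (orbitEquivR n (simpleRefl i • π)).2

/-- A step upwards in the weak order of the Borel orbits on `X`. -/
def FreeInv.Step (π π' : FreeInv n) : Prop :=
  ∃ i : Fin (2 * n - 1), π.1 (lo i) ≠ hi i ∧ π' = simpleRefl i • π ∧ π.1 (hi i) < π.1 (lo i)

theorem FreeInv.step_iff {π π' : FreeInv n} :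
    π'.Step π ↔ ∃ i : Fin (2 * n - 1),
      π.1 (lo i) ≠ hi i ∧ π' = simpleRefl i • π ∧ π.1 (lo i) < π.1 (hi i) := by
  constructor
  · rintro ⟨i, hm, rfl, h⟩
    exact ⟨i, refl_smul_unmatched hm, (refl_smul_refl_smul i π').symm, by
      rwa [refl_smul_lo hm, refl_smul_hi hm]⟩
  · rintro ⟨i, hm, rfl, h⟩
    exact ⟨i, refl_smul_unmatched hm, (refl_smul_refl_smul i π).symm, by
      rwa [refl_smul_lo hm, refl_smul_hi hm]⟩

/-- Reflections in partners fix the orbit and drop out of a chain; for the others the closure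
condition is the inequality in `FreeInv.Step`. -/
theorem weakLE_orbX_iff [Infinite k] {π π' : FreeInv n} :
    WeakLE (orbX k π) (orbX k π') ↔ Relation.ReflTransGen FreeInv.Step π π' := by
  constructor
  · intro h
    suffices H : ∀ O, WeakLE (orbX k π) O → ∃ π'', O = orbX k π'' ∧
        Relation.ReflTransGen FreeInv.Step π π'' by
      obtain ⟨π'', h1, h2⟩ := H _ h
      rwa [orbX_injective h1]
    intro O hO
    induction hO with
    | refl => exact ⟨π, rfl, .refl⟩
    | tail _ hstep ih =>
      obtain ⟨ρ, rfl, hρ⟩ := ih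
      obtain ⟨i, rfl, hc⟩ := hstep
      rw [knopRefl_orbX] at hc ⊢
      refine ⟨_, rfl, ?_⟩
      by_cases hm : ρ.1 (lo i) = hi i
      · rwa [FreeInv.refl_smul_of_matched hm]
      · exact hρ.tail ⟨i, hm, rfl, (orbX_subset_closure_iff hm).1 hc⟩
  · intro h
    induction h with
    | refl => exact .refl
    | tail _ hstep ih =>
      obtain ⟨i, hm, rfl, hlt⟩ := hstep
      exact ih.tail ⟨i, (knopRefl_orbX i _).symm, (orbX_subset_closure_iff hm).2 hlt⟩

/-- `WeakLE` allows irrelevant intermediate orbits, but an upward chain from a relevant orbit never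
meets one: only a reflection in partners leaves the relevant orbits, and that step fails the closure
condition. -/
theorem weakLE_orbH_iff {π π' : FreeInv n} :
    WeakLE (orbH π) (orbH π') ↔ Relation.ReflTransGen FreeInv.Step π' π := by
  rw [← Relation.reflTransGen_swap]
  constructor
  · intro h
    suffices H : ∀ O, WeakLE (orbH π) O → ∃ π'', O = orbH π'' ∧
        Relation.ReflTransGen (Function.swap FreeInv.Step) π π'' by
      obtain ⟨π'', h1, h2⟩ := H _ h
      rwa [orbH_injective h1]
    intro O hO
    induction hO with
    | refl => exact ⟨π, rfl, .refl⟩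
    | tail _ hstep ih =>
      obtain ⟨ρ, rfl, hρ⟩ := ih
      obtain ⟨i, rfl, hc⟩ := hstep
      by_cases hm : ρ.1 (lo i) = hi i
      · exact (not_subset_closure_of_matched hm hc).elim
      · rw [knopRefl_orbH_of_unmatched hm] at hc ⊢
        exact ⟨_, rfl, hρ.tail (FreeInv.step_iff.2
          ⟨i, hm, rfl, (orbH_subset_closure_iff hm).1 hc⟩)⟩
  · intro h
    induction h with
    | refl => exact .refl
    | tail _ hstep ih =>
      obtain ⟨i, hm, rfl, hlt⟩ := FreeInv.step_iff.1 hstep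
      exact ih.tail ⟨i, (knopRefl_orbH_of_unmatched hm).symm, (orbH_subset_closure_iff hm).2 hlt⟩

/-- The action of the symmetric group on a set of orbits indexed by the involutions. -/
noncomputable def transportAction {α : Type*} (e : FreeInv n ≃ α) :
    Equiv.Perm (Fin (2 * n)) →* Equiv.Perm α :=
  e.permCongrHom.toMonoidHom.comp (MulAction.toPermHom _ _)

theorem transportAction_apply {α : Type*} (e : FreeInv n ≃ α) (w : Equiv.Perm (Fin (2 * n)))
    (π : FreeInv n) : transportAction e w (e π) = e (w • π) := by
  simp [transportAction]

end Correspondence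

theorem existsUnique_eq_apply {α β : Type*} (e : α ≃ β) {r : α → Prop} {b : β}
    (h : ∀ a, r a ↔ e a = b) : ∃! a, r a := by
  simp only [h]
  exact e.bijective.existsUnique b

end SpDual

namespace SpDual

/-! ### Upper triangular matrices that commute or anticommute with `nilMat` -/

section Centralizer

variable {n : ℕ} {F : Type*} [Field F] (π : FreeInv n)

theorem mul_nilMat_apply {R : Type*} [CommRing R] (A : Matrix (Fin (2 * n)) (Fin (2 * n)) R)
    (i j : Fin (2 * n)) :
    (A * nilMat R π) i j = if j < π.1 j then A i (π.1 j) else 0 := by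
  rw [Matrix.mul_apply]
  rcases π.lt_or_lt j with h | h
  · simp only [nilMat_col_source h]
    simp [h]
  · simp only [nilMat_col_sink h]
    simp [h.asymm]

theorem nilMat_mul_apply {R : Type*} [CommRing R] (A : Matrix (Fin (2 * n)) (Fin (2 * n)) R)
    (i j : Fin (2 * n)) :
    (nilMat R π * A) i j = if i < π.1 i then 0 else A (π.1 i) j := by
  rw [Matrix.mul_apply]
  rcases π.lt_or_lt i with h | h
  · simp only [nilMat_row_source h]
    simp [h]
  · simp only [nilMat_row_sink h]
    simp [h.asymm]

/-- The positions of the entries that parametrize the upper triangular matrices in the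
centralizer of `nilMat`. -/
def FreeInv.CentPos (i j : Fin (2 * n)) : Prop :=
  j < π.1 j ∧ i ≤ j ∧ (i < π.1 i → π.1 i ≤ π.1 j)

instance (i j : Fin (2 * n)) : Decidable (π.CentPos i j) := by
  unfold FreeInv.CentPos; infer_instance

variable {π} in
theorem FreeInv.centPos_apply {i j : Fin (2 * n)} (hi : π.1 i < i) (hj : π.1 j < j) :
    π.CentPos (π.1 i) (π.1 j) ↔ π.1 i ≤ π.1 j ∧ i ≤ j := by
  simp only [CentPos, π.apply_apply, hi, hj, true_and, true_implies]

/-- The upper triangular matrix `a` with `a * nilMat = e * nilMat * a` and the given entries at the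
positions `CentPos`. -/
def centMat {R : Type*} [CommRing R] (e : R) (y : Fin (2 * n) → Fin (2 * n) → R) :
    Matrix (Fin (2 * n)) (Fin (2 * n)) R :=
  Matrix.of fun i j =>
    if j < π.1 j then (if π.CentPos i j then y i j else 0)
    else if π.1 i < i ∧ π.CentPos (π.1 i) (π.1 j) then e * y (π.1 i) (π.1 j) else 0

variable {π}

theorem centMat_apply_of_centPos {R : Type*} [CommRing R] {e : R}
    {y : Fin (2 * n) → Fin (2 * n) → R} {i j : Fin (2 * n)} (h : π.CentPos i j) :
    centMat π e y i j = y i j := by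
  simp [centMat, h.1, h]

theorem centMat_upper {R : Type*} [CommRing R] (e : R) (y : Fin (2 * n) → Fin (2 * n) → R) :
    (centMat π e y).BlockTriangular id := by
  intro i j (hij : j < i)
  simp only [centMat, Matrix.of_apply]
  split_ifs with h1 h2 h2
  · exact absurd h2.2.1 (not_le.2 hij)
  · rfl
  · have h1' : π.1 j < j := (π.lt_or_lt j).resolve_left h1
    exact absurd ((FreeInv.centPos_apply h2.1 h1').1 h2.2).2 (not_le.2 hij)
  · rfl

theorem centMat_strictUpper {R : Type*} [Field R] {e : R} {y : Fin (2 * n) → Fin (2 * n) → R}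
    (hy : ∀ i, y i i = 0) : StrictUpper (centMat π e y) := by
  intro i j hij
  rcases hij.lt_or_eq with h | rfl
  · exact centMat_upper e y h
  · simp [centMat, hy]

theorem centMat_mul_nilMat {R : Type*} [CommRing R] (e : R) (y : Fin (2 * n) → Fin (2 * n) → R) :
    centMat π e y * nilMat R π = e • (nilMat R π * centMat π e y) := by
  ext i j
  rw [mul_nilMat_apply, Matrix.smul_apply, nilMat_mul_apply]
  simp only [centMat, Matrix.of_apply, π.apply_apply]
  rcases π.lt_or_lt i with hi | hi <;> rcases π.lt_or_lt j with hj | hj <;>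
    simp [hi, hj, hi.asymm, hj.asymm]

theorem apply_partner_of_comm {e : F} {a : Matrix (Fin (2 * n)) (Fin (2 * n)) F}
    (hN : a * nilMat F π = e • (nilMat F π * a)) {i j : Fin (2 * n)} (hj : j < π.1 j) :
    a i (π.1 j) = if i < π.1 i then 0 else e * a (π.1 i) j := by
  have := congrFun (congrFun hN i) j
  rw [mul_nilMat_apply, Matrix.smul_apply, nilMat_mul_apply, if_pos hj] at this
  rw [this]
  split_ifs <;> simp

/-- If `i` and `j` are the smaller elements of their pairs, the entry at `(i, j)` equals, up to the
factor `e`, the one at `(π i, π j)`. It vanishes when `π i > π j`, which explains the last condition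
in `FreeInv.CentPos`. -/
theorem apply_eq_zero_of_comm {e : F} {a : Matrix (Fin (2 * n)) (Fin (2 * n)) F}
    (hN : a * nilMat F π = e • (nilMat F π * a)) (he : e ≠ 0) (ha : a.BlockTriangular id) {i j : Fin (2 * n)}
    (hj : j < π.1 j) (h : ¬ π.CentPos i j) : a i j = 0 := by
  by_cases hij : j < i
  · exact ha hij
  · simp only [FreeInv.CentPos, hj, not_lt.1 hij, true_and, Classical.not_imp, not_le] at h
    have h1 := apply_partner_of_comm hN (i := π.1 i) hj
    rw [π.apply_apply, if_neg h.1.asymm, ha h.2] at h1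
    exact (mul_eq_zero.1 h1.symm).resolve_left he

theorem eq_centMat_of_comm {e : F} {a : Matrix (Fin (2 * n)) (Fin (2 * n)) F}
    (hN : a * nilMat F π = e • (nilMat F π * a)) (he : e ≠ 0) (ha : a.BlockTriangular id) :
    a = centMat π e a := by
  ext i j
  simp only [centMat, Matrix.of_apply]
  split_ifs with h1 h2 h2
  · rfl
  · exact apply_eq_zero_of_comm hN he ha h1 h2
  all_goals
    have hj : π.1 j < j := (π.lt_or_lt j).resolve_left h1
    have h3 := apply_partner_of_comm hN (i := i) (j := π.1 j) (by rwa [π.apply_apply])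
    rw [π.apply_apply] at h3
    rw [h3]
  · rw [if_neg h2.1.asymm]
  · split_ifs with h4
    · rfl
    · have hi : π.1 i < i := (π.lt_or_lt i).resolve_left h4
      rw [apply_eq_zero_of_comm hN he ha (by rwa [π.apply_apply]) fun h => h2 ⟨hi, h⟩, mul_zero]

/-- An upper triangular matrix `a` that commutes with `nilMat` is determined by the entries of `c * a`
at the positions `CentPos`. -/
theorem eq_zero_of_centPos {c a : Matrix (Fin (2 * n)) (Fin (2 * n)) F}
    (hc : c.BlockTriangular id) (hcd : ∀ i, c i i ≠ 0) (ha : a.BlockTriangular id)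
    (hN : a * nilMat F π = nilMat F π * a)
    (h : ∀ i j, π.CentPos i j → (c * a) i j = 0) : a = 0 := by
  have hN' : a * nilMat F π = (1 : F) • (nilMat F π * a) := by rw [one_smul, hN]
  have key : ∀ j, j < π.1 j → ∀ i, a i j = 0 := by
    intro j hj i
    induction i using WellFoundedGT.induction with
    | ind i ih =>
      by_cases hS : π.CentPos i j
      · have h1 := h i j hS
        rw [Matrix.mul_apply, Finset.sum_eq_single i] at h1
        · exact (mul_eq_zero.1 h1).resolve_left (hcd i)
        · intro l _ hl
          rcases lt_or_gt_of_ne hl with hl | hl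
          · rw [hc hl, zero_mul]
          · rw [ih l hl, mul_zero]
        · simp
      · exact apply_eq_zero_of_comm hN' one_ne_zero ha hj hS
  ext i j
  rcases π.lt_or_lt j with hj | hj
  · exact key j hj i
  · have h1 := apply_partner_of_comm hN' (i := i) (j := π.1 j) (by rwa [π.apply_apply])
    rw [π.apply_apply] at h1
    rw [h1, key _ (by rwa [π.apply_apply])]
    simp

theorem upper_mul_apply_self {R : Type*} [CommRing R] {m : ℕ} {b a : Matrix (Fin m) (Fin m) R}
    (hb : b.BlockTriangular id) (ha : a.BlockTriangular id) (i : Fin m) :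
    (b * a) i i = b i i * a i i := by
  rw [Matrix.mul_apply, Finset.sum_eq_single i]
  · intro l _ hl
    rcases lt_or_gt_of_ne hl with hl | hl
    · rw [hb hl, zero_mul]
    · rw [ha hl, mul_zero]
  · simp

/-- The values at the positions `CentPos` extended by zero. -/
def extendCent (π : FreeInv n) (y : {p : Fin (2 * n) × Fin (2 * n) // π.CentPos p.1 p.2} → F)
    (i j : Fin (2 * n)) : F :=
  if h : π.CentPos i j then y ⟨(i, j), h⟩ else 0

/-- A normal form for `b` modulo the centralizer of `nilMat`. Sending the free entries of a
centralizing matrix `a` to the entries of `b a` at the same positions is an injective endomorphism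
of a finite-dimensional space (`eq_zero_of_centPos`), hence surjective, so these entries of `b a`
can be made those of the identity. -/
theorem exists_mul_cent_eq_one (π : FreeInv n) {b : Matrix (Fin (2 * n)) (Fin (2 * n)) F}
    (hb : b.BlockTriangular id) (hbd : ∀ i, b i i ≠ 0) :
    ∃ a : Matrix (Fin (2 * n)) (Fin (2 * n)) F, a.BlockTriangular id ∧ (∀ i, a i i ≠ 0) ∧
      a * nilMat F π = nilMat F π * a ∧
      ∀ i j, π.CentPos i j → (b * a) i j = (1 : Matrix (Fin (2 * n)) (Fin (2 * n)) F) i j := by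
  let T : ({p : Fin (2 * n) × Fin (2 * n) // π.CentPos p.1 p.2} → F) →ₗ[F]
      ({p : Fin (2 * n) × Fin (2 * n) // π.CentPos p.1 p.2} → F) :=
    { toFun := fun y p => (b * centMat π 1 (extendCent π y)) p.1.1 p.1.2
      map_add' := fun y z => by
        have : centMat π 1 (extendCent π (y + z)) =
            centMat π 1 (extendCent π y) + centMat π 1 (extendCent π z) := by
          ext i j
          simp only [centMat, extendCent, Matrix.of_apply, Matrix.add_apply]
          split_ifs <;> simp
        ext p
        rw [this, mul_add]
        rfl
      map_smul' := fun r y => by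
        have : centMat π 1 (extendCent π (r • y)) = r • centMat π 1 (extendCent π y) := by
          ext i j
          simp only [centMat, extendCent, Matrix.of_apply, Matrix.smul_apply]
          split_ifs <;> simp
        ext p
        rw [this, Matrix.mul_smul]
        rfl }
  have hcomm : ∀ y, centMat π 1 (extendCent π y) * nilMat F π =
      nilMat F π * centMat π 1 (extendCent π y) := fun y => by
    rw [centMat_mul_nilMat, one_smul]
  have hinj : Function.Injective T := by
    rw [← LinearMap.ker_eq_bot, LinearMap.ker_eq_bot']
    intro y hy
    have h0 := eq_zero_of_centPos hb hbd (centMat_upper 1 (extendCent π y)) (hcomm y)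
      fun i j hij => congrFun hy ⟨(i, j), hij⟩
    ext ⟨⟨i, j⟩, hij⟩
    have h1 := congrFun (congrFun h0 i) j
    rw [centMat_apply_of_centPos hij, extendCent, dif_pos hij] at h1
    exact h1
  obtain ⟨y, hy⟩ := LinearMap.injective_iff_surjective.1 hinj
    fun p => (1 : Matrix (Fin (2 * n)) (Fin (2 * n)) F) p.1.1 p.1.2
  set a := centMat π 1 (extendCent π y) with ha
  have hau : a.BlockTriangular id := centMat_upper _ _
  have hS : ∀ i j, π.CentPos i j → (b * a) i j = (1 : Matrix _ _ F) i j :=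
    fun i j hij => congrFun hy ⟨(i, j), hij⟩
  -- Diagonal positions at smaller elements belong to `CentPos`, so there `b i i * a i i = 1`; the
  -- commutation relation carries this over to the partners.
  have hsrc : ∀ i, i < π.1 i → a i i ≠ 0 := fun i hi h0 => by
    have := hS i i ⟨hi, le_rfl, fun _ => le_rfl⟩
    rw [upper_mul_apply_self hb hau, h0, mul_zero, Matrix.one_apply_eq] at this
    exact zero_ne_one this
  refine ⟨a, hau, fun i => ?_, hcomm y, hS⟩
  rcases π.lt_or_lt i with hi | hi
  · exact hsrc i hi
  · have h1 := apply_partner_of_comm (a := a) (e := 1) (π := π) (by rw [hcomm y, one_smul])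
      (i := i) (j := π.1 i) (by rwa [π.apply_apply])
    rw [π.apply_apply, if_neg hi.asymm, one_mul] at h1
    rw [h1]
    exact hsrc _ (by rwa [π.apply_apply])

end Centralizer

end SpDual

namespace SpDual

/-! ### Kernels of evaluations with the same transcendence degree -/

theorem exists_of_mem_adjoin_range {k A ι : Type*} [CommRing k] [CommRing A] [Algebra k A]
    {u : ι → A} {a : A} (h : a ∈ Algebra.adjoin k (Set.range u)) :
    ∃ p : MvPolynomial ι k, MvPolynomial.aeval u p = a := by
  rwa [Algebra.adjoin_range_eq_range_aeval] at h

universe u in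
-- An inclusion of primes with quotients of the same finite transcendence degree is an equality. A
-- transcendence basis of `K₁` taken among the images of the variables stays independent in `K₂`, so
-- it is a basis there by degree. If `α₂ f ≠ 0`, then `α₂ f` satisfies an algebraic equation over
-- this basis with nonzero constant coefficient.
theorem ker_eq_of_trdeg_le {k K₁ K₂ : Type u} [Field k] [Field K₁] [Field K₂] [Algebra k K₁]
    [Algebra k K₂] {τ : Type*} {α₁ : MvPolynomial τ k →ₐ[k] K₁} {α₂ : MvPolynomial τ k →ₐ[k] K₂}
    (halg : Algebra.IsAlgebraic
      (Algebra.adjoin k (Set.range fun s => α₁ (MvPolynomial.X s))) K₁)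
    (hfin : Algebra.trdeg k K₁ < Cardinal.aleph0) (htr : Algebra.trdeg k K₂ ≤ Algebra.trdeg k K₁)
    (hker : ∀ f, α₂ f = 0 → α₁ f = 0) {f : MvPolynomial τ k} (hf : α₁ f = 0) : α₂ f = 0 := by
  obtain ⟨t, hts, ht⟩ := exists_isTranscendenceBasis_subset (R := k)
    (Set.range fun s => α₁ (MvPolynomial.X s))
  choose σ hσ using fun x : t => hts x.2
  let v : t → K₂ := fun x => α₂ (MvPolynomial.X (σ x))
  have h1 : ∀ p, MvPolynomial.aeval (Subtype.val : t → K₁) p = α₁ (MvPolynomial.rename σ p) := by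
    intro p
    rw [← AlgHom.comp_apply]
    congr 1
    ext x
    simp [hσ]
  have h2 : ∀ p, MvPolynomial.aeval v p = α₂ (MvPolynomial.rename σ p) := by
    intro p
    rw [← AlgHom.comp_apply]
    congr 1
    ext x
    simp [v]
  have hzero : ∀ p, α₁ (MvPolynomial.rename σ p) = 0 → p = 0 := fun p hp =>
    algebraicIndependent_iff.1 ht.1 p (by rw [h1, hp])
  have hv : AlgebraicIndependent k v := algebraicIndependent_iff.2 fun p hp =>
    hzero p (hker _ (by rw [← h2, hp]))
  have hcard := ht.cardinalMk_eq_trdeg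
  have hvb : IsTranscendenceBasis k v :=
    hv.isTranscendenceBasis_of_trdeg_le (htr.trans_lt hfin) (by rwa [hcard])
  by_contra hne
  have halg₂ := hvb.isAlgebraic
  obtain ⟨q, hq0, hq⟩ := (halg₂.isAlgebraic (α₂ f)).exists_nonzero_coeff_and_aeval_eq_zero
    (mem_nonZeroDivisors_of_ne_zero hne)
  choose p hp using fun i => exists_of_mem_adjoin_range (q.coeff i).2
  have h3 : α₂ (∑ i ∈ Finset.range (q.natDegree + 1), MvPolynomial.rename σ (p i) * f ^ i) = 0 := by
    rw [← hq, Polynomial.aeval_eq_sum_range, map_sum]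
    refine Finset.sum_congr rfl fun i _ => ?_
    rw [map_mul, map_pow, ← h2, hp, Algebra.smul_def]
    rfl
  -- Transported to `K₁`, where `f` maps to `0`, the equation leaves only its constant coefficient,
  -- which must then vanish.
  have h4 := hker _ h3
  rw [map_sum, Finset.sum_range_succ', Finset.sum_eq_zero, zero_add, pow_zero, mul_one] at h4
  · apply hq0
    rw [← Subtype.coe_inj, ← hp, hzero _ h4, map_zero]
    rfl
  · intro i _
    rw [map_mul, map_pow, hf, zero_pow (Nat.succ_ne_zero i), mul_zero]

theorem trdeg_fractionRing_mvPolynomial (k ι : Type) [Field k] :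
    Algebra.trdeg k (FractionRing (MvPolynomial ι k)) = Cardinal.mk ι := by
  have : Algebra.IsAlgebraic (MvPolynomial ι k) (FractionRing (MvPolynomial ι k)) :=
    IsLocalization.isAlgebraic _ (nonZeroDivisors (MvPolynomial ι k))
  have h := (IsTranscendenceBasis.mvPolynomial ι k).algebraMap_comp
    (A := FractionRing (MvPolynomial ι k))
  exact h.cardinalMk_eq_trdeg.symm

/-! ### Irreducible components -/

theorem irreducibleComponents_eq_range {X ι : Type*} [TopologicalSpace X] [Finite ι]
    {Z : ι → Set X} (hirr : ∀ i, IsIrreducible (Z i)) (hcl : ∀ i, IsClosed (Z i))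
    (hcov : ⋃ i, Z i = Set.univ) (hanti : ∀ i j, Z i ⊆ Z j → i = j) :
    irreducibleComponents X = Set.range Z := by
  have hsub : ∀ T : Set X, IsIrreducible T → ∃ i, T ⊆ Z i := by
    intro T hT
    have h1 := isIrreducible_iff_sUnion_isClosed.1 hT (Set.finite_range Z).toFinset
      (by simpa using hcl) (by simp [hcov])
    simpa using h1
  ext T
  constructor
  · intro hT
    obtain ⟨i, hi⟩ := hsub T hT.1
    exact ⟨i, (hT.2 (hirr i) hi).antisymm hi⟩
  · rintro ⟨i, rfl⟩
    refine ⟨hirr i, fun T hT hiT => ?_⟩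
    obtain ⟨j, hj⟩ := hsub T hT
    obtain rfl := hanti i j (hiT.trans hj)
    exact hj

end SpDual

namespace SpDual

/-! ### The slice of `Λ` over a Borel orbit, and its generic point -/

section Slice

variable {n : ℕ} (π : FreeInv n)

/-- A complement to the centralizer of `nilMat` in the upper triangular matrices. -/
def genC {R : Type*} [CommRing R] (x : Fin (2 * n) × Fin (2 * n) → R) :
    Matrix (Fin (2 * n)) (Fin (2 * n)) R :=
  Matrix.of fun i j =>
    if π.CentPos i j then (if i = j then 1 else 0) else if i ≤ j then x (i, j) else 0

/-- A strictly upper triangular matrix that anticommutes with `nilMat`. -/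
def genZ {R : Type*} [CommRing R] (x : Fin (2 * n) × Fin (2 * n) → R) :
    Matrix (Fin (2 * n)) (Fin (2 * n)) R :=
  centMat π (-1) fun i j => if i = j then 0 else x (i, j)

/-- The entries of a pair of matrices. -/
def pairCoords {m : ℕ} {R : Type*} (A B : Matrix (Fin m) (Fin m) R) :
    (Fin m × Fin m) ⊕ (Fin m × Fin m) → R :=
  Sum.elim (fun p => A p.1 p.2) fun p => B p.1 p.2

/-- The numerators of the coordinates of the point of the slice with parameters `x`. -/
def genNum {R : Type*} [CommRing R] (x : Fin (2 * n) × Fin (2 * n) → R) :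
    (Fin (2 * n) × Fin (2 * n)) ⊕ (Fin (2 * n) × Fin (2 * n)) → R :=
  pairCoords (genC π x * nilMat R π * (genC π x).adjugate)
    (genC π x * ((nilMat R π)ᵀ + genZ π x) * (genC π x).adjugate)

variable {π}

theorem genC_upper {R : Type*} [CommRing R] (x : Fin (2 * n) × Fin (2 * n) → R) :
    (genC π x).BlockTriangular id := fun i j (h : j < i) => by
  simp only [genC, Matrix.of_apply]
  rw [if_neg fun h' => absurd h'.2.1 (not_le.2 h), if_neg (not_le.2 h)]

theorem mapMatrix_nilMat {R R' : Type*} [CommRing R] [CommRing R'] (φ : R →+* R') :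
    φ.mapMatrix (nilMat R π) = nilMat R' π := by
  ext i j
  rw [RingHom.mapMatrix_apply, Matrix.map_apply, nilMat_apply, nilMat_apply]
  split_ifs <;> simp

theorem mapMatrix_genC {R R' : Type*} [CommRing R] [CommRing R'] (φ : R →+* R')
    (x : Fin (2 * n) × Fin (2 * n) → R) : φ.mapMatrix (genC π x) = genC π (φ ∘ x) := by
  ext i j
  simp only [genC, RingHom.mapMatrix_apply, Matrix.map_apply, Matrix.of_apply]
  split_ifs <;> simp

theorem mapMatrix_genZ {R R' : Type*} [CommRing R] [CommRing R'] (φ : R →+* R')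
    (x : Fin (2 * n) × Fin (2 * n) → R) : φ.mapMatrix (genZ π x) = genZ π (φ ∘ x) := by
  ext i j
  simp only [genZ, centMat, RingHom.mapMatrix_apply, Matrix.map_apply, Matrix.of_apply]
  split_ifs <;> simp

theorem map_det_genC {R R' : Type*} [CommRing R] [CommRing R'] (φ : R →+* R')
    (x : Fin (2 * n) × Fin (2 * n) → R) : φ (genC π x).det = (genC π (φ ∘ x)).det := by
  rw [RingHom.map_det, mapMatrix_genC]

theorem map_pairCoords {m : ℕ} {R R' : Type*} [CommRing R] [CommRing R'] (φ : R →+* R')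
    (A B : Matrix (Fin m) (Fin m) R) (s : (Fin m × Fin m) ⊕ (Fin m × Fin m)) :
    φ (pairCoords A B s) = pairCoords (φ.mapMatrix A) (φ.mapMatrix B) s := by
  rcases s with s | s <;> rfl

theorem map_genNum {R R' : Type*} [CommRing R] [CommRing R'] (φ : R →+* R')
    (x : Fin (2 * n) × Fin (2 * n) → R) (s : (Fin (2 * n) × Fin (2 * n)) ⊕ _) :
    φ (genNum π x s) = genNum π (φ ∘ x) s := by
  rw [genNum, map_pairCoords]
  have ht : φ.mapMatrix (nilMat R π)ᵀ = (nilMat R' π)ᵀ := by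
    rw [← mapMatrix_nilMat φ]; rfl
  simp only [map_mul, map_add, mapMatrix_nilMat, mapMatrix_genC, mapMatrix_genZ,
    RingHom.map_adjugate, ht, genNum]

section Field

variable {F : Type*} [Field F]

theorem genNum_div_det (x : Fin (2 * n) × Fin (2 * n) → F) (s : (Fin (2 * n) × Fin (2 * n)) ⊕ _) :
    genNum π x s / (genC π x).det = pairCoords (genC π x * nilMat F π * (genC π x)⁻¹)
      (genC π x * ((nilMat F π)ᵀ + genZ π x) * (genC π x)⁻¹) s := by
  rw [Matrix.inv_def, Ring.inverse_eq_inv', Matrix.mul_smul, Matrix.mul_smul, div_eq_inv_mul]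
  rcases s with s | s <;> rfl

theorem genC_diag_ne_zero {x : Fin (2 * n) × Fin (2 * n) → F} (h : (genC π x).det ≠ 0)
    (i : Fin (2 * n)) : genC π x i i ≠ 0 := by
  rw [Matrix.det_of_isUpperTriangular (genC_upper x)] at h
  exact Finset.prod_ne_zero_iff.1 h i (Finset.mem_univ i)

theorem nilMat_mul_genZ (x : Fin (2 * n) × Fin (2 * n) → F) :
    nilMat F π * genZ π x + genZ π x * nilMat F π = 0 := by
  rw [genZ, centMat_mul_nilMat, neg_one_smul, add_neg_cancel]

theorem strictUpper_genZ (x : Fin (2 * n) × Fin (2 * n) → F) : StrictUpper (genZ π x) :=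
  centMat_strictUpper fun i => by simp

theorem centMat_congr {e : F} {y z : Fin (2 * n) → Fin (2 * n) → F}
    (h : ∀ i j, π.CentPos i j → y i j = z i j) : centMat π e y = centMat π e z := by
  ext i j
  simp only [centMat, Matrix.of_apply]
  split_ifs with h1 h2 h2
  · exact h _ _ h2
  · rfl
  · rw [h _ _ h2.2]
  · rfl

end Field

variable (π) in
/-- The positions of the independent parameters of the slice. -/
abbrev ParPos : Type :=
  {p : Fin (2 * n) × Fin (2 * n) // p.1 ≤ p.2 ∧ (p.1 = p.2 → ¬ π.IsSource p.1)}

/-- The parameters extended by zero. -/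
def extendPar {R : Type*} [CommRing R] (v : ParPos π → R) (p : Fin (2 * n) × Fin (2 * n)) : R := by
  classical exact if h : p.1 ≤ p.2 ∧ (p.1 = p.2 → ¬ π.IsSource p.1) then v ⟨p, h⟩ else 0

theorem extendPar_apply {R : Type*} [CommRing R] (v : ParPos π → R) (p : ParPos π) :
    extendPar v p.1 = v p := dif_pos p.2

theorem comp_extendPar {R R' : Type*} [CommRing R] [CommRing R'] (φ : R →+* R')
    (v : ParPos π → R) : φ ∘ extendPar v = extendPar (φ ∘ v) := by
  ext p
  simp only [extendPar, Function.comp_apply]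
  split_ifs <;> simp

variable (π) in
-- The number of parameters does not depend on `π`: orbit dimension plus fibre dimension is
-- constant. Off-diagonal positions in `CentPos` carry parameters of `genZ`, the remaining upper
-- triangular positions those of `genC`. Only the `n` diagonal positions at smaller elements carry
-- none.
theorem card_parPos_add : Nat.card (ParPos π) + n =
    Nat.card {p : Fin (2 * n) × Fin (2 * n) // p.1 ≤ p.2} := by
  classical
  rw [Nat.card_eq_fintype_card, Nat.card_eq_fintype_card]
  refine (congrArg (_ + ·) π.card_source.symm).trans ?_
  rw [← Fintype.card_sum]
  refine Fintype.card_congr ⟨Sum.elim (fun p => ⟨p.1, p.2.1⟩) fun x => ⟨(x.1, x.1), le_rfl⟩,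
    fun p => if h : p.1.1 = p.1.2 ∧ π.IsSource p.1.1 then Sum.inr ⟨p.1.1, h.2⟩
      else Sum.inl ⟨p.1, p.2, fun e hs => h ⟨e, hs⟩⟩, ?_, ?_⟩
  · rintro (⟨⟨i, j⟩, h⟩ | ⟨x, hx⟩)
    · exact dif_neg fun e => h.2 e.1 e.2
    · exact dif_pos ⟨rfl, hx⟩
  · rintro ⟨⟨i, j⟩, h⟩
    by_cases he : i = j ∧ π.IsSource i
    · obtain ⟨rfl, hi⟩ := he
      simp [hi]
    · simp [he]

variable (π) in
/-- The pairs `(N, Y)` with `N` in the Borel orbit of `nilMat`, `Y` strictly upper triangular and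
`N Y + Y N = 1`. -/
def slice : Set (Matrix (Fin (2 * n)) (Fin (2 * n)) ℂ × Matrix (Fin (2 * n)) (Fin (2 * n)) ℂ) :=
  {p | (∃ b ∈ borel ℂ (2 * n), p.1 = b.1 * nilMat ℂ π * b⁻¹.1) ∧ StrictUpper p.2 ∧
    p.1 * p.2 + p.2 * p.1 = 1}

theorem gen_mem_slice {x : Fin (2 * n) × Fin (2 * n) → ℂ} (h : (genC π x).det ≠ 0) :
    (genC π x * nilMat ℂ π * (genC π x)⁻¹,
      genC π x * ((nilMat ℂ π)ᵀ + genZ π x) * (genC π x)⁻¹) ∈ slice π := by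
  let c : GL (Fin (2 * n)) ℂ := Matrix.GeneralLinearGroup.mkOfDetNeZero _ h
  have hc : c ∈ borel ℂ (2 * n) := mem_borel_iff.2 fun i j hij => genC_upper x hij
  have hcv : c.1 = genC π x := rfl
  have hci : (genC π x)⁻¹ = c⁻¹.1 := by rw [Matrix.coe_units_inv, hcv]
  rw [hci, ← hcv]
  refine ⟨⟨c, hc, rfl⟩, StrictUpper.conj (fun i j hij => ?_) hc, conj_anticomm c ?_⟩
  · rw [Matrix.add_apply, strictUpper_nilMat_transpose ℂ π i j hij, strictUpper_genZ x i j hij,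
      add_zero]
  · have h1 := nilMat_mul_genZ (π := π) x
    have h2 := nilMat_anticomm ℂ π
    rw [mul_add, add_mul, add_add_add_comm, h1, h2, add_zero]

/-- Normalize `b` modulo the centralizer to the shape `genC`. After conjugating back, all solutions
`Y` differ from the transpose of `nilMat` by a strictly upper triangular matrix anticommuting with
`nilMat`, that is, one of the form `genZ`. -/
theorem exists_gen_of_mem_slice {A B : Matrix (Fin (2 * n)) (Fin (2 * n)) ℂ}
    (h : (A, B) ∈ slice π) : ∃ v : ParPos π → ℂ, (genC π (extendPar v)).det ≠ 0 ∧
      A = genC π (extendPar v) * nilMat ℂ π * (genC π (extendPar v))⁻¹ ∧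
      B = genC π (extendPar v) * ((nilMat ℂ π)ᵀ + genZ π (extendPar v)) *
        (genC π (extendPar v))⁻¹ := by
  obtain ⟨⟨b, hb, hA⟩, hB, hAB⟩ := h
  simp only at hA hB hAB
  have hbdet : b.1.det ≠ 0 := (Matrix.isUnits_det_units b).ne_zero
  have hbu : b.1.BlockTriangular id := fun i j hij => mem_borel_iff.1 hb i j hij
  rw [Matrix.det_of_isUpperTriangular hbu] at hbdet
  obtain ⟨a, hau, had, haN, hS⟩ := exists_mul_cent_eq_one π hbu fun i =>
    Finset.prod_ne_zero_iff.1 hbdet i (Finset.mem_univ i)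
  let a' : GL (Fin (2 * n)) ℂ := Matrix.GeneralLinearGroup.mkOfDetNeZero a (by
    rw [Matrix.det_of_isUpperTriangular hau]
    exact Finset.prod_ne_zero_iff.2 fun i _ => had i)
  let c : GL (Fin (2 * n)) ℂ := b * a'
  have hc : c ∈ borel ℂ (2 * n) := mul_mem hb (mem_borel_iff.2 fun i j hij => hau hij)
  have hAc : A = c.1 * nilMat ℂ π * c⁻¹.1 := by
    have h1 : a'.1 * nilMat ℂ π * a'⁻¹.1 = nilMat ℂ π := by
      rw [show a'.1 = a from rfl, haN, Matrix.mul_assoc]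
      have : a * a'⁻¹.1 = 1 := a'.mul_inv
      rw [this, mul_one]
    calc A = b.1 * (a'.1 * nilMat ℂ π * a'⁻¹.1) * b⁻¹.1 := by rw [h1, hA]
      _ = _ := by simp only [c, mul_inv_rev, Units.val_mul, Matrix.mul_assoc]
  have hci : c⁻¹.1 * c.1 = 1 := c.inv_mul
  have hci' : c.1 * c⁻¹.1 = 1 := c.mul_inv
  set Z := c⁻¹.1 * B * c.1 - (nilMat ℂ π)ᵀ with hZ
  have hWu : StrictUpper (c⁻¹.1 * B * c.1) := by
    have := hB.conj (inv_mem hc)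
    rwa [inv_inv] at this
  have hZu : StrictUpper Z := fun i j hij => by
    rw [hZ, Matrix.sub_apply, hWu i j hij, strictUpper_nilMat_transpose ℂ π i j hij, sub_zero]
  have hZN : Z * nilMat ℂ π = (-1 : ℂ) • (nilMat ℂ π * Z) := by
    have h1 := conj_anticomm c⁻¹ hAB
    have h2 : c⁻¹.1 * A * c⁻¹⁻¹.1 = nilMat ℂ π := by
      rw [inv_inv, hAc]
      calc _ = (c⁻¹.1 * c.1) * nilMat ℂ π * (c⁻¹.1 * c.1) := by simp only [Matrix.mul_assoc]
        _ = _ := by rw [hci, one_mul, mul_one]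
    rw [h2, inv_inv, ← nilMat_anticomm ℂ π] at h1
    rw [hZ, neg_one_smul, eq_neg_iff_add_eq_zero, sub_mul, mul_sub]
    rw [← sub_eq_zero] at h1
    rw [← h1]
    abel
  have hZc : Z = centMat π (-1) Z := eq_centMat_of_comm hZN (by norm_num) fun i j hij =>
    hZu i j (le_of_lt hij)
  -- `genC` and `genZ` read disjoint sets of positions, so one family of parameters serves both.
  let v : ParPos π → ℂ := fun p => if π.CentPos p.1.1 p.1.2 then Z p.1.1 p.1.2 else c p.1.1 p.1.2
  have hC : genC π (extendPar v) = c.1 := by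
    ext i j
    simp only [genC, Matrix.of_apply]
    split_ifs with h1 h2 h2
    · rw [show c.1 = b.1 * a from rfl, hS i j h1, h2, Matrix.one_apply_eq]
    · rw [show c.1 = b.1 * a from rfl, hS i j h1, Matrix.one_apply_ne h2]
    · rw [extendPar_apply v ⟨(i, j), h2, ?_⟩]
      · simp only [v, if_neg h1]
      · rintro (rfl : i = j) hs
        exact h1 ⟨hs, le_rfl, fun _ => le_rfl⟩
    · exact (mem_borel_iff.1 hc i j (not_le.1 h2)).symm
  have hZ' : genZ π (extendPar v) = Z := by
    rw [hZc, genZ]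
    refine centMat_congr fun i j hij => ?_
    split_ifs with h1
    · exact (hZu i j h1.ge).symm
    · rw [extendPar_apply v ⟨(i, j), hij.2.1, fun e => (h1 e).elim⟩]
      simp only [v, if_pos hij]
  have hcinv : (c.1)⁻¹ = c⁻¹.1 := (Matrix.coe_units_inv c).symm
  refine ⟨v, ?_, ?_, ?_⟩
  · rw [hC]; exact (Matrix.isUnits_det_units c).ne_zero
  · rw [hC, hcinv, hAc]
  · rw [hC, hcinv, hZ', hZ, add_sub_cancel]
    calc B = (c.1 * c⁻¹.1) * B * (c.1 * c⁻¹.1) := by rw [hci', one_mul, mul_one]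
      _ = _ := by simp only [Matrix.mul_assoc]

end Slice

end SpDual

namespace SpDual

/-! ### The vanishing ideal of a slice as the kernel at its generic point -/

section GenericPoint

variable {n : ℕ}

/-- The rational functions in the parameters of the slice. -/
abbrev ParField (π : FreeInv n) : Type := FractionRing (MvPolynomial (ParPos π) ℂ)

/-- The generic parameters. -/
noncomputable abbrev genX (π : FreeInv n) : Fin (2 * n) × Fin (2 * n) → MvPolynomial (ParPos π) ℂ :=
  extendPar MvPolynomial.X

/-- Evaluation of polynomials in the entries of a pair at the generic point of the slice. -/
noncomputable def genEval (π : FreeInv n) :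
    MvPolynomial ((Fin (2 * n) × Fin (2 * n)) ⊕ (Fin (2 * n) × Fin (2 * n))) ℂ →ₐ[ℂ] ParField π :=
  MvPolynomial.aeval fun s => algebraMap (MvPolynomial (ParPos π) ℂ) (ParField π)
    (genNum π (genX π) s) / algebraMap _ _ (genC π (genX π)).det

theorem eval_comp_genX {π : FreeInv n} (v : ParPos π → ℂ) :
    MvPolynomial.eval v ∘ genX π = extendPar v := by
  rw [genX, comp_extendPar]
  congr 1
  ext p
  simp

theorem det_genC_one_ne_zero (π : FreeInv n) :
    (genC π (extendPar fun _ : ParPos π => (1 : ℂ))).det ≠ 0 := by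
  rw [Matrix.det_of_isUpperTriangular (genC_upper _)]
  refine Finset.prod_ne_zero_iff.2 fun i _ => ?_
  simp only [genC, Matrix.of_apply]
  split_ifs with h1 h2
  · exact one_ne_zero
  · rw [extendPar_apply _ ⟨(i, i), le_rfl, fun _ hs => h1 ⟨hs, le_rfl, fun _ => le_rfl⟩⟩]
    exact one_ne_zero
  · exact absurd le_rfl h2

theorem det_genC_genX_ne_zero (π : FreeInv n) : (genC π (genX π)).det ≠ 0 := fun h => by
  have h1 := map_det_genC (π := π) (MvPolynomial.eval fun _ => (1 : ℂ)) (genX π)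
  rw [h, map_zero, eval_comp_genX] at h1
  exact det_genC_one_ne_zero π h1.symm

theorem genEval_eq_zero_iff {π : FreeInv n}
    {f : MvPolynomial ((Fin (2 * n) × Fin (2 * n)) ⊕ (Fin (2 * n) × Fin (2 * n))) ℂ} :
    genEval π f = 0 ↔ clearDen (genNum π (genX π)) (genC π (genX π)).det f = 0 := by
  have hinj : Function.Injective (algebraMap (MvPolynomial (ParPos π) ℂ) (ParField π)) :=
    IsFractionRing.injective _ _
  have hΔ : algebraMap (MvPolynomial (ParPos π) ℂ) (ParField π) (genC π (genX π)).det ≠ 0 :=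
    (map_ne_zero_iff _ hinj).2 (det_genC_genX_ne_zero π)
  have h := aeval_mul_pow_eq_clearDen
    (IsScalarTower.toAlgHom ℂ (MvPolynomial (ParPos π) ℂ) (ParField π)) (genNum π (genX π)) hΔ f
  have h1 : genEval π f * _ = algebraMap _ (ParField π) _ := h
  rw [← (map_eq_zero_iff _ hinj), ← h1, mul_eq_zero]
  exact ⟨Or.inl, fun e => e.resolve_right (pow_ne_zero _ hΔ)⟩

theorem eval_pair_mul_pow {π : FreeInv n} {v : ParPos π → ℂ}
    (hv : (genC π (extendPar v)).det ≠ 0)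
    (f : MvPolynomial ((Fin (2 * n) × Fin (2 * n)) ⊕ (Fin (2 * n) × Fin (2 * n))) ℂ) :
    MvPolynomial.eval (pairCoords
      (genC π (extendPar v) * nilMat ℂ π * (genC π (extendPar v))⁻¹)
      (genC π (extendPar v) * ((nilMat ℂ π)ᵀ + genZ π (extendPar v)) *
        (genC π (extendPar v))⁻¹)) f * (genC π (extendPar v)).det ^ f.totalDegree =
      MvPolynomial.eval v (clearDen (genNum π (genX π)) (genC π (genX π)).det f) := by
  have hd := map_det_genC (π := π) (MvPolynomial.eval v) (genX π)
  rw [eval_comp_genX] at hd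
  have h := aeval_mul_pow_eq_clearDen (MvPolynomial.aeval v) (genNum π (genX π))
    (Δ := (genC π (genX π)).det) (by
      rw [MvPolynomial.aeval_eq_eval, hd]; exact hv) f
  simp only [MvPolynomial.aeval_eq_eval, hd] at h
  rw [← h]
  congr 3
  ext s
  rw [map_genNum, eval_comp_genX, genNum_div_det]

theorem genEval_eq_zero_iff_slice {π : FreeInv n}
    {f : MvPolynomial ((Fin (2 * n) × Fin (2 * n)) ⊕ (Fin (2 * n) × Fin (2 * n))) ℂ} :
    genEval π f = 0 ↔ ∀ p ∈ slice π, MvPolynomial.eval (pairCoords p.1 p.2) f = 0 := by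
  rw [genEval_eq_zero_iff]
  constructor
  · rintro h ⟨A, B⟩ hp
    obtain ⟨v, hv, rfl, rfl⟩ := exists_gen_of_mem_slice hp
    have h1 := eval_pair_mul_pow hv f
    rw [h, map_zero] at h1
    exact (mul_eq_zero.1 h1).resolve_right (pow_ne_zero _ hv)
  · intro h
    -- Parameters with vanishing determinant give no point of the slice; multiplying by the
    -- determinant gives a polynomial that vanishes at all parameters.
    refine (mul_eq_zero.1 ?_).resolve_right (det_genC_genX_ne_zero π)
    refine MvPolynomial.funext fun v => ?_
    rw [map_mul, map_zero]
    by_cases hv : (genC π (extendPar v)).det = 0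
    · rw [map_det_genC, eval_comp_genX, hv, mul_zero]
    · rw [← eval_pair_mul_pow hv f, h _ (gen_mem_slice hv), zero_mul, zero_mul]

end GenericPoint

/-! ### The parameters are rational functions of the generic point -/

section Generation

variable {n : ℕ} {K : Type*} [Field K]

/-- Applied entrywise, an `F`-linear retraction turns a solution of a linear system over `F` into a
solution in `F`; a unique solution therefore lies in `F`. -/
theorem exists_retraction {k : Type*} [Field k] [Algebra k K] (F : IntermediateField k K) :
    ∃ r : K →+ K, (∀ z, r z ∈ F) ∧ (∀ z ∈ F, r z = z) ∧ ∀ a ∈ F, ∀ z, r (a * z) = a * r z := by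
  obtain ⟨g, hg⟩ := LinearMap.exists_leftInverse_of_injective (Algebra.linearMap F K)
    (LinearMap.ker_eq_bot.2 (algebraMap F K).injective)
  refine ⟨((Algebra.linearMap F K) ∘ₗ g).toAddMonoidHom, fun z => (g z).2, fun z hz => ?_,
    fun a ha z => ?_⟩
  · exact congrArg Subtype.val (LinearMap.congr_fun hg ⟨z, hz⟩)
  · exact ((Algebra.linearMap F K) ∘ₗ g).map_smul ⟨a, ha⟩ z

/-- With `N'` the conjugated matrix, `C` is the only upper triangular solution of `C * nilMat = N' *
C` with the given constants at the positions `CentPos`. This system has coefficients in `F`. -/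
theorem genC_mem_of_conj_mem {k : Type*} [Field k] [Algebra k K] {F : IntermediateField k K}
    {π : FreeInv n} {x : Fin (2 * n) × Fin (2 * n) → K} (hx : (genC π x).det ≠ 0)
    (hF : ∀ i j, (genC π x * nilMat K π * (genC π x)⁻¹) i j ∈ F) (i j : Fin (2 * n)) :
    genC π x i j ∈ F := by
  obtain ⟨r, hrF, hr1, hrm⟩ := exists_retraction F
  set C := genC π x with hC
  have hCi : C * C⁻¹ = 1 := Matrix.mul_nonsing_inv _ (isUnit_iff_ne_zero.2 hx)
  have hCi' : C⁻¹ * C = 1 := Matrix.nonsing_inv_mul _ (isUnit_iff_ne_zero.2 hx)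
  set N' := C * nilMat K π * C⁻¹ with hN'
  have h0 : C * nilMat K π = N' * C := by rw [hN', Matrix.mul_assoc, hCi', mul_one]
  have h1 : C.map r * nilMat K π = N' * C.map r := by
    ext a c
    have h2 := congrArg r (congrFun (congrFun h0 a) c)
    rw [mul_nilMat_apply] at h2 ⊢
    rw [Matrix.mul_apply, map_sum] at h2
    simp only [hrm _ (hF _ _)] at h2
    rw [Matrix.mul_apply]
    simp only [Matrix.map_apply]
    rw [← h2]
    split_ifs <;> simp
  have hCu : C.BlockTriangular id := genC_upper x
  have hCru : (C.map r).BlockTriangular id := fun a c hac => by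
    rw [Matrix.map_apply, hCu hac, map_zero]
  have hinvu : C⁻¹.BlockTriangular id := by
    have : Invertible C := Matrix.invertibleOfIsUnitDet _ (isUnit_iff_ne_zero.2 hx)
    exact Matrix.blockTriangular_inv_of_blockTriangular hCu
  have ha : C⁻¹ * (C - C.map r) = 0 := by
    refine eq_zero_of_centPos (π := π) hCu (genC_diag_ne_zero hx) (hinvu.mul (hCu.sub hCru)) ?_
      fun a c hac => ?_
    · rw [Matrix.mul_assoc, sub_mul, h0, h1, ← mul_sub, hN']
      calc _ = (C⁻¹ * C) * nilMat K π * C⁻¹ * (C - C.map r) := by simp only [Matrix.mul_assoc]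
        _ = _ := by rw [hCi', one_mul, Matrix.mul_assoc]
    · rw [← Matrix.mul_assoc, hCi, one_mul, Matrix.sub_apply, Matrix.map_apply, hC]
      simp only [genC, Matrix.of_apply, if_pos hac]
      rw [hr1, sub_self]
      split_ifs
      · exact one_mem F
      · exact zero_mem F
  have h3 : C = C.map r := by
    have := congrArg (C * ·) ha
    simp only [← Matrix.mul_assoc, hCi, one_mul, mul_zero] at this
    exact sub_eq_zero.1 this
  rw [h3]
  exact hrF _

theorem mem_of_mul_mem {k : Type*} [Field k] [Algebra k K] {F : IntermediateField k K} {m : ℕ}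
    {C W : Matrix (Fin m) (Fin m) K} (hC : C.det ≠ 0) (hCF : ∀ i j, C i j ∈ F)
    (h : ∀ i j, (C * W) i j ∈ F) (i j : Fin m) : W i j ∈ F := by
  obtain ⟨r, hrF, hr1, hrm⟩ := exists_retraction F
  have h1 : C * W.map r = C * W := by
    ext a c
    rw [← hr1 _ (h a c), Matrix.mul_apply, Matrix.mul_apply, map_sum]
    simp only [hrm _ (hCF _ _), Matrix.map_apply]
  have hCi' : C⁻¹ * C = 1 := Matrix.nonsing_inv_mul _ (isUnit_iff_ne_zero.2 hC)
  have h2 := congrArg (C⁻¹ * ·) h1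
  simp only [← Matrix.mul_assoc, hCi', one_mul] at h2
  rw [← h2]
  exact hrF _

/-- First `C` and then the conjugated back second matrix have entries in `F`, and each parameter is
an entry of one of them, up to a constant summand. -/
theorem parameter_mem {k : Type*} [Field k] [Algebra k K] {F : IntermediateField k K}
    {π : FreeInv n} {v : ParPos π → K} (hv : (genC π (extendPar v)).det ≠ 0)
    (h : ∀ s, pairCoords (genC π (extendPar v) * nilMat K π * (genC π (extendPar v))⁻¹)
      (genC π (extendPar v) * ((nilMat K π)ᵀ + genZ π (extendPar v)) *
        (genC π (extendPar v))⁻¹) s ∈ F) (p : ParPos π) : v p ∈ F := by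
  have hC := genC_mem_of_conj_mem hv fun i j => h (Sum.inl (i, j))
  have hCi' : (genC π (extendPar v))⁻¹ * genC π (extendPar v) = 1 :=
    Matrix.nonsing_inv_mul _ (isUnit_iff_ne_zero.2 hv)
  have hW := mem_of_mul_mem (W := (nilMat K π)ᵀ + genZ π (extendPar v)) hv hC fun i j => by
    have h1 : genC π (extendPar v) * ((nilMat K π)ᵀ + genZ π (extendPar v)) =
        (genC π (extendPar v) * ((nilMat K π)ᵀ + genZ π (extendPar v)) *
          (genC π (extendPar v))⁻¹) * genC π (extendPar v) := by
      rw [Matrix.mul_assoc _ _ (genC π (extendPar v)), hCi', mul_one]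
    rw [h1, Matrix.mul_apply]
    exact sum_mem fun l _ => mul_mem (h (Sum.inr (i, l))) (hC l j)
  obtain ⟨⟨i, j⟩, hij, hs⟩ := p
  by_cases hcp : π.CentPos i j
  · have hne : i ≠ j := by
      rintro rfl
      exact hs rfl hcp.1
    have h1 := hW i j
    rw [Matrix.add_apply, genZ, centMat_apply_of_centPos hcp, if_neg hne,
      extendPar_apply v ⟨(i, j), hij, hs⟩] at h1
    refine (add_mem_cancel_left ?_).1 h1
    rw [Matrix.transpose_apply, nilMat_apply]
    split_ifs
    · exact one_mem F
    · exact zero_mem F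
  · have h1 := hC i j
    simp only [genC, Matrix.of_apply, if_neg hcp] at h1
    rwa [if_pos hij, extendPar_apply v ⟨(i, j), hij, hs⟩] at h1

/-- The coordinates of the generic point generate the whole field of rational functions in the
parameters, so the parametrization is birational and the transcendence degree counts parameters. -/
theorem isAlgebraic_genEval (π : FreeInv n) : Algebra.IsAlgebraic
    (Algebra.adjoin ℂ (Set.range fun s => genEval π (MvPolynomial.X s))) (ParField π) := by
  set S := Set.range fun s => genEval π (MvPolynomial.X s) with hS
  let φ := algebraMap (MvPolynomial (ParPos π) ℂ) (ParField π)
  have hinj : Function.Injective φ := IsFractionRing.injective _ _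
  let v : ParPos π → ParField π := fun p => φ (MvPolynomial.X p)
  have hx : φ ∘ genX π = extendPar v := comp_extendPar φ _
  have hdet := map_det_genC (π := π) φ (genX π)
  rw [hx] at hdet
  have hv : (genC π (extendPar v)).det ≠ 0 := by
    rw [← hdet]
    exact (map_ne_zero_iff _ hinj).2 (det_genC_genX_ne_zero π)
  let F := IntermediateField.adjoin ℂ S
  have hX : ∀ p, v p ∈ F := parameter_mem hv fun s => by
    rw [← genNum_div_det, ← hx, ← map_genNum, hx, ← hdet]
    refine IntermediateField.subset_adjoin ℂ S ⟨s, ?_⟩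
    simp only [genEval, MvPolynomial.aeval_X]
    rfl
  have hpoly : ∀ q, φ q ∈ F := fun q => by
    induction q using MvPolynomial.induction_on with
    | C a => exact F.algebraMap_mem a
    | add p q hp hq => rw [map_add]; exact add_mem hp hq
    | mul_X p i hp => rw [map_mul]; exact mul_mem hp (hX i)
  refine ⟨fun z => ?_⟩
  have hz : z ∈ F := by
    obtain ⟨a, b, -, rfl⟩ := IsFractionRing.div_surjective (A := MvPolynomial (ParPos π) ℂ) z
    exact div_mem (hpoly a) (hpoly b)
  obtain ⟨a, ha, b, hb, rfl⟩ := IntermediateField.mem_adjoin_iff_div.1 hz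
  have hmem : ∀ c ∈ Algebra.adjoin ℂ S, IsAlgebraic (Algebra.adjoin ℂ S) c := fun c hc =>
    isAlgebraic_algebraMap (⟨c, hc⟩ : Algebra.adjoin ℂ S)
  rw [div_eq_mul_inv]
  exact (hmem a ha).mul (hmem b hb).inv

theorem trdeg_parField (π : FreeInv n) :
    Algebra.trdeg ℂ (ParField π) = Nat.card (ParPos π) := by
  rw [trdeg_fractionRing_mvPolynomial, Nat.cast_card]

end Generation

/-! ### Slices of different orbits -/

section SliceOrder

variable {n : ℕ}

theorem nilMat_mem_slice (π : FreeInv n) : (nilMat ℂ π, (nilMat ℂ π)ᵀ) ∈ slice π :=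
  ⟨⟨1, one_mem _, by simp⟩, strictUpper_nilMat_transpose ℂ π, nilMat_anticomm ℂ π⟩

theorem exists_poly_minor (T : Finset (Fin (2 * n) × Fin (2 * n))) :
    ∃ q : MvPolynomial ((Fin (2 * n) × Fin (2 * n)) ⊕ (Fin (2 * n) × Fin (2 * n))) ℂ,
      ∀ A B : Matrix (Fin (2 * n)) (Fin (2 * n)) ℂ, MvPolynomial.eval (pairCoords A B) q =
        (A.submatrix (fun t : T => t.1.1) (fun t : T => t.1.2)).det := by
  refine ⟨(Matrix.of fun t t' : T => MvPolynomial.X (Sum.inl (t.1.1, t'.1.2))).det,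
    fun A B => ?_⟩
  rw [RingHom.map_det]
  congr 1
  ext t t'
  simp [pairCoords]

theorem card_corner_le_of_slice {π π' : FreeInv n} (h : ∀ f,
      (∀ p ∈ slice π', MvPolynomial.eval (pairCoords p.1 p.2) f = 0) →
        ∀ p ∈ slice π, MvPolynomial.eval (pairCoords p.1 p.2) f = 0)
    {R C : Finset (Fin (2 * n))} (hR : ∀ i ∈ R, ∀ x, i ≤ x → x ∈ R)
    (hC : ∀ j ∈ C, ∀ y, y ≤ j → y ∈ C) :
    (entries (nilMat ℂ π) ∩ R ×ˢ C).card ≤ (entries (nilMat ℂ π') ∩ R ×ˢ C).card := by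
  refine card_corner_le (hasNilShape_nilMat π).isPartialMonomial fun T hT => ?_
  obtain ⟨q, hq⟩ := exists_poly_minor T
  have hvan : ∀ p ∈ slice π', MvPolynomial.eval (pairCoords p.1 p.2) q = 0 := by
    rintro ⟨A, B⟩ hp
    obtain ⟨b, hb, hA⟩ := hp.1
    rw [hq, show A = b.1 * nilMat ℂ π' * b⁻¹.1 from hA]
    refine hT b.1 b⁻¹.1 (fun i hi x hx => ?_) fun j hj y hy => ?_
    · exact mem_borel_iff.1 hb i x (not_le.1 fun hle => hx (hR i hi x hle))
    · exact mem_borel_iff.1 (inv_mem hb) y j (not_le.1 fun hle => hy (hC j hj y hle))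
  have h1 := h q hvan _ (nilMat_mem_slice π)
  rwa [hq] at h1

/-- Irreducible sets of equal dimension, one in the closure of the other, have the same vanishing
ideal; minors of the first matrix then give the same corner counts. -/
theorem eq_of_slice_le {π π' : FreeInv n} (h : ∀ f,
      (∀ p ∈ slice π', MvPolynomial.eval (pairCoords p.1 p.2) f = 0) →
        ∀ p ∈ slice π, MvPolynomial.eval (pairCoords p.1 p.2) f = 0) : π = π' := by
  have hcard : Nat.card (ParPos π) = Nat.card (ParPos π') :=
    Nat.add_right_cancel ((card_parPos_add π).trans (card_parPos_add π').symm)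
  have h' : ∀ f, (∀ p ∈ slice π, MvPolynomial.eval (pairCoords p.1 p.2) f = 0) →
      ∀ p ∈ slice π', MvPolynomial.eval (pairCoords p.1 p.2) f = 0 := by
    simp only [← genEval_eq_zero_iff_slice] at h ⊢
    intro f hf
    refine ker_eq_of_trdeg_le (isAlgebraic_genEval π) ?_ ?_ h hf
    · rw [trdeg_parField]; exact Cardinal.natCast_lt_aleph0
    · rw [trdeg_parField, trdeg_parField, hcard]
  exact eq_of_entries_nilMat (eq_of_card_corner_eq true fun _ _ hR hC => le_antisymm
    (card_corner_le_of_slice h hR (by simpa using hC))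
    (card_corner_le_of_slice h' hR (by simpa using hC)))

end SliceOrder

end SpDual

namespace SpDual

/-! ### Rational maps and irreducibility in the Zariski topology -/

theorem continuous_zariski_of_frac {k : Type*} [Field k] {σ E σ' E' : Type*} {c : E → σ → k}
    {c' : E' → σ' → k} {f : E → E'} (num : σ' → MvPolynomial σ k) {Δ : MvPolynomial σ k}
    (hΔ : ∀ x, MvPolynomial.eval (c x) Δ ≠ 0)
    (h : ∀ x s, c' (f x) s = MvPolynomial.eval (c x) (num s) / MvPolynomial.eval (c x) Δ) :
    Continuous[zariski k c, zariski k c'] f := by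
  let _ := zariski k c
  refine continuous_generateFrom_iff.2 ?_
  rintro _ ⟨p, rfl⟩
  refine TopologicalSpace.isOpen_generateFrom_of_mem ⟨clearDen num Δ p, ?_⟩
  ext x
  have h1 := aeval_mul_pow_eq_clearDen (MvPolynomial.aeval (c x)) num (Δ := Δ) (hΔ x) p
  simp only [MvPolynomial.aeval_eq_eval] at h1
  have h2 : c' (f x) = fun s => MvPolynomial.eval (c x) (num s) / MvPolynomial.eval (c x) Δ :=
    funext (h x)
  simp only [Set.mem_preimage, Set.mem_ofPred_eq, h2]
  rw [← h1, mul_ne_zero_iff]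
  exact ⟨fun e => ⟨e, pow_ne_zero _ (hΔ x)⟩, fun e => e.1⟩

/-- If no nonzero polynomial vanishes on `E`, two basic open sets meet because the product of their
polynomials is nonzero. -/
theorem isIrreducible_univ_zariski {k : Type*} [Field k] {σ E : Type*} {c : E → σ → k}
    (h : ∀ p : MvPolynomial σ k, p ≠ 0 → ∃ x, MvPolynomial.eval (c x) p ≠ 0) :
    @IsIrreducible E (zariski k c) Set.univ := by
  let _ := zariski k c
  refine ⟨?_, ?_⟩
  · obtain ⟨x, -⟩ := h 1 one_ne_zero
    exact ⟨x, trivial⟩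
  · rintro U V hU hV ⟨x, -, hx⟩ ⟨y, -, hy⟩
    obtain ⟨p, hp, hpU⟩ := exists_poly_of_isOpen_zariski hU hx
    obtain ⟨q, hq, hqV⟩ := exists_poly_of_isOpen_zariski hV hy
    obtain ⟨z, hz⟩ := h (p * q) (mul_ne_zero (fun e => hp (by rw [e, map_zero]))
      fun e => hq (by rw [e, map_zero]))
    rw [map_mul] at hz
    exact ⟨z, trivial, hpU z (left_ne_zero_of_mul hz), hqV z (right_ne_zero_of_mul hz)⟩

theorem adjugate_coe {k : Type*} [Field k] {m : ℕ} (g : GL (Fin m) k) :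
    g.1.adjugate = g.1.det • g⁻¹.1 := by
  have h1 : g.1.adjugate = g.1.adjugate * (g.1 * g⁻¹.1) := by rw [g.mul_inv, mul_one]
  rw [h1, ← Matrix.mul_assoc, Matrix.adjugate_mul]
  simp

section Components

variable {n : ℕ}

/-! ### The strata of `Λ` -/

/-- The points of `Λ` over the relevant orbit of `π`. -/
def stratum (π : FreeInv n) : Set (Lam n) := {p | flagOrbit (H n) (tau p) = flagEquiv (orbH π)}

theorem iUnion_stratum : ⋃ π : FreeInv n, stratum π = Set.univ := by
  refine Set.eq_univ_of_forall fun p => Set.mem_iUnion.2 ?_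
  obtain ⟨π, hπ⟩ := exists_eq_orbH (O := flagEquiv.symm (flagOrbit (H n) (tau p))) (by
    rw [Equiv.apply_symm_apply]; exact ⟨p, rfl⟩)
  exact ⟨π, (flagEquiv.symm_apply_eq).1 hπ⟩

theorem flagOrbit_mk_eq (g₁ g₂ : GL (Fin (2 * n)) ℂ) :
    flagOrbit (H n) (QuotientGroup.mk g₁, QuotientGroup.mk g₂) =
      flagEquiv (borelOrbit (H n) (QuotientGroup.mk (g₂⁻¹ * g₁))) := by
  rw [flagEquiv_borelOrbit]
  refine Quotient.sound' ⟨g₂, ?_⟩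
  refine Prod.ext ?_ ?_
  · change (QuotientGroup.mk (g₂ * (g₂⁻¹ * g₁)) : GL (Fin (2 * n)) ℂ ⧸ H n) = QuotientGroup.mk g₁
    rw [mul_inv_cancel_left]
  · change (QuotientGroup.mk (g₂ * 1) : GL (Fin (2 * n)) ℂ ⧸ borel ℂ (2 * n)) = QuotientGroup.mk g₂
    rw [mul_one]

theorem flagOrbit_mk_eq_orbH_iff {π : FreeInv n} {g₁ g₂ : GL (Fin (2 * n)) ℂ} :
    flagOrbit (H n) (QuotientGroup.mk g₁, QuotientGroup.mk g₂) = flagEquiv (orbH π) ↔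
      ∃ b ∈ borel ℂ (2 * n), g₂⁻¹.1 * conjN g₁ * g₂.1 = b.1 * nilMat ℂ π * b⁻¹.1 := by
  rw [flagOrbit_mk_eq, flagEquiv.injective.eq_iff, orbH, borelOrbit_mk_eq_iff_conjN, conjN_mul,
    conjN_reprH, inv_inv]

theorem mem_slice_of_mem_stratum {π : FreeInv n} {g₁ g₂ : GL (Fin (2 * n)) ℂ}
    {φ : Module.Dual ℂ (Matrix (Fin (2 * n)) (Fin (2 * n)) ℂ)}
    (h : ((QuotientGroup.mk g₁, QuotientGroup.mk g₂, φ) : Ambient n) ∈ Lam n)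
    (hπ : flagOrbit (H n) (QuotientGroup.mk g₁, QuotientGroup.mk g₂) = flagEquiv (orbH π)) :
    (g₂⁻¹.1 * conjN g₁ * g₂.1, g₂⁻¹.1 * dualMatrix φ * g₂.1) ∈ slice π := by
  obtain ⟨h1, h2⟩ := mem_Lam_iff.1 h
  refine ⟨flagOrbit_mk_eq_orbH_iff.1 hπ, h2, ?_⟩
  have := conj_anticomm g₂⁻¹ h1
  rwa [inv_inv] at this

/-! ### Closed conditions on `Λ` -/

/-- The pair of matrices of a triple, moved to the standard flag. -/
noncomputable def triplePair (p : GL (Fin (2 * n)) ℂ × GL (Fin (2 * n)) ℂ ×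
    Module.Dual ℂ (Matrix (Fin (2 * n)) (Fin (2 * n)) ℂ)) :
    Matrix (Fin (2 * n)) (Fin (2 * n)) ℂ × Matrix (Fin (2 * n)) (Fin (2 * n)) ℂ :=
  (p.2.1⁻¹.1 * conjN p.1 * p.2.1.1, p.2.1⁻¹.1 * dualMatrix p.2.2 * p.2.1.1)

theorem continuous_triplePair : Continuous[zariskiTriple n,
    zariski ℂ (fun p : Matrix (Fin (2 * n)) (Fin (2 * n)) ℂ × Matrix (Fin (2 * n)) (Fin (2 * n)) ℂ =>
      pairCoords p.1 p.2)] (triplePair (n := n)) := by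
  let R := MvPolynomial ((Fin (2 * n) × Fin (2 * n)) ⊕ (Fin (2 * n) × Fin (2 * n)) ⊕
      (Fin (2 * n) × Fin (2 * n))) ℂ
  let G₁ : Matrix (Fin (2 * n)) (Fin (2 * n)) R :=
    Matrix.of fun i j => MvPolynomial.X (Sum.inl (i, j))
  let G₂ : Matrix (Fin (2 * n)) (Fin (2 * n)) R :=
    Matrix.of fun i j => MvPolynomial.X (Sum.inr (Sum.inl (i, j)))
  let Y : Matrix (Fin (2 * n)) (Fin (2 * n)) R :=
    Matrix.of fun i j => MvPolynomial.X (Sum.inr (Sum.inr (j, i)))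
  let N₀ : Matrix (Fin (2 * n)) (Fin (2 * n)) R := (nilBase n).map MvPolynomial.C
  let c : GL (Fin (2 * n)) ℂ × GL (Fin (2 * n)) ℂ ×
      Module.Dual ℂ (Matrix (Fin (2 * n)) (Fin (2 * n)) ℂ) → _ → ℂ := fun p =>
    Sum.elim (fun ij : Fin (2 * n) × Fin (2 * n) => p.1 ij.1 ij.2)
      (Sum.elim (fun ij : Fin (2 * n) × Fin (2 * n) => p.2.1 ij.1 ij.2)
        (fun ij : Fin (2 * n) × Fin (2 * n) => p.2.2 (Matrix.single ij.1 ij.2 1)))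
  have hG₁ : ∀ p, (MvPolynomial.eval (c p)).mapMatrix G₁ = p.1.1 := fun p => by
    ext i j; simp [G₁, c]
  have hG₂ : ∀ p, (MvPolynomial.eval (c p)).mapMatrix G₂ = p.2.1.1 := fun p => by
    ext i j; simp [G₂, c]
  have hY : ∀ p, (MvPolynomial.eval (c p)).mapMatrix Y = dualMatrix p.2.2 := fun p => by
    ext i j; simp [Y, c, dualMatrix]
  have hN₀ : ∀ p, (MvPolynomial.eval (c p)).mapMatrix N₀ = nilBase n := fun p => by
    ext i j; simp [N₀]
  have hdet : ∀ p, MvPolynomial.eval (c p) (G₁.det * G₂.det) = p.1.1.det * p.2.1.1.det := fun p => by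
    rw [map_mul, RingHom.map_det, RingHom.map_det, hG₁, hG₂]
  have hne : ∀ g : GL (Fin (2 * n)) ℂ, g.1.det ≠ 0 := fun g =>
    (Matrix.isUnits_det_units g).ne_zero
  -- Both matrices are put over the common denominator `det g₁ * det g₂`, whence the additional
  -- factor in the second numerator.
  refine continuous_zariski_of_frac (c := c) (pairCoords
    (G₂.adjugate * (G₁ * N₀ * G₁.adjugate) * G₂) (G₁.det • (G₂.adjugate * Y * G₂)))
    (Δ := G₁.det * G₂.det) (fun p => ?_) fun p s => ?_
  · rw [hdet]
    exact mul_ne_zero (hne _) (hne _)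
  · rw [hdet, map_pairCoords, ← smul_one_mul G₁.det]
    have hsm : (MvPolynomial.eval (c p)).mapMatrix (G₁.det • (1 : Matrix _ _ R)) =
        p.1.1.det • (1 : Matrix (Fin (2 * n)) (Fin (2 * n)) ℂ) := by
      rw [Matrix.smul_one_eq_diagonal, Matrix.smul_one_eq_diagonal, ← hG₁ p, ← RingHom.map_det]
      ext i j
      by_cases hij : i = j <;> simp [hij]
    simp only [map_mul, RingHom.map_adjugate, hG₁, hG₂, hY, hN₀, hsm, adjugate_coe]
    rw [eq_div_iff (mul_ne_zero (hne _) (hne _))]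
    rcases s with s | s <;>
      simp [pairCoords, triplePair, conjN] <;> ring

/-- The points of the ambient space at all of whose representatives `f` vanishes. -/
def vanishingSet (f : MvPolynomial ((Fin (2 * n) × Fin (2 * n)) ⊕ (Fin (2 * n) × Fin (2 * n))) ℂ) :
    Set (Ambient n) :=
  {p | ∀ g₁ g₂, p.1 = QuotientGroup.mk g₁ → p.2.1 = QuotientGroup.mk g₂ →
    MvPolynomial.eval (pairCoords (triplePair (g₁, g₂, p.2.2)).1
      (triplePair (g₁, g₂, p.2.2)).2) f = 0}

/-- The pair depends on `g₁` only through its coset, so the preimage of the set is an intersection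
of translates of a closed set by elements of `B` acting on `g₂`. -/
theorem isClosed_vanishingSet
    (f : MvPolynomial ((Fin (2 * n) × Fin (2 * n)) ⊕ (Fin (2 * n) × Fin (2 * n))) ℂ) :
    IsClosed[zariskiAmbient n] (vanishingSet f) := by
  rw [isClosed_coinduced]
  let V := {p : GL (Fin (2 * n)) ℂ × GL (Fin (2 * n)) ℂ ×
    Module.Dual ℂ (Matrix (Fin (2 * n)) (Fin (2 * n)) ℂ) |
      MvPolynomial.eval (pairCoords (triplePair p).1 (triplePair p).2) f = 0}
  have hV : IsClosed[zariskiTriple n] V :=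
    @IsClosed.preimage _ _ (zariskiTriple n) (zariski ℂ _) _ continuous_triplePair _
      (isClosed_zariski_zeroLocus (fun p : Matrix (Fin (2 * n)) (Fin (2 * n)) ℂ ×
        Matrix (Fin (2 * n)) (Fin (2 * n)) ℂ => pairCoords p.1 p.2) f)
  have hmul : ∀ b : GL (Fin (2 * n)) ℂ, Continuous[zariskiTriple n, zariskiTriple n]
      fun p => (p.1, p.2.1 * b, p.2.2) := fun b => by
    refine continuous_zariski fun s => ?_
    rcases s with s | s | s
    · exact ⟨MvPolynomial.X (Sum.inl s), fun p => by simp⟩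
    · exact ⟨∑ l, MvPolynomial.X (Sum.inr (Sum.inl (s.1, l))) * MvPolynomial.C (b l s.2),
        fun p => by simp [Matrix.mul_apply]⟩
    · exact ⟨MvPolynomial.X (Sum.inr (Sum.inr s)), fun p => by simp⟩
  have heq : (fun p : GL (Fin (2 * n)) ℂ × GL (Fin (2 * n)) ℂ ×
        Module.Dual ℂ (Matrix (Fin (2 * n)) (Fin (2 * n)) ℂ) =>
      ((QuotientGroup.mk p.1, QuotientGroup.mk p.2.1, p.2.2) : Ambient n)) ⁻¹' vanishingSet f =
      ⋂ b ∈ borel ℂ (2 * n), (fun p => (p.1, p.2.1 * b, p.2.2)) ⁻¹' V := by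
    ext ⟨g₁, g₂, φ⟩
    simp only [Set.mem_preimage, Set.mem_iInter]
    constructor
    · intro h b hb
      exact h g₁ (g₂ * b) rfl (QuotientGroup.mk_mul_of_mem g₂ hb).symm
    · intro h γ₁ γ₂ h1 h2
      have h3 : g₂⁻¹ * γ₂ ∈ borel ℂ (2 * n) := QuotientGroup.eq.1 h2
      have h4 : MvPolynomial.eval (pairCoords (triplePair (g₁, g₂ * (g₂⁻¹ * γ₂), φ)).1
        (triplePair (g₁, g₂ * (g₂⁻¹ * γ₂), φ)).2) f = 0 := h _ h3
      rw [mul_inv_cancel_left] at h4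
      have h5 : triplePair (γ₁, γ₂, φ) = triplePair (g₁, γ₂, φ) := by
        simp only [triplePair, mk_eq_mk_iff_conjN.1 h1]
      change MvPolynomial.eval (pairCoords (triplePair (γ₁, γ₂, φ)).1
        (triplePair (γ₁, γ₂, φ)).2) f = 0
      rw [h5]
      exact h4
  rw [heq]
  let _ := zariskiTriple n
  exact isClosed_biInter fun b _ => hV.preimage (hmul b)

/-- A polynomial that vanishes on the slice of `π'` defines a closed set containing its stratum,
hence the stratum of `π`. Placing points of the slice of `π` over the standard flag shows that the
polynomial vanishes there as well. -/
theorem eq_of_closure_stratum_subset {π π' : FreeInv n}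
    (h : closure[zariskiLam n] (stratum π) ⊆ closure[zariskiLam n] (stratum π')) : π = π' := by
  refine eq_of_slice_le fun f hf => ?_
  rintro ⟨A, B⟩ ⟨⟨b, hb, hA⟩, hB, hAB⟩
  simp only at hA hB hAB
  have hconj : conjN (b * reprH π) = A := by rw [conjN_mul, conjN_reprH, hA]
  have hcl : IsClosed[zariskiLam n] (Subtype.val ⁻¹' vanishingSet f : Set (Lam n)) :=
    @IsClosed.preimage _ _ (zariskiLam n) (zariskiAmbient n) _ continuous_induced_dom _
      (isClosed_vanishingSet f)
  have hsub : stratum π' ⊆ Subtype.val ⁻¹' vanishingSet f := by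
    rintro ⟨⟨y, z, φ⟩, hp⟩ hπ g₁ g₂ h1 h2
    obtain rfl : y = QuotientGroup.mk g₁ := h1
    obtain rfl : z = QuotientGroup.mk g₂ := h2
    exact hf _ (mem_slice_of_mem_stratum hp hπ)
  have hmem : ((QuotientGroup.mk (b * reprH π), QuotientGroup.mk 1, traceDual B) : Ambient n) ∈
      Lam n := mem_Lam_iff.2 (by
    rw [dualMatrix_traceDual, hconj]
    exact ⟨hAB, by simpa using hB⟩)
  have hstr : (⟨_, hmem⟩ : Lam n) ∈ stratum π := flagOrbit_mk_eq_orbH_iff.2 ⟨b, hb, by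
    rw [hconj, hA]; simp⟩
  have h1 : (⟨_, hmem⟩ : Lam n) ∈ closure[zariskiLam n] (stratum π) :=
    @subset_closure _ (zariskiLam n) _ _ hstr
  have h2 : (⟨_, hmem⟩ : Lam n) ∈ (Subtype.val ⁻¹' vanishingSet f : Set (Lam n)) := by
    let _ := zariskiLam n
    exact closure_minimal hsub hcl (h h1)
  have h3 := h2 _ _ rfl rfl
  simpa [triplePair, hconj, dualMatrix_traceDual] using h3

/-! ### The strata are irreducible -/

theorem exists_genZ_of_anticomm {π : FreeInv n} {W : Matrix (Fin (2 * n)) (Fin (2 * n)) ℂ}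
    (hW : StrictUpper W) (h : nilMat ℂ π * W + W * nilMat ℂ π = 1) :
    ∃ x, W = (nilMat ℂ π)ᵀ + genZ π x := by
  set Z := W - (nilMat ℂ π)ᵀ with hZ
  have hZu : StrictUpper Z := fun i j hij => by
    rw [hZ, Matrix.sub_apply, hW i j hij, strictUpper_nilMat_transpose ℂ π i j hij, sub_zero]
  have hZN : Z * nilMat ℂ π = (-1 : ℂ) • (nilMat ℂ π * Z) := by
    rw [← nilMat_anticomm ℂ π, ← sub_eq_zero] at h
    rw [hZ, neg_one_smul, eq_neg_iff_add_eq_zero, sub_mul, mul_sub, ← h]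
    abel
  have hZc : Z = centMat π (-1) Z := eq_centMat_of_comm hZN (by norm_num) fun i j hij =>
    hZu i j (le_of_lt hij)
  refine ⟨fun p => Z p.1 p.2, ?_⟩
  have h1 : genZ π (fun p => Z p.1 p.2) = Z := by
    refine Eq.trans (centMat_congr fun i j _ => ?_) hZc.symm
    split_ifs with h1
    · exact (hZu i j h1.ge).symm
    · rfl
  rw [h1, hZ, add_sub_cancel]

/-- The parameter space of a stratum. -/
abbrev StratumPar (n : ℕ) : Type := GL (Fin (2 * n)) ℂ × (Fin (2 * n) × Fin (2 * n) → ℂ)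

/-- The Zariski topology on the parameter space. -/
noncomputable abbrev zariskiPar (n : ℕ) : TopologicalSpace (StratumPar n) :=
  zariski ℂ fun p => Sum.elim (fun ij : Fin (2 * n) × Fin (2 * n) => p.1 ij.1 ij.2) p.2

theorem isIrreducible_univ_par (n : ℕ) :
    @IsIrreducible (StratumPar n) (zariskiPar n) Set.univ := by
  refine isIrreducible_univ_zariski fun p hp => ?_
  let G : Matrix (Fin (2 * n)) (Fin (2 * n))
      (MvPolynomial ((Fin (2 * n) × Fin (2 * n)) ⊕ (Fin (2 * n) × Fin (2 * n))) ℂ) :=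
    Matrix.of fun i j => MvPolynomial.X (Sum.inl (i, j))
  have hG : ∀ v, MvPolynomial.eval v G.det = (Matrix.of fun i j => v (Sum.inl (i, j))).det := by
    intro v
    rw [RingHom.map_det]
    congr 1
    ext i j
    simp [G]
  have hG0 : G.det ≠ 0 := fun e => by
    have h1 := hG (Sum.elim (fun ij => (1 : Matrix (Fin (2 * n)) (Fin (2 * n)) ℂ) ij.1 ij.2) 0)
    rw [e, map_zero] at h1
    have h2 : (Matrix.of fun i j => (1 : Matrix (Fin (2 * n)) (Fin (2 * n)) ℂ) i j) = 1 := rfl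
    simp only [Sum.elim_inl] at h1
    rw [h2, Matrix.det_one] at h1
    exact zero_ne_one h1
  -- The factor `G.det` ensures that the matrix part of the point found is invertible.
  obtain ⟨v, hv⟩ : ∃ v, MvPolynomial.eval v (p * G.det) ≠ 0 := by
    by_contra! hall
    exact mul_ne_zero hp hG0 (MvPolynomial.funext fun v => by rw [hall, map_zero])
  rw [map_mul, hG] at hv
  refine ⟨(Matrix.GeneralLinearGroup.mkOfDetNeZero _ (right_ne_zero_of_mul hv),
    fun ij => v (Sum.inr ij)), ?_⟩
  convert left_ne_zero_of_mul hv using 3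
  ext s
  rcases s with s | s <;> rfl

/-- The parametrization of a stratum. -/
noncomputable def stratumMap (π : FreeInv n) (p : StratumPar n) :
    GL (Fin (2 * n)) ℂ × GL (Fin (2 * n)) ℂ ×
      Module.Dual ℂ (Matrix (Fin (2 * n)) (Fin (2 * n)) ℂ) :=
  (p.1 * reprH π, p.1, traceDual (p.1.1 * ((nilMat ℂ π)ᵀ + genZ π p.2) * p.1⁻¹.1))

theorem continuous_stratumMap (π : FreeInv n) :
    Continuous[zariskiPar n, zariskiTriple n] (stratumMap π) := by
  let R := MvPolynomial ((Fin (2 * n) × Fin (2 * n)) ⊕ (Fin (2 * n) × Fin (2 * n))) ℂ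
  let G : Matrix (Fin (2 * n)) (Fin (2 * n)) R :=
    Matrix.of fun i j => MvPolynomial.X (Sum.inl (i, j))
  let W : Matrix (Fin (2 * n)) (Fin (2 * n)) R :=
    (nilMat R π)ᵀ + genZ π fun p => MvPolynomial.X (Sum.inr p)
  let c : StratumPar n → _ → ℂ := fun p =>
    Sum.elim (fun ij : Fin (2 * n) × Fin (2 * n) => p.1 ij.1 ij.2) p.2
  have hG : ∀ p, (MvPolynomial.eval (c p)).mapMatrix G = p.1.1 := fun p => by
    ext i j; simp [G, c]
  have hW : ∀ p, (MvPolynomial.eval (c p)).mapMatrix W = (nilMat ℂ π)ᵀ + genZ π p.2 := fun p => by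
    have h1 : MvPolynomial.eval (c p) ∘ (fun q => MvPolynomial.X (Sum.inr q)) = p.2 := by
      ext q
      simp [c]
    rw [map_add, mapMatrix_genZ, h1, ← mapMatrix_nilMat (MvPolynomial.eval (c p))]
    rfl
  have hdet : ∀ p, MvPolynomial.eval (c p) G.det = p.1.1.det := fun p => by
    rw [RingHom.map_det, hG]
  have hne : ∀ g : GL (Fin (2 * n)) ℂ, g.1.det ≠ 0 := fun g =>
    (Matrix.isUnits_det_units g).ne_zero
  let r : Matrix (Fin (2 * n)) (Fin (2 * n)) R := (reprH π).1.map MvPolynomial.C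
  refine continuous_zariski_of_frac (c := c) (Sum.elim (fun ij => G.det * (G * r) ij.1 ij.2)
    (Sum.elim (fun ij => G.det * G ij.1 ij.2) fun ij => (G * W * G.adjugate) ij.2 ij.1))
    (Δ := G.det) (fun p => ?_) fun p s => ?_
  · rw [hdet]; exact hne _
  · rw [hdet, eq_div_iff (hne _)]
    rcases s with s | s | s
    · simp only [Sum.elim_inl, map_mul, hdet]
      rw [mul_comm]
      congr 1
      simp [stratumMap, Matrix.mul_apply, G, r, c]
    · simp only [Sum.elim_inl, Sum.elim_inr, map_mul, hdet]
      rw [mul_comm]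
      congr 1
      simp [stratumMap, G, c]
    · simp only [Sum.elim_inr]
      have h1 : MvPolynomial.eval (c p) ((G * W * G.adjugate) s.2 s.1) =
          ((MvPolynomial.eval (c p)).mapMatrix (G * W * G.adjugate)) s.2 s.1 := rfl
      rw [h1, map_mul, map_mul, RingHom.map_adjugate, hG, hW, adjugate_coe, Matrix.mul_smul,
        Matrix.smul_apply, smul_eq_mul, mul_comm]
      congr 1
      exact congrFun (congrFun (dualMatrix_traceDual
        (p.1.1 * ((nilMat ℂ π)ᵀ + genZ π p.2) * p.1⁻¹.1)) s.2) s.1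

theorem conj_inv_conj {k : Type*} [Field k] {m : ℕ} (g : GL (Fin m) k)
    (A : Matrix (Fin m) (Fin m) k) : g⁻¹.1 * (g.1 * A * g⁻¹.1) * g.1 = A := by
  have h : g⁻¹.1 * g.1 = 1 := g.inv_mul
  calc _ = (g⁻¹.1 * g.1) * A * (g⁻¹.1 * g.1) := by simp only [Matrix.mul_assoc]
    _ = A := by rw [h, one_mul, mul_one]

theorem stratumMap_mem_Lam (π : FreeInv n) (p : StratumPar n) :
    ((QuotientGroup.mk (stratumMap π p).1, QuotientGroup.mk (stratumMap π p).2.1,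
      (stratumMap π p).2.2) : Ambient n) ∈ Lam n := by
  refine mem_Lam_iff.2 ?_
  simp only [stratumMap, dualMatrix_traceDual, conjN_mul, conjN_reprH, conj_inv_conj]
  constructor
  · refine conj_anticomm p.1 ?_
    rw [mul_add, add_mul, add_add_add_comm, nilMat_mul_genZ, nilMat_anticomm, add_zero]
  · intro i j hij
    rw [Matrix.add_apply, strictUpper_nilMat_transpose ℂ π i j hij, strictUpper_genZ _ i j hij,
      add_zero]

/-- The stratum is the continuous image of the irreducible space `StratumPar n`. For surjectivity,
adjust the representative of the flag by an element of `B` so that the first matrix becomes `nilMat`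
exactly; the second is then given by some `genZ`. -/
theorem isIrreducible_stratum (π : FreeInv n) : @IsIrreducible (Lam n) (zariskiLam n) (stratum π) := by
  let F : StratumPar n → Lam n := fun p => ⟨_, stratumMap_mem_Lam π p⟩
  have hF : Continuous[zariskiPar n, zariskiLam n] F :=
    continuous_induced_rng.2 (@Continuous.comp _ _ _ (zariskiPar n) (zariskiTriple n)
      (zariskiAmbient n) _ _ continuous_coinduced_rng (continuous_stratumMap π))
  have himg : F '' Set.univ = stratum π := by
    rw [Set.image_univ]
    ext ⟨⟨y, z, φ⟩, hp⟩
    constructor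
    · rintro ⟨p, hp'⟩
      rw [← hp']
      refine flagOrbit_mk_eq_orbH_iff.2 ⟨1, one_mem _, ?_⟩
      simp only [stratumMap, conjN_mul, conjN_reprH, conj_inv_conj]
      simp
    · intro hπ
      induction y using QuotientGroup.induction_on with | H g₁ => ?_
      induction z using QuotientGroup.induction_on with | H g₂ => ?_
      obtain ⟨⟨b, hb, hA⟩, hB, hAB⟩ := mem_slice_of_mem_stratum hp hπ
      simp only at hA hB hAB
      have h1 : nilMat ℂ π = b⁻¹.1 * (g₂⁻¹.1 * conjN g₁ * g₂.1) * b.1 := by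
        rw [hA, conj_inv_conj]
      have hu := hB.conj (inv_mem hb)
      have hc := conj_anticomm b⁻¹ hAB
      rw [inv_inv] at hu hc
      rw [← h1] at hc
      obtain ⟨x, hx⟩ := exists_genZ_of_anticomm hu hc
      refine ⟨(g₂ * b, x), Subtype.ext ?_⟩
      have hg : ∀ A : Matrix (Fin (2 * n)) (Fin (2 * n)) ℂ,
          (g₂ * b).1 * (b⁻¹.1 * (g₂⁻¹.1 * A * g₂.1) * b.1) * (g₂ * b)⁻¹.1 = A := fun A => by
        have := conj_inv_conj (g₂ * b)⁻¹ A
        rw [inv_inv] at this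
        nth_rw 2 [← this]
        simp only [mul_inv_rev, Units.val_mul, Matrix.mul_assoc]
      refine Prod.ext ?_ (Prod.ext ?_ ?_)
      · refine mk_eq_mk_iff_conjN.2 ?_
        simp only [stratumMap]
        rw [conjN_mul, conjN_reprH, h1, hg]
      · exact QuotientGroup.mk_mul_of_mem g₂ hb
      · change traceDual ((g₂ * b).1 * ((nilMat ℂ π)ᵀ + genZ π x) * (g₂ * b)⁻¹.1) = φ
        rw [← hx, hg, traceDual_dualMatrix]
  rw [← himg]
  exact @IsIrreducible.image _ _ (zariskiPar n) (zariskiLam n) _ (isIrreducible_univ_par n) F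
    (@Continuous.continuousOn _ _ (zariskiPar n) (zariskiLam n) _ _ hF)

theorem ncard_irreducibleComponents_Lam (n : ℕ) :
    (@irreducibleComponents (Lam n) (zariskiLam n)).ncard = Nat.doubleFactorial (2 * n - 1) := by
  let _ := zariskiLam n
  have : Finite (FreeInv n) := Subtype.finite
  have hcov : ⋃ π : FreeInv n, closure (stratum π) = Set.univ :=
    Set.eq_univ_of_univ_subset (iUnion_stratum.symm.subset.trans
      (Set.iUnion_mono fun π => subset_closure))
  rw [irreducibleComponents_eq_range (fun π : FreeInv n => (isIrreducible_stratum π).closure)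
    (fun _ => isClosed_closure) hcov fun _ _ h => eq_of_closure_stratum_subset h,
    ← Set.image_univ, Set.ncard_image_of_injective _ fun π π' h =>
      eq_of_closure_stratum_subset (Eq.subset h), Set.ncard_univ, card_freeInv]

end Components

end SpDual

/-! ### Assembly of the statements -/

theorem proposition3 (n : ℕ) (k : Type*) [Field k] [Infinite k] :
    -- both sides are indexed by the perfect matchings
    (∀ O : SpDual.BorelOrbits (SpDual.Sp k n), ∃! P, SpDual.LabelX O P) ∧
    (∀ P : SpDual.Matching n, ∃! O : SpDual.BorelOrbits (SpDual.Sp k n), SpDual.LabelX O P) ∧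
    (∀ O : SpDual.RelevantOrbits n, ∃! P, SpDual.LabelR O P) ∧
    (∀ P : SpDual.Matching n, ∃! O : SpDual.RelevantOrbits n, SpDual.LabelR O P) ∧
    -- the counts
    Nat.card (SpDual.BorelOrbits (SpDual.Sp k n)) = Nat.doubleFactorial (2 * n - 1) ∧
    Nat.card (SpDual.RelevantOrbits n) = Nat.doubleFactorial (2 * n - 1) ∧
    (@irreducibleComponents (SpDual.Lam n) (SpDual.zariskiLam n)).ncard = Nat.doubleFactorial (2 * n - 1) ∧
    -- the map `Φ_X`, determined by the matchings
    ∃ Φ : SpDual.BorelOrbits (SpDual.Sp k n) → SpDual.RelevantOrbits n,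
      (∀ O P, SpDual.LabelX O P ↔ SpDual.LabelR (Φ O) P) ∧
      Function.Bijective Φ ∧
      -- simple reflections define actions of `W`, and `Φ_X` intertwines them
      (∃ (ρX : Equiv.Perm (Fin (2 * n)) →*
              Equiv.Perm (SpDual.BorelOrbits (SpDual.Sp k n)))
          (ρR : Equiv.Perm (Fin (2 * n)) →* Equiv.Perm (SpDual.RelevantOrbits n)),
        (∀ i O, ρX (SpDual.simpleRefl i) O = SpDual.knopRefl i O) ∧
        (∀ i O, ρR (SpDual.simpleRefl i) O = SpDual.starRefl i O) ∧
        ∀ w O, Φ (ρX w O) = ρR w (Φ O)) ∧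
      -- `Φ_X` reverses the weak Bruhat order
      ∀ O O', SpDual.WeakLE O O' ↔ SpDual.RelevantLE (Φ O') (Φ O) := by
  open SpDual in
  -- In these coordinates `Φ` is the identity of `FreeInv n` and both actions are conjugation.
  let eX := orbitEquivX k n
  let eR := orbitEquivR n
  refine ⟨fun O => ?_, fun P => ?_, fun O => ?_, fun P => ?_, ?_, ?_, ?_,
    eX.symm.trans eR, fun O P => ?_, Equiv.bijective _, ⟨transportAction eX, transportAction eR,
      fun i O => ?_, fun i O => ?_, fun w O => ?_⟩, fun O O' => ?_⟩
  · obtain ⟨π, rfl⟩ := eX.surjective O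
    exact existsUnique_eq_apply (matchingEquiv n) fun P => labelX_orbitEquivX
  · refine existsUnique_eq_apply eX.symm (b := matchingEquiv n P) fun O => ?_
    obtain ⟨π, rfl⟩ := eX.surjective O
    rw [labelX_orbitEquivX, Equiv.symm_apply_apply, eq_comm]
  · obtain ⟨π, rfl⟩ := eR.surjective O
    exact existsUnique_eq_apply (matchingEquiv n) fun P => labelR_orbitEquivR
  · refine existsUnique_eq_apply eR.symm (b := matchingEquiv n P) fun O => ?_
    obtain ⟨π, rfl⟩ := eR.surjective O
    rw [labelR_orbitEquivR, Equiv.symm_apply_apply, eq_comm]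
  · rw [← Nat.card_congr eX, card_freeInv]
  · rw [← Nat.card_congr eR, card_freeInv]
  · exact ncard_irreducibleComponents_Lam n
  · obtain ⟨π, rfl⟩ := eX.surjective O
    rw [labelX_orbitEquivX, Equiv.trans_apply, Equiv.symm_apply_apply, labelR_orbitEquivR]
  · obtain ⟨π, rfl⟩ := eX.surjective O
    rw [transportAction_apply]
    exact (knopRefl_orbX i π).symm
  · obtain ⟨π, rfl⟩ := eR.surjective O
    rw [transportAction_apply]
    exact (starRefl_orbitEquivR i π).symm
  · obtain ⟨π, rfl⟩ := eX.surjective O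
    simp only [Equiv.trans_apply, transportAction_apply, Equiv.symm_apply_apply]
  · obtain ⟨π, rfl⟩ := eX.surjective O
    obtain ⟨π', rfl⟩ := eX.surjective O'
    simp only [Equiv.trans_apply, Equiv.symm_apply_apply, RelevantLE]
    rw [flagEquiv_symm_orbitEquivR, flagEquiv_symm_orbitEquivR, weakLE_orbH_iff]
    exact weakLE_orbX_iff
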